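/- Identify a language $A\subseteq\{0,1\}^*$ with its characteristic sequence in the Cantor space $\mathbf C=\{0,1\}^\infty$ with respect to the standard enumeration of strings $\lambda,0,1,00,01,\dots$; write $S\upharpoonright n$ for the $n$-bit prefix of $S\in\mathbf C$ and $\log$ for $\log_2$. For a bound $s$, let $\mathrm{SIZE}_{\mathrm{i.o.}}(s(n))$ be the class of all languages $A$ such that for infinitely many $n$ the set $A_{=n}=A\cap\{0,1\}^n$ is decided by an $n$-input Boolean circuit with at most $s(n)$ gates (constants, NOT, and fan-in-two AND and OR gates). A SpanP function $f(x)$ counts the distinct strings output, over all computation paths, by a polynomial-time probabilistic Turing machine that on each path outputs a string or nothing. A SpanP-martingale is a function $d:\{0,1\}^*\to[0,\infty)$ with $d(w)=\frac{d(w0)+d(w1)}2$ for all $w$, for which there are a SpanP function $f$ and a polynomial-time computable function $g$, all of whose values are powers of $2$, with $\left|d(w)-\frac{f(w,r)}{g(w,r)}\right|\le 2^{-r}$ for all $w\in\{0,1\}^*$ and $r\in\mathbb N$ ($r$ given in unary). A class $X\subseteq\mathbf C$ has SpanP-measure $0$ if there is a SpanP-martingale $d$ with $\limsup_{n\to\infty}d(S\upharpoonright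 n)=\infty$ for every $S\in X$. A class $X\subseteq\mathbf C$ has $\mathcal M_{\mathrm{NP}}$-measure $0$ (NP-entropy-rate measure $0$) if there are a language $A\in\mathrm{NP}$ and a polynomial-time computable $f:\mathbb N\to\mathbb N$ (argument in unary) such that every $S\in X$ has infinitely many prefixes in $A$; $\log|A_{=n}|<n-f(n)$ for all sufficiently large $n$ (with $\log 0=-\infty$); and $\sum_{n}2^{-f(n)}$ is p-convergent, i.e. it converges and there is a polynomial-time computable $m:\mathbb N\to\mathbb N$ (argument and value in unary) with $\sum_{n\ge m(i)}2^{-f(n)}\le 2^{-i}$ for all $i$. **Theorem.** For every real $\alpha<1$, the class $$\mathrm{SIZE}_{\mathrm{i.o.}}\!\left(\frac{2^n}{n}\left(1+\frac{\alpha\log n}{n}\right)\right)$$ has SpanP-measure $0$, and it has $\mathcal M_{\mathrm{NP}}$-measure $0$. -/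

import Mathlib

noncomputable section

namespace CountingMeasure

open Filter Computability

/-! ### Strings, languages, Cantor space -/

/-- Finite binary strings. -/
abbrev Str := List Bool

/-- Languages (decision problems). -/
abbrev Lang := Set Str

/-- Infinite binary sequences. -/
abbrev Cantor := ℕ → Bool

/-- The `i`-th binary string in the standard (length-lexicographic) enumeration
`λ, 0, 1, 00, 01, 10, 11, 000, …`: the binary expansion of `i + 1`, most significant bit first,
without its leading `1`. -/
def stdString (i : ℕ) : Str := (Nat.bits (i + 1)).dropLast.reverse

open Classical in
/-- The characteristic sequence of a language. -/
def charSeq (A : Lang) : Cantor := fun i => decide (stdString i ∈ A)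

/-- The class of sequences identified with a class of languages. -/
def toCantor (X : Set Lang) : Set Cantor := charSeq '' X

/-- The `n`-bit prefix of an infinite sequence. -/
def prefixOf (S : Cantor) (n : ℕ) : Str := (List.range n).map S

/-! ### Boolean circuits -/

/-- A gate whose inputs are taken from `m` available wires. -/
inductive Gate (m : ℕ) : Type
  | const (b : Bool) : Gate m
  | not (i : Fin m) : Gate m
  | and (i j : Fin m) : Gate m
  | or (i j : Fin m) : Gate m

/-- The value of a gate, given the values of the available wires. -/
def Gate.eval {m : ℕ} (v : Fin m → Bool) : Gate m → Bool
  | .const b => b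
  | .not i => !(v i)
  | .and i j => v i && v j
  | .or i j => v i || v j

/-- `GateSeq n s`: a list of `s` gates over `n` inputs, in topological order. The wires available
to a gate are the `n` inputs followed by all earlier gates. -/
inductive GateSeq (n : ℕ) : ℕ → Type
  | nil : GateSeq n 0
  | snoc {s : ℕ} (P : GateSeq n s) (g : Gate (n + s)) : GateSeq n (s + 1)

/-- The values of all wires (inputs first, then gates) on input `x`. -/
def GateSeq.wires {n : ℕ} (x : Fin n → Bool) : {s : ℕ} → GateSeq n s → (Fin (n + s) → Bool)
  | _, .nil => x
  | _, .snoc P g => Fin.snoc (α := fun _ => Bool) (P.wires x) (g.eval (P.wires x))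

/-- A Boolean circuit with `n` inputs: a sequence of gates and an output wire. -/
structure Circuit (n : ℕ) where
  /-- the number of gates -/
  size : ℕ
  /-- the gates -/
  gates : GateSeq n size
  /-- the output wire -/
  out : Fin (n + size)

/-- The Boolean function computed by a circuit. -/
def Circuit.eval {n : ℕ} (C : Circuit n) (x : Fin n → Bool) : Bool := C.gates.wires x C.out

/-- `C` decides `A_{=n}`. -/
def Circuit.Decides {n : ℕ} (C : Circuit n) (A : Lang) : Prop :=
  ∀ x : Fin n → Bool, C.eval x = true ↔ List.ofFn x ∈ A

/-- The languages `A` such that, for infinitely many `n`, some circuit with at most `s n` gates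
decides `A_{=n}`. -/
def SIZEio (s : ℕ → ℝ) : Set Lang :=
  {A | ∃ᶠ n in atTop, ∃ C : Circuit n, (C.size : ℝ) ≤ s n ∧ C.Decides A}

/-! ### Polynomial time, NP, SpanP -/

/-- `f` is computable by a Turing machine in time polynomial in the length of the encoded input
(the class FP, for functions between encoded types). -/
def PolyTime {α β Γ₁ Γ₂ : Type} (ea : Encoding α Γ₁) (eb : Encoding β Γ₂) (f : α → β) : Prop :=
  Nonempty (Turing.TM2ComputableInPolyTime ea.encode eb.encode f)

/-- Encoding of the result of a transducer: the empty string for "no output", and `1y` for the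
output string `y`. -/
def encodingOutput : Encoding (Option Str) Bool where
  encode
    | none => []
    | some y => true :: y
  decode
    | [] => some none
    | _ :: y => some (some y)
  decode_encode x := by cases x <;> rfl

/-- The class NP. -/
def NP : Set Lang :=
  {L | ∃ (p : Polynomial ℕ) (V : Str × Str → Bool),
    PolyTime (encodingProd (encodingList Bool) (encodingList Bool)) encodingBoolBool V ∧
    ∀ x, x ∈ L ↔ ∃ u : Str, u.length = p.eval x.length ∧ V (x, u) = true}

/-- `f` is a SpanP function: `f x` is the number of distinct strings that a polynomial-time
probabilistic Turing machine outputs on `x`. The machine is a polynomial-time machine `M` with an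
auxiliary string `u` of `p(|x|)` random bits; a computation path is a choice of `u`, and on each
path the machine outputs a string or nothing. -/
def IsSpanP {α Γ : Type} (e : Encoding α Γ) (f : α → ℕ) : Prop :=
  ∃ (p : Polynomial ℕ) (M : α × Str → Option Str),
    PolyTime (encodingProd e (encodingList Bool)) encodingOutput M ∧
    ∀ x, f x = Set.ncard {y : Str |
      ∃ u : Str, u.length = p.eval (e.encode x).length ∧ M (x, u) = some y}

/-! ### Counting martingales and SpanP-measure -/

/-- Martingales on binary strings. -/
def IsMartingale (d : Str → ℝ) : Prop :=
  (∀ w, 0 ≤ d w) ∧ ∀ w, d w = (d (w ++ [false]) + d (w ++ [true])) / 2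

/-- The success set `S^∞[d]`. -/
def successSet (d : Str → ℝ) : Set Cantor :=
  {S | limsup (fun n => ((d (prefixOf S n) : ℝ) : EReal)) atTop = ⊤}

/-- The encoding of pairs `(w, r)`, with `r` in unary. -/
abbrev encodingStrUnary : Encoding (Str × ℕ) (Bool ⊕ Bool) :=
  encodingProd (encodingList Bool) unaryEncodingNat

/-- SpanP-martingales: martingales approximable within `2^{-r}` by the ratio of a SpanP function
and an FP function whose values (written in binary) are powers of two. -/
def IsSpanPMartingale (d : Str → ℝ) : Prop :=
  IsMartingale d ∧ ∃ f g : Str × ℕ → ℕ,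
    IsSpanP encodingStrUnary f ∧
    PolyTime encodingStrUnary encodingNatBool g ∧
    (∀ w r, ∃ k : ℕ, g (w, r) = 2 ^ k) ∧
    ∀ w r, |d w - (f (w, r) : ℝ) / (g (w, r) : ℝ)| ≤ ((2 : ℝ) ^ r)⁻¹

/-- `X` has SpanP-measure 0. -/
def SpanPMeasureZero (X : Set Cantor) : Prop :=
  ∃ d : Str → ℝ, IsSpanPMartingale d ∧ X ⊆ successSet d

/-! ### Entropy rate measure -/

/-- The i.o.-class of a language: the sequences with infinitely many prefixes in `A`. -/
def ioClass (A : Lang) : Set Cantor := {S | ∃ᶠ n in atTop, prefixOf S n ∈ A}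

/-- The series of nonnegative reals `∑ a n` is p-convergent: it converges, with a polynomial-time
modulus of convergence `m` (natural numbers in unary). -/
def PConvergent (a : ℕ → ℝ) : Prop :=
  (∀ n, 0 ≤ a n) ∧ Summable a ∧ ∃ m : ℕ → ℕ, PolyTime unaryEncodingNat unaryEncodingNat m ∧
    ∀ i : ℕ, ∑' n, a (n + m i) ≤ ((2 : ℝ) ^ i)⁻¹

/-- `X` has entropy rate measure 0 with respect to the class of languages `C`. The condition
`log |A_{=n}| < n - f n` is written as `|A_{=n}| < 2 ^ (n - f n)`, so that it holds when `A_{=n}`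
is empty. -/
def EntropyRateMeasureZero (C : Set Lang) (X : Set Cantor) : Prop :=
  ∃ A ∈ C, ∃ f : ℕ → ℕ, PolyTime unaryEncodingNat encodingNatBool f ∧
    X ⊆ ioClass A ∧
    (∀ᶠ n : ℕ in atTop,
      (Set.ncard {x : Str | x ∈ A ∧ x.length = n} : ℝ) < (2 : ℝ) ^ ((n : ℤ) - (f n : ℤ))) ∧
    PConvergent fun n => ((2 : ℝ) ^ f n)⁻¹

end CountingMeasure

end

/-! The strings of length `n` occupy the `2 ^ n` positions from `2 ^ n - 1` on in a characteristic
sequence, so this block is a truth table. Call it cheap if some straight-line program of AND gates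
with free negation computes it with `s` gates, where `cost s ≤ 2 ^ n`. Here `cost s` is a sum of bit
lengths that exceeds the logarithm of `s!` by about `10 * s`. Unlike the size bound, it does not
mention the real number `α`, so a machine can compute it.

Two facts carry the theorem. First, a circuit within the size bound yields a cheap table for all
large `n` (`eventually_cost_le`, `Circuit.mem_tables`): `log s` is at most `n - log n + 1`, and the
gain `-log n` beats `α log n` because `α < 1`. Second, cheap tables are rare: for `n ≥ 24` their
proportion is at most `2 ^ -(2 ^ ((n + 5) / 2) + 1)` (`ncard_tables_mul_le`). There are about `s ^
(2 * s)` programs up to a factor exponential in `s`, but renaming the gates of a repetition-free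
program gives `s!` different descriptions of one function. So only about `s!` functions remain, up
to such a factor, and the constant 10 in the cost absorbs it.

For the NP entropy rate, the language consists of the strings whose last complete block is cheap,
with a gate list as witness. Among strings of length `N` their proportion is below `2 ^ -f(N)` for a
function `f` of order `√N`, which makes the series p-convergent.

For SpanP, the martingale `mart` is the conditional expectation of the number of cheap blocks. It
tends to infinity along every sequence with infinitely many cheap blocks. To approximate it, a
machine guesses an extension of `w` and a gate list, and outputs the extended string marked with the
block that was verified. Different gate lists for the same block give the same output, so counting
distinct outputs counts pairs of a block and an extension, as the expectation requires.

The machines are written in a small stack language whose compilation to `Turing.FinTM2` is verified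
once (`Prog.polyTime`). -/

noncomputable section

/-! ### A structured programming language for polynomial time. -/

namespace CountingMeasure

open Filter Computability

/-! ### Stack programs -/

/-- Structured programs over an input stack with alphabet `Γ` and Boolean stacks indexed
by `κ`. -/
inductive Prog (κ Γ : Type) : Type
  | skip : Prog κ Γ
  | push (k : κ) (b : Bool) : Prog κ Γ
  | seq (p q : Prog κ Γ) : Prog κ Γ
  | pop (k : κ) (p : Option Bool → Prog κ Γ) : Prog κ Γ
  | loop (k : κ) (p : Bool → Prog κ Γ) : Prog κ Γ
  | input (p : Γ → Prog κ Γ) : Prog κ Γ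

namespace Prog

variable {κ Γ : Type}

/-- The memory of a stack program: the input stack and the Boolean stacks. -/
abbrev Mem (κ Γ : Type) : Type := List Γ × (κ → List Bool)

/-- `Run p s t s'`: started in memory `s`, the program `p` ends in memory `s'` after at most `t`
steps. -/
inductive Run [DecidableEq κ] : Prog κ Γ → Mem κ Γ → ℕ → Mem κ Γ → Prop
  | skip (s) : Run skip s 1 s
  | push (k b i S) : Run (push k b) (i, S) 1 (i, Function.update S k (b :: S k))
  | seq {p q s t s' t' s''} : Run p s t s' → Run q s' t' s'' → Run (seq p q) s (t + t') s''
  | pop {k p i S t s'} : Run (p (S k).head?) (i, Function.update S k (S k).tail) t s' →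
      Run (pop k p) (i, S) (t + 1) s'
  | loop_nil {k p i S} : S k = [] → Run (loop k p) (i, S) 1 (i, S)
  | loop_cons {k p i S b l t s' t' s''} : S k = b :: l →
      Run (p b) (i, Function.update S k l) t s' → Run (loop k p) s' t' s'' →
      Run (loop k p) (i, S) (1 + t + t') s''
  | input_nil {p S} : Run (input p) ([], S) 1 ([], S)
  | input_cons {p a i S t s' t' s''} :
      Run (p a) (i, S) t s' → Run (input p) s' t' s'' → Run (input p) (a :: i, S) (1 + t + t') s''
  | le {p s t t' s'} : Run p s t s' → t ≤ t' → Run p s t' s'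

/-- Labels of the compiled program. -/
def Lab : Prog κ Γ → Type
  | skip => Unit
  | push _ _ => Unit
  | seq p q => Lab p ⊕ Lab q
  | pop _ p => Option (Σ o, Lab (p o))
  | loop _ p => Option (Σ b, Lab (p b))
  | input p => Option (Σ a, Lab (p a))

instance instFintypeLab [Fintype Γ] : ∀ p : Prog κ Γ, Fintype (Lab p)
  | skip => inferInstanceAs (Fintype Unit)
  | push _ _ => inferInstanceAs (Fintype Unit)
  | seq p q =>
    haveI := instFintypeLab p
    haveI := instFintypeLab q
    inferInstanceAs (Fintype (Lab p ⊕ Lab q))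
  | pop _ p =>
    haveI := fun o => instFintypeLab (p o)
    inferInstanceAs (Fintype (Option (Σ o, Lab (p o))))
  | loop _ p =>
    haveI := fun o => instFintypeLab (p o)
    inferInstanceAs (Fintype (Option (Σ o, Lab (p o))))
  | input p =>
    haveI := fun o => instFintypeLab (p o)
    inferInstanceAs (Fintype (Option (Σ o, Lab (p o))))

/-- The first label of a compiled program. -/
def entry : ∀ p : Prog κ Γ, Lab p
  | skip => ()
  | push _ _ => ()
  | seq p _ => Sum.inl (entry p)
  | pop _ _ => (none : Option _)
  | loop _ _ => (none : Option _)
  | input _ => (none : Option _)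

/-- The alphabets of the compiled machine. -/
abbrev Alph (κ Γ : Type) : Option κ → Type
  | none => Γ
  | some _ => Bool

/-- The internal states of the compiled machine: the symbols read last. -/
abbrev Reg (Γ : Type) : Type := Option Bool × Option Γ

open Turing.TM2 in
/-- The statements of the compiled program; `next` is the label to go to at the end. -/
def code {Λ : Type} : ∀ p : Prog κ Γ, (Lab p → Λ) → Λ → Lab p → Stmt (Alph κ Γ) Λ (Reg Γ)
  | skip, _, next, _ => .goto fun _ => next
  | push k b, _, next, _ => .push (some k) (fun _ => b) (.goto fun _ => next)
  | seq p q, emb, next, l =>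
    match l with
    | Sum.inl l => code p (fun l => emb (Sum.inl l)) (emb (Sum.inr (entry q))) l
    | Sum.inr l => code q (fun l => emb (Sum.inr l)) next l
  | pop k p, emb, next, l =>
    match l with
    | none => .pop (some k) (fun v o => (o, v.2)) (.goto fun v => emb (some ⟨v.1, entry (p v.1)⟩))
    | some ⟨o, l⟩ => code (p o) (fun l => emb (some ⟨o, l⟩)) next l
  | loop k p, emb, next, l =>
    match l with
    | none => .pop (some k) (fun v o => (o, v.2)) (.goto fun v =>
        v.1.elim next fun b => emb (some ⟨b, entry (p b)⟩))
    | some ⟨b, l⟩ => code (p b) (fun l => emb (some ⟨b, l⟩)) (emb none) l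
  | input p, emb, next, l =>
    match l with
    | none => .pop none (fun v o => (v.1, o)) (.goto fun v =>
        v.2.elim next fun b => emb (some ⟨b, entry (p b)⟩))
    | some ⟨b, l⟩ => code (p b) (fun l => emb (some ⟨b, l⟩)) (emb none) l

/-- The stacks of the compiled machine. -/
def stackOf (s : Mem κ Γ) : ∀ k, List (Alph κ Γ k)
  | none => s.1
  | some k => s.2 k

variable [DecidableEq κ]

theorem update_stackOf_some (i : List Γ) (S : κ → List Bool) (k : κ) (l : List Bool) :
    Function.update (stackOf (i, S)) (some k) l = stackOf (i, Function.update S k l) := by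
  funext o
  rcases o with _ | k'
  · rfl
  · by_cases h : k' = k
    · subst h
      simp [stackOf]
    · simp [stackOf, h]

theorem update_stackOf_none (i i' : List Γ) (S : κ → List Bool) :
    Function.update (stackOf (i, S)) none i' = stackOf (i', S) := by
  funext o
  rcases o with _ | k'
  · simp [stackOf]
  · rfl

open Turing.TM2 in
/-- The run of the compiled machine, counting steps. -/
def Leads {Λ : Type} (M : Λ → Stmt (Alph κ Γ) Λ (Reg Γ)) (t : ℕ)
    (c c' : Cfg (Alph κ Γ) Λ (Reg Γ)) : Prop :=
  ∃ n ≤ t, (flip Option.bind (step M))^[n] (some c) = some c'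

section

open Turing.TM2

variable {Λ : Type} {M : Λ → Stmt (Alph κ Γ) Λ (Reg Γ)}

theorem Leads.trans {t t' : ℕ} {c c' c'' : Cfg (Alph κ Γ) Λ (Reg Γ)} (h : Leads M t c c')
    (h' : Leads M t' c' c'') : Leads M (t + t') c c'' := by
  obtain ⟨n, hn, e⟩ := h
  obtain ⟨n', hn', e'⟩ := h'
  refine ⟨n' + n, by omega, ?_⟩
  rw [Function.iterate_add_apply, e, e']

theorem Leads.single {c c' : Cfg (Alph κ Γ) Λ (Reg Γ)} (h : step M c = some c') :
    Leads M 1 c c' :=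
  ⟨1, le_rfl, by simpa [flip] using h⟩

theorem Leads.mono {t t' : ℕ} {c c' : Cfg (Alph κ Γ) Λ (Reg Γ)} (h : Leads M t c c')
    (ht : t ≤ t') : Leads M t' c c' := by
  obtain ⟨n, hn, e⟩ := h
  exact ⟨n, hn.trans ht, e⟩

/-- The statement is relative to an embedding `emb` of the labels into a larger machine and to a
continuation `next`, so that induction on the run reaches the subprograms. The final register is
left unspecified: each branch on a register follows the read that sets it. -/
theorem Run.leads {p : Prog κ Γ} {s s' : Mem κ Γ} {t : ℕ} (h : Run p s t s') :
    ∀ (emb : Lab p → Λ) (next : Λ), (∀ l, M (emb l) = code p emb next l) →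
      ∀ v, ∃ v', Leads M t ⟨some (emb (entry p)), v, stackOf s⟩ ⟨some next, v', stackOf s'⟩ := by
  induction h with
  | skip s =>
    intro emb next hM v
    refine ⟨v, Leads.single ?_⟩
    rw [step, hM]
    rfl
  | push k b i S =>
    intro emb next hM v
    refine ⟨v, Leads.single ?_⟩
    rw [step, hM, ← update_stackOf_some]
    rfl
  | seq _ _ ih ih' =>
    intro emb next hM v
    obtain ⟨v', h⟩ := ih (fun l => emb (Sum.inl l)) _ (fun l => hM (Sum.inl l)) v
    obtain ⟨v'', h'⟩ := ih' (fun l => emb (Sum.inr l)) next (fun l => hM (Sum.inr l)) v'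
    exact ⟨v'', h.trans h'⟩
  | @pop k p i S t s' _ ih =>
    intro emb next hM v
    obtain ⟨v', h⟩ := ih (fun l => emb (some ⟨_, l⟩)) next (fun l => hM (some ⟨_, l⟩))
      ((S k).head?, v.2)
    refine ⟨v', ((Leads.single ?_).trans h).mono (by omega)⟩
    rw [step, hM, ← update_stackOf_some]
    rfl
  | @loop_nil k p i S hk =>
    intro emb next hM v
    refine ⟨(none, v.2), Leads.single ?_⟩
    have : stackOf (i, S) = Function.update (stackOf (i, S)) (some k) (S k).tail := by
      rw [update_stackOf_some, hk, List.tail_nil, ← hk, Function.update_eq_self]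
    conv_rhs => rw [this]
    rw [step, hM]
    have hk' : stackOf (i, S) (some k) = [] := hk
    simp only [entry, code, stepAux, hk', hk]
    rfl
  | @loop_cons k p i S b l t s' t' s'' hk _ _ ih ih' =>
    intro emb next hM v
    obtain ⟨v', h⟩ := ih (fun l => emb (some ⟨_, l⟩)) (emb none) (fun l => hM (some ⟨_, l⟩))
      (some b, v.2)
    obtain ⟨v'', h'⟩ := ih' emb next hM v'
    refine ⟨v'', ((Leads.single ?_).trans h).trans h'⟩
    have hk' : stackOf (i, S) (some k) = b :: l := hk
    rw [step, hM, ← update_stackOf_some]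
    simp only [entry, code, stepAux, hk']
    rfl
  | @input_nil p S =>
    intro emb next hM v
    refine ⟨(v.1, none), Leads.single ?_⟩
    rw [step, hM]
    simp only [entry, code, stepAux]
    have := update_stackOf_none (κ := κ) ([] : List Γ) [] S
    exact congrArg (fun x => some (Cfg.mk (some next) (v.1, none) x)) this
  | @input_cons p a i S t s' t' s'' _ _ ih ih' =>
    intro emb next hM v
    obtain ⟨v', h⟩ := ih (fun l => emb (some ⟨_, l⟩)) (emb none) (fun l => hM (some ⟨_, l⟩))
      (v.1, some a)
    obtain ⟨v'', h'⟩ := ih' emb next hM v'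
    refine ⟨v'', ((Leads.single ?_).trans h).trans h'⟩
    rw [step, hM]
    have := update_stackOf_none (a :: i) i S
    exact congrArg (fun x => some (Cfg.mk (some (emb (some ⟨a, entry (p a)⟩))) (v.1, some a) x)) this
  | le _ ht ih =>
    intro emb next hM v
    obtain ⟨v', h⟩ := ih emb next hM v
    exact ⟨v', h.mono ht⟩

end

/-- A function computed by a stack program within a polynomial number of steps is computable in
polynomial time. -/
theorem polyTime {α β : Type} [Fintype κ] [Fintype Γ] {ea : Encoding α Γ} {eb : Encoding β Bool}
    {f : α → β} (p : Prog κ Γ) (out : κ) (T : Polynomial ℕ)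
    (h : ∀ a, Run p (ea.encode a, fun _ => []) (T.eval (ea.encode a).length)
      ([], Function.update (fun _ => []) out (eb.encode (f a)))) : PolyTime ea eb f := by
  let tm : Turing.FinTM2 :=
    { K := Option κ
      k₀ := none
      k₁ := some out
      Γ := Alph κ Γ
      Λ := Option (Lab p)
      main := some (entry p)
      σ := Reg Γ
      initialState := (none, none)
      Γk₀Fin := inferInstanceAs (Fintype Γ)
      m := fun l => match l with
        -- `haltList` demands the initial register at the end, so the exit label resets it; this is
        -- the one step added to `T`.
        | none => .load (fun _ => (none, none)) .halt
        | some l => code p some none l }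
  refine ⟨⟨⟨tm, Equiv.refl _, Equiv.refl _⟩, T + 1, fun a => Classical.choice ?_⟩⟩
  obtain ⟨v', n, hn, e⟩ := (h a).leads (M := tm.m) some none (fun l => rfl) (none, none)
  refine ⟨⟨n + 1, ?_⟩, by simpa using hn⟩
  rw [add_comm, Function.iterate_add_apply]
  have e1 : Turing.initList tm (List.map (Equiv.refl Γ).invFun (ea.encode a)) =
      ⟨some (some (entry p)), (none, none), stackOf (ea.encode a, fun _ => [])⟩ := by
    unfold Turing.initList
    congr 1
    funext k
    rcases k with _ | k
    · simp [tm, stackOf]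
    · rfl
  have e2 : Turing.haltList tm (List.map (Equiv.refl Bool).invFun (eb.encode (f a))) =
      ⟨none, (none, none), stackOf ([], Function.update (fun _ => []) out (eb.encode (f a)))⟩ := by
    unfold Turing.haltList
    congr 1
    funext k
    rcases k with _ | k
    · rfl
    · by_cases hk : k = out
      · subst hk
        simp [tm, stackOf]
      · simp [tm, stackOf, hk]
  rw [e1]
  exact (congrArg (flip Option.bind (Turing.TM2.step tm.m))^[1] e).trans (congrArg some e2.symm)

end Prog

end CountingMeasure

end

noncomputable section

namespace CountingMeasure

open Filter Computability

/-! ### A memory with named stacks -/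

/-- Names of the Boolean stacks used by all programs below. -/
inductive Stk : Type
  | x | y | q | g | g2 | w | w2 | ac | c | c2 | fl | nn | ph | d | bad | out
  deriving DecidableEq

instance : Fintype Stk :=
  Fintype.ofList [.x, .y, .q, .g, .g2, .w, .w2, .ac, .c, .c2, .fl, .nn, .ph, .d, .bad, .out]
    fun k => by cases k <;> simp

/-- The contents of the Boolean stacks. -/
@[ext] structure Tape : Type where
  x : List Bool := []
  y : List Bool := []
  q : List Bool := []
  g : List Bool := []
  g2 : List Bool := []
  w : List Bool := []
  w2 : List Bool := []
  ac : List Bool := []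
  c : List Bool := []
  c2 : List Bool := []
  fl : List Bool := []
  nn : List Bool := []
  ph : List Bool := []
  d : List Bool := []
  bad : List Bool := []
  out : List Bool := []

namespace Tape

/-- The contents of a stack. -/
def get (t : Tape) : Stk → List Bool
  | .x => t.x | .y => t.y | .q => t.q | .g => t.g | .g2 => t.g2 | .w => t.w | .w2 => t.w2
  | .ac => t.ac | .c => t.c | .c2 => t.c2 | .fl => t.fl | .nn => t.nn | .ph => t.ph | .d => t.d
  | .bad => t.bad | .out => t.out

/-- Replace the contents of a stack. -/
def set (t : Tape) (k : Stk) (l : List Bool) : Tape :=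
  match k with
  | .x => { t with x := l } | .y => { t with y := l } | .q => { t with q := l }
  | .g => { t with g := l } | .g2 => { t with g2 := l } | .w => { t with w := l }
  | .w2 => { t with w2 := l } | .ac => { t with ac := l } | .c => { t with c := l }
  | .c2 => { t with c2 := l } | .fl => { t with fl := l } | .nn => { t with nn := l }
  | .ph => { t with ph := l } | .d => { t with d := l } | .bad => { t with bad := l }
  | .out => { t with out := l }

theorem update_get (t : Tape) (k : Stk) (l : List Bool) :
    Function.update t.get k l = (t.set k l).get := by
  funext j
  cases k <;> cases j <;> rfl

@[simp] theorem get_set_self (t : Tape) (k : Stk) (l : List Bool) : (t.set k l).get k = l := by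
  cases k <;> rfl

theorem get_set_ne (t : Tape) {k j : Stk} (h : j ≠ k) (l : List Bool) :
    (t.set k l).get j = t.get j := by
  rw [← update_get, Function.update_of_ne h]

@[simp] theorem set_set (t : Tape) (k : Stk) (l l' : List Bool) :
    (t.set k l).set k l' = t.set k l' := by
  cases k <;> rfl

@[simp] theorem set_get (t : Tape) (k : Stk) : t.set k (t.get k) = t := by
  cases k <;> rfl

theorem set_comm (t : Tape) {k j : Stk} (h : k ≠ j) (l l' : List Bool) :
    (t.set k l).set j l' = (t.set j l').set k l := by
  cases k <;> cases j <;> first | rfl | exact absurd rfl h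

end Tape

open Prog

variable {Γ : Type}

/-- `Exec p t T t'`: started on stacks `t`, the program `p` ends on stacks `t'` after at most `T`
steps, leaving the input stack alone. -/
def Exec (p : Prog Stk Γ) (t : Tape) (T : ℕ) (t' : Tape) : Prop :=
  ∀ i : List Γ, Run p (i, t.get) T (i, t'.get)

namespace Exec

theorem skip (t : Tape) : Exec (Prog.skip : Prog Stk Γ) t 1 t := fun _ => Run.skip _

theorem push (k : Stk) (b : Bool) (t : Tape) :
    Exec (Prog.push k b : Prog Stk Γ) t 1 (t.set k (b :: t.get k)) := fun i => by
  rw [← Tape.update_get]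
  exact Run.push _ _ _ _

theorem seq {p q : Prog Stk Γ} {t t' t'' : Tape} {T T' : ℕ} (h : Exec p t T t')
    (h' : Exec q t' T' t'') : Exec (Prog.seq p q) t (T + T') t'' :=
  fun i => Run.seq (h i) (h' i)

theorem pop {k : Stk} {p : Option Bool → Prog Stk Γ} {t t' : Tape} {T : ℕ}
    (h : Exec (p (t.get k).head?) (t.set k (t.get k).tail) T t') :
    Exec (Prog.pop k p) t (T + 1) t' := fun i => by
  refine Run.pop ?_
  rw [Tape.update_get]
  exact h i

theorem le {p : Prog Stk Γ} {t t' : Tape} {T T' : ℕ} (h : Exec p t T t') (hT : T ≤ T') :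
    Exec p t T' t' := fun i => (h i).le hT

theorem conv {p : Prog Stk Γ} {t t' t'' : Tape} {T : ℕ} (h : Exec p t T t') (e : t' = t'') :
    Exec p t T t'' := e ▸ h

theorem loop_nil {k : Stk} {p : Bool → Prog Stk Γ} {t : Tape} (h : t.get k = []) :
    Exec (Prog.loop k p) t 1 t := fun _ => Run.loop_nil h

theorem loop_cons {k : Stk} {p : Bool → Prog Stk Γ} {t t' t'' : Tape} {b : Bool} {l : List Bool}
    {T T' : ℕ} (h : t.get k = b :: l) (h1 : Exec (p b) (t.set k l) T t')
    (h2 : Exec (Prog.loop k p) t' T' t'') : Exec (Prog.loop k p) t (1 + T + T') t'' := fun i => by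
  refine Run.loop_cons h ?_ (h2 i)
  rw [Tape.update_get]
  exact h1 i

/-- Execution of a loop along a sequence of memories. -/
theorem loop_seq {k : Stk} {p : Bool → Prog Stk Γ} (F : ℕ → Tape) (m T : ℕ)
    (hm : (F m).get k = [])
    (h : ∀ i < m, ∃ b l, (F i).get k = b :: l ∧ Exec (p b) ((F i).set k l) T (F (i + 1))) :
    Exec (Prog.loop k p) (F 0) (m * (T + 1) + 1) (F m) := by
  suffices H : ∀ j ≤ m, Exec (Prog.loop k p) (F (m - j)) (j * (T + 1) + 1) (F m) by
    simpa using H m le_rfl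
  intro j
  induction j with
  | zero => exact fun _ => (loop_nil (by simpa using hm)).le (by simp)
  | succ j ih =>
    intro hj
    obtain ⟨b, l, e, hb⟩ := h (m - (j + 1)) (by omega)
    rw [show m - (j + 1) + 1 = m - j by omega] at hb
    exact (loop_cons e hb (ih (by omega))).le (by ring_nf; omega)

end Exec

/-! ### Basic programs -/

infixr:60 " ;; " => Prog.seq

/-- Empty a stack. -/
def clear (k : Stk) : Prog Stk Γ := .loop k fun _ => .skip

/-- Move a stack onto another one, reversing it. -/
def move (a b : Stk) : Prog Stk Γ := .loop a fun s => .push b s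

/-- Move a stack onto two others, reversing it. -/
def moveTwo (a b b' : Stk) : Prog Stk Γ := .loop a fun s => .push b s ;; .push b' s

/-- Push a symbol several times. -/
def pushN (k : Stk) (b : Bool) : ℕ → Prog Stk Γ
  | 0 => .skip
  | n + 1 => .push k b ;; pushN k b n

/-- Empty several stacks. -/
def clearAll : List Stk → Prog Stk Γ
  | [] => .skip
  | k :: l => clear k ;; clearAll l

namespace Exec

theorem clear (k : Stk) (t : Tape) :
    Exec (clear k : Prog Stk Γ) t (2 * (t.get k).length + 1) (t.set k []) := by
  generalize h : t.get k = l
  induction l generalizing t with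
  | nil =>
    have e : t.set k [] = t := by rw [← h, Tape.set_get]
    rw [e]
    exact loop_nil h
  | cons b l ih =>
    have := ih (t.set k l) (by simp)
    rw [Tape.set_set] at this
    exact (loop_cons h (skip _) this).le (by simp; omega)

theorem move {a b : Stk} (hab : a ≠ b) (t : Tape) :
    Exec (move a b : Prog Stk Γ) t (2 * (t.get a).length + 1)
      ((t.set a []).set b ((t.get a).reverse ++ t.get b)) := by
  generalize h : t.get a = l
  induction l generalizing t with
  | nil =>
    have e : t.set a [] = t := by rw [← h, Tape.set_get]
    rw [e, List.reverse_nil, List.nil_append, Tape.set_get]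
    exact loop_nil h
  | cons s l ih =>
    have := ih ((t.set a l).set b (s :: t.get b)) (by rw [Tape.get_set_ne _ hab]; simp)
    rw [Tape.set_comm _ hab.symm, Tape.set_set, Tape.set_set, Tape.get_set_self] at this
    refine (loop_cons h (push b s _) ?_ ).le
      (show 1 + 1 + (2 * l.length + 1) ≤ _ by simp; omega)
    rw [Tape.get_set_ne _ hab.symm]
    rw [List.reverse_cons, List.append_assoc]
    exact this

theorem moveTwo {a b b' : Stk} (hab : a ≠ b) (hab' : a ≠ b') (hbb : b ≠ b') (t : Tape) :
    Exec (moveTwo a b b' : Prog Stk Γ) t (3 * (t.get a).length + 1)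
      (((t.set a []).set b ((t.get a).reverse ++ t.get b)).set b'
        ((t.get a).reverse ++ t.get b')) := by
  generalize h : t.get a = l
  induction l generalizing t with
  | nil =>
    have e : t.set a [] = t := by rw [← h, Tape.set_get]
    rw [e, List.reverse_nil, List.nil_append, List.nil_append, Tape.set_get, Tape.set_get]
    exact loop_nil h
  | cons s l ih =>
    have := ih (((t.set a l).set b (s :: t.get b)).set b' (s :: t.get b'))
      (by rw [Tape.get_set_ne _ hab', Tape.get_set_ne _ hab]; simp)
    rw [Tape.set_comm _ hab'.symm, Tape.set_comm _ hab.symm, Tape.set_set,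
      Tape.set_comm _ hbb.symm, Tape.set_set, Tape.set_set, Tape.get_set_self,
      Tape.get_set_ne _ hbb, Tape.get_set_self] at this
    refine (loop_cons h ((push b s _).seq (push b' s _)) ?_ ).le
      (show 1 + (1 + 1) + (3 * l.length + 1) ≤ _ by simp; omega)
    rw [Tape.get_set_ne _ hbb.symm, Tape.get_set_ne _ hab.symm, Tape.get_set_ne _ hab'.symm]
    rw [List.reverse_cons, List.append_assoc, List.append_assoc]
    exact this

theorem pushN (k : Stk) (b : Bool) (n : ℕ) (t : Tape) :
    Exec (pushN k b n : Prog Stk Γ) t (n + 1) (t.set k (List.replicate n b ++ t.get k)) := by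
  induction n generalizing t with
  | zero =>
    rw [List.replicate_zero, List.nil_append, Tape.set_get]
    exact skip t
  | succ n ih =>
    have := ih (t.set k (b :: t.get k))
    rw [Tape.set_set, Tape.get_set_self] at this
    rw [List.replicate_succ', List.append_assoc]
    exact ((push k b t).seq this).le (by omega)

theorem clearAll (l : List Stk) (t : Tape) {B : ℕ} (hB : ∀ k, (t.get k).length ≤ B) :
    Exec (clearAll l : Prog Stk Γ) t (l.length * (2 * B + 1) + 1)
      (l.foldl (fun t k => t.set k []) t) := by
  induction l generalizing t with
  | nil => exact (skip t).le (by simp)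
  | cons k l ih =>
    refine ((clear k t).seq (ih (t.set k []) fun j => ?_)).le ?_
    · by_cases h : j = k
      · subst h
        simp
      · rw [Tape.get_set_ne _ h]
        exact hB j
    · have := hB k
      simp only [List.length_cons]
      ring_nf
      omega

end Exec

end CountingMeasure

end

/-! ### Arithmetic of the length and rate functions. -/

noncomputable section

namespace CountingMeasure

open Filter Computability

variable {Γ : Type}

/-! ### Powers and logarithms of unary numbers -/

/-- Move `x` to `y` and `q`, and add the square of its length to `w`. -/
def square (v : Bool) : Prog Stk Γ :=
  moveTwo .x .y .q ;;
  .loop .y (fun _ => .loop .q (fun s => .push .w v ;; .push .g s) ;; move .g .q) ;;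
  clear .q

theorem exec_square (v : Bool) (z : ℕ) (t : Tape) (hx : t.x = List.replicate z true)
    (hy : t.y = []) (hq : t.q = []) (hg : t.g = []) :
    Exec (square v : Prog Stk Γ) t (5 * z ^ 2 + 9 * z + 3)
      { t with x := [], w := List.replicate (z ^ 2) v ++ t.w } := by
  have inner (i : ℕ) (t : Tape) (hq : t.q = List.replicate i true) :
      Exec (.loop .q (fun s => .push .w v ;; .push .g s) : Prog Stk Γ) t (3 * i + 1)
        { t with q := [], w := List.replicate i v ++ t.w, g := List.replicate i true ++ t.g } := by
    induction i generalizing t with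
    | zero =>
      have : ({ t with q := [] } : Tape) = t := by ext1 <;> simp_all
      simpa [this] using Exec.loop_nil (Γ := Γ) (p := fun s => .push .w v ;; .push .g s)
        (show t.get .q = [] by simp [Tape.get, hq])
    | succ i ih =>
      refine (Exec.loop_cons (show t.get .q = true :: List.replicate i true from hq)
        ((Exec.push .w v _).seq (Exec.push .g true _)) ?_).le
        (show 1 + (1 + 1) + (3 * i + 1) ≤ _ by omega)
      rw [List.replicate_succ', List.replicate_succ', List.append_assoc, List.append_assoc]
      exact ih _ rfl
  let F (i : ℕ) : Tape := { t with
    x := []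
    y := List.replicate (z - i) true
    q := List.replicate z true
    w := List.replicate (z * i) v ++ t.w }
  have h1 : Exec (moveTwo .x .y .q : Prog Stk Γ) t (3 * z + 1) (F 0) := by
    have := Exec.moveTwo (Γ := Γ) (a := .x) (b := .y) (b' := .q) (by simp) (by simp) (by simp) t
    simp only [Tape.get, Tape.set, hx, hy, hq, List.length_replicate, List.reverse_replicate,
      List.append_nil] at this
    simpa [F] using this
  have h2 : Exec (.loop .y (fun _ => .loop .q (fun s => .push .w v ;; .push .g s) ;; move .g .q) :
      Prog Stk Γ) (F 0) (z * (3 * z + 1 + (2 * z + 1) + 1) + 1) (F z) := by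
    refine Exec.loop_seq F z _ (by simp [F, Tape.get]) fun i hi =>
      ⟨true, List.replicate (z - (i + 1)) true, ?_, ?_⟩
    · simp only [F, Tape.get]
      rw [← List.replicate_succ]
      congr 1
      omega
    · refine (inner z _ rfl).seq ?_
      have := Exec.move (Γ := Γ) (a := .g) (b := .q) (by simp)
        { (F i).set .y (List.replicate (z - (i + 1)) true) with
          q := [], w := List.replicate z v ++ (F i).w, g := List.replicate z true ++ t.g }
      simp only [Tape.get, hg, List.append_nil, List.length_replicate, List.reverse_replicate]
        at this
      have e : ({ F i with
          y := List.replicate (z - (i + 1)) true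
          w := List.replicate z v ++ (F i).w
          g := []
          q := List.replicate z true } : Tape) = F (i + 1) := by
        simp only [F, ← List.append_assoc, List.replicate_append_replicate, hg]
        ring_nf
      rw [← e]
      simpa [Tape.set, F, hg] using this
  have h3 := Exec.clear (Γ := Γ) .q (F z)
  have e : (F z).set .q [] = { t with x := [], w := List.replicate (z ^ 2) v ++ t.w } := by
    simp [F, Tape.set, hy, hq, sq]
  rw [e] at h3
  refine (h1.seq (h2.seq h3)).le ?_
  simp only [F, Tape.get, List.length_replicate]
  ring_nf
  omega

/-- Raise the length of `x` to the fourth power. -/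
def pow4 (v : Bool) : Prog Stk Γ := square true ;; move .w .x ;; square v ;; move .w .out

theorem exec_pow4 (v : Bool) (z : ℕ) (l : List Bool) :
    Exec (pow4 v : Prog Stk Γ) { x := List.replicate z true, out := l } (7 * z ^ 4 + 16 * z ^ 2 + 9 * z + 8)
      { out := List.replicate (z ^ 4) v ++ l } := by
  have h1 := exec_square (Γ := Γ) true z { x := List.replicate z true, out := l } rfl rfl rfl rfl
  have h2 := Exec.move (Γ := Γ) (a := .w) (b := .x) (by simp)
    { x := [], w := List.replicate (z ^ 2) true ++ [], out := l }
  have h3 := exec_square (Γ := Γ) v (z ^ 2)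
    { x := (List.replicate (z ^ 2) true ++ []).reverse ++ [], out := l } (by simp) rfl rfl rfl
  have h4 := Exec.move (Γ := Γ) (a := .w) (b := .out) (by simp)
    { w := List.replicate ((z ^ 2) ^ 2) v ++ [], out := l }
  refine ((h1.seq (h2.seq (h3.seq h4))).le ?_).conv ?_
  · simp only [Tape.get, List.append_nil, List.length_replicate]
    ring_nf
    omega
  · simp [Tape.set, Tape.get, ← pow_mul]

theorem run_input_unary {α : Type} (i : List α) (t : Tape) :
    Prog.Run (.input fun _ => .push .x true : Prog Stk α) (i, t.get) (2 * i.length + 1)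
      ([], Tape.get { t with x := List.replicate i.length true ++ t.x }) := by
  induction i generalizing t with
  | nil => exact Prog.Run.input_nil
  | cons a i ih =>
    rw [List.length_cons, List.replicate_succ', List.append_assoc]
    exact (Prog.Run.input_cons (a := a) (Exec.push .x true t i) (ih _)).le
      (show 1 + 1 + (2 * i.length + 1) ≤ 2 * (i.length + 1) + 1 by omega)

/-- Read the input as a unary number, add `c` and raise to the fourth power. -/
def pow4Input (v : Bool) (l : Prog Stk Γ) (c : ℕ) : Prog Stk Γ :=
  .input (fun _ => .push .x true) ;; pushN .x true c ;; l ;; pow4 v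

theorem run_pow4Input (v : Bool) (l : Prog Stk Γ) (c : ℕ) (i : List Γ) (s : List Bool)
    (hl : ∀ t, Exec l t 1 { t with out := s ++ t.out }) :
    Prog.Run (pow4Input v l c) (i, Tape.get {})
      (2 * i.length + 1 + (c + 1 + (1 + (7 * (i.length + c) ^ 4 + 16 * (i.length + c) ^ 2 +
        9 * (i.length + c) + 8))))
      ([], Tape.get { out := List.replicate ((i.length + c) ^ 4) v ++ s }) := by
  refine Prog.Run.seq (run_input_unary i {}) (Prog.Run.seq (Exec.pushN .x true c _ []) 
    (Prog.Run.seq (hl _ []) ?_))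
  have := exec_pow4 (Γ := Γ) v (i.length + c) s []
  rw [add_comm i.length c, ← List.replicate_append_replicate] at this
  simpa [Tape.set, Tape.get, add_comm i.length c] using this

theorem unaryEncodeNat_eq (n : ℕ) : unaryEncodeNat n = List.replicate n true := by
  induction n with
  | zero => rfl
  | succ n ih => rw [unaryEncodeNat, ih, List.replicate_succ]

/-- Numbers are written least significant bit first, so a power of two is produced by pushing zeros
onto a one. This is why the rate function is also chosen to be a power of two. -/
theorem encodeNat_two_pow (n : ℕ) : encodeNat (2 ^ n) = List.replicate n false ++ [true] := by
  have h (n : ℕ) : ∃ p : PosNum, ((2 ^ n : ℕ) : Num) = Num.pos p ∧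
      encodePosNum p = List.replicate n false ++ [true] := by
    induction n with
    | zero => exact ⟨1, rfl, rfl⟩
    | succ n ih =>
      obtain ⟨p, hp, e⟩ := ih
      refine ⟨p.bit0, ?_, by rw [encodePosNum, e, List.replicate_succ, List.cons_append]⟩
      rw [pow_succ, mul_two, Nat.cast_add, hp]
      change Num.pos p + Num.pos p = Num.bit0 (Num.pos p)
      rw [Num.bit0_of_bit0]
  obtain ⟨p, hp, e⟩ := h n
  rw [encodeNat, hp, encodeNum, e]

/-- The memory with a single nonempty stack. -/
theorem get_out (l : List Bool) :
    Tape.get { out := l } = Function.update (fun _ => []) .out l := by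
  funext k
  cases k <;> rfl

theorem get_empty : Tape.get {} = fun _ => [] := by
  funext k
  cases k <;> rfl

theorem polyTime_pow4 (c : ℕ) :
    PolyTime unaryEncodingNat unaryEncodingNat (fun i => (i + c) ^ 4) := by
  refine Prog.polyTime (pow4Input true .skip c) .out
    (2 * .X + 1 + (.C c + 1 + (1 + (7 * (.X + .C c) ^ 4 + 16 * (.X + .C c) ^ 2 +
      9 * (.X + .C c) + 8)))) fun i => ?_
  have := run_pow4Input true .skip c (unaryEncodeNat i) [] fun t => Exec.skip t
  rw [get_empty, get_out] at this
  have e : unaryEncodingNat.encode i = List.replicate i true := unaryEncodeNat_eq i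
  rw [unaryEncodeNat_eq] at this
  rw [e, show unaryEncodingNat.encode _ = _ from unaryEncodeNat_eq _]
  simpa using this

/-- The input has exactly `|w| + r` symbols, since `r` is in unary, so the program need only count
symbols without telling the two components apart. -/
theorem polyTime_two_pow (c : ℕ) :
    PolyTime encodingStrUnary encodingNatBool (fun x => 2 ^ (x.1.length + x.2 + c) ^ 4) := by
  refine Prog.polyTime (pow4Input false (.push .out true) c) .out
    (2 * .X + 1 + (.C c + 1 + (1 + (7 * (.X + .C c) ^ 4 + 16 * (.X + .C c) ^ 2 +
      9 * (.X + .C c) + 8)))) fun i => ?_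
  have := run_pow4Input false (.push .out true) c (encodingStrUnary.encode i) [true]
    fun t => Exec.push _ _ t
  rw [get_empty, get_out] at this
  have e : (encodingStrUnary.encode i).length = i.1.length + i.2 := by
    simp [encodingStrUnary, encodingProd, encodingList, unaryEncodingNat, unaryEncodeNat_eq]
  rw [show encodingNatBool.encode _ = _ from encodeNat_two_pow _]
  rw [e] at this ⊢
  simpa using this

/-- The number of rounds in which `N ↦ ⌈(N - 1) / 4⌉` reaches zero. -/
def rounds : ℕ → ℕ
  | 0 => 0
  | N + 1 => rounds ((N + 3) / 4) + 1
decreasing_by omega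

/-- Compute `2 ^ rounds N` from the unary number `N`. -/
def powRounds : Prog Stk Bool :=
  .input (fun _ => .push .x true) ;; .push .out true ;;
    .loop .x fun _ =>
      .loop .x (fun _ => .pop .x fun _ => .pop .x fun _ => .pop .x fun _ => .push .y true) ;;
      move .y .x ;; .push .out false

/-- Each round removes up to four symbols and records one. Popping an empty stack is harmless, which
makes the quotient round up. -/
theorem exec_quarter (n : ℕ) (t : Tape) (hx : t.x = List.replicate n true) :
    Exec (.loop .x (fun _ => .pop .x fun _ => .pop .x fun _ => .pop .x fun _ => .push .y true) :
      Prog Stk Γ) t (5 * n + 1)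
      { t with x := [], y := List.replicate ((n + 3) / 4) true ++ t.y } := by
  induction n using Nat.strong_induction_on generalizing t with
  | _ n ih =>
    rcases n with _ | n
    · refine (Exec.loop_nil (by simpa [Tape.get] using hx)).conv ?_
      ext1 <;> simp_all
    · have h := ih (n - 3) (by omega)
        { t with x := List.replicate (n - 3) true, y := true :: t.y } rfl
      refine ((Exec.loop_cons (show t.get .x = true :: List.replicate n true from hx)
        (Exec.pop (Exec.pop (Exec.pop (Exec.push .y true _)))) (h.conv rfl |> fun h => ?_)).le
        (show 1 + (1 + 1 + 1 + 1) + (5 * (n - 3) + 1) ≤ _ by omega)).conv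
        (show ({ t with
          x := []
          y := List.replicate ((n - 3 + 3) / 4) true ++ true :: t.y } : Tape) = _ from ?_)
      · have e : (List.replicate n true).tail.tail.tail = List.replicate (n - 3) true := by
          simp only [List.tail_replicate]
          congr 1
        rw [← e] at h
        exact h
      · have e : (n + 1 + 3) / 4 = (n - 3 + 3) / 4 + 1 := by omega
        rw [e, List.replicate_succ', List.append_assoc]
        rfl

/-- The total time is linear because the lengths shrink geometrically. -/
theorem exec_rounds (n : ℕ) (l : List Bool) :
    Exec (.loop .x fun _ =>
      .loop .x (fun _ => .pop .x fun _ => .pop .x fun _ => .pop .x fun _ => .push .y true) ;;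
      move .y .x ;; .push .out false : Prog Stk Γ)
      { x := List.replicate n true, out := l } (20 * n + 1)
      { out := List.replicate (rounds n) false ++ l } := by
  induction n using Nat.strong_induction_on generalizing l with
  | _ n ih =>
    rcases n with _ | n
    · rw [rounds]
      exact Exec.loop_nil rfl
    · have h := ih ((n + 3) / 4) (by omega) (false :: l)
      have h1 := exec_quarter (Γ := Γ) n { x := List.replicate n true, out := l } rfl
      have h2 := Exec.move (Γ := Γ) (a := .y) (b := .x) (by simp)
        { y := List.replicate ((n + 3) / 4) true ++ [], out := l }
      have e : ((({ y := List.replicate ((n + 3) / 4) true ++ [], out := l } : Tape).set .y []).set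
          .x ((List.replicate ((n + 3) / 4) true ++ []).reverse ++ [])) =
          { x := List.replicate ((n + 3) / 4) true, out := l } := by
        simp [Tape.set]
      refine ((Exec.loop_cons (show Tape.get { x := List.replicate (n + 1) true, out := l } .x =
        true :: List.replicate n true from rfl)
        (h1.seq ((h2.conv e).seq (Exec.push .out false _))) h).le ?_).conv ?_
      · simp [Tape.get]
        omega
      · rw [rounds, List.replicate_succ', List.append_assoc]
        rfl

theorem polyTime_powRounds :
    PolyTime unaryEncodingNat encodingNatBool (fun n => 2 ^ rounds n) := by
  refine Prog.polyTime powRounds .out (22 * .X + 3) fun n => ?_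
  rw [show unaryEncodingNat.encode _ = _ from unaryEncodeNat_eq _,
    show encodingNatBool.encode _ = _ from encodeNat_two_pow _, ← get_out, ← get_empty]
  have h := run_input_unary (List.replicate n true) {}
  have h' := exec_rounds (Γ := Bool) n [true] []
  refine (Prog.Run.seq h (Prog.Run.seq (Exec.push .out true _ []) (t' := 20 * n + 1) ?_)).le ?_
  · simpa [Tape.set, Tape.get] using h'
  · simp
    ring_nf
    omega

end CountingMeasure

end

/-! ### The machines: counters, gate lists and their verification. -/

noncomputable section

namespace CountingMeasure

open Filter Computability

variable {Γ : Type}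

/-! ### Binary counters -/

/-- Increment a binary number of fixed width, least significant bit first. -/
def flipBits : List Bool → List Bool
  | [] => []
  | false :: l => true :: l
  | true :: l => false :: flipBits l

/-- Increment a binary number, least significant bit first. -/
def incBits (l : List Bool) : List Bool := flipBits l ++ if l.all id then [true] else []

@[simp] theorem length_flipBits (l : List Bool) : (flipBits l).length = l.length := by
  induction l with
  | nil => rfl
  | cons b l ih => cases b <;> simp [flipBits, ih]

theorem bits_two_mul (m : ℕ) (h : m ≠ 0) : Nat.bits (2 * m) = false :: Nat.bits m := by
  simpa [Nat.bit_val] using Nat.bits_append_bit m false (fun h' => absurd h' h)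

theorem bits_two_mul_add_one (m : ℕ) : Nat.bits (2 * m + 1) = true :: Nat.bits m := by
  simp

theorem incBits_bits (k : ℕ) : incBits (Nat.bits k) = Nat.bits (k + 1) := by
  induction k using Nat.strong_induction_on with
  | _ k ih =>
    rcases Nat.even_or_odd' k with ⟨m, rfl | rfl⟩
    · rcases Nat.eq_zero_or_pos m with rfl | hm
      · simp [incBits, flipBits]
      · rw [bits_two_mul m hm.ne', bits_two_mul_add_one]
        simp [incBits, flipBits]
    · rw [bits_two_mul_add_one, show 2 * m + 1 + 1 = 2 * (m + 1) by ring,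
        bits_two_mul _ (Nat.succ_ne_zero m), ← ih m (by omega)]
      simp [incBits, flipBits]

theorem length_bits (k : ℕ) : (Nat.bits k).length = Nat.size k := (Nat.size_eq_bits_len k).symm ▸ rfl

/-- The bit length grows exactly when the carry runs through all bits. This lets a program track
`Nat.size` in unary by reacting to overflows only. -/
theorem size_succ (k : ℕ) :
    Nat.size (k + 1) = Nat.size k + if (Nat.bits k).all id then 1 else 0 := by
  rw [← length_bits, ← incBits_bits, incBits, List.length_append, length_flipBits, length_bits]
  split_ifs <;> rfl

theorem size_le_self (k : ℕ) : Nat.size k ≤ k := Nat.size_le.2 Nat.lt_two_pow_self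

/-- Increment the counter `c`, and run `ov` if its length grows. -/
def inc (ov : Prog Stk Γ) : Prog Stk Γ :=
  .push .fl true ;;
  .loop .c (fun b => .pop .fl fun o =>
    if o.isSome then .push .c2 (!b) ;; (if b then .push .fl true else .skip) else .push .c2 b) ;;
  .pop .fl fun o =>
    if o.isSome then .push .c2 true ;; move .c2 .c ;; ov else move .c2 .c ;; .skip

theorem exec_inc_loop_false (l : List Bool) (t : Tape) (hc : t.c = l) (hf : t.fl = []) :
    Exec (.loop .c (fun b => .pop .fl fun o =>
      if o.isSome then .push .c2 (!b) ;; (if b then .push .fl true else .skip) else .push .c2 b) :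
      Prog Stk Γ) t (4 * l.length + 1) { t with c := [], c2 := l.reverse ++ t.c2 } := by
  induction l generalizing t with
  | nil =>
    refine (Exec.loop_nil (by simpa [Tape.get] using hc)).conv ?_
    ext1 <;> simp_all
  | cons b l ih =>
    have h := ih { t with c := l, c2 := b :: t.c2, fl := [] } rfl rfl
    refine ((Exec.loop_cons (show t.get .c = b :: l from hc) (T := 2)
      (t' := { t with c := l, c2 := b :: t.c2, fl := [] }) (Exec.pop ?_) h).le ?_).conv ?_
    · simp only [Tape.get, Tape.set, hf]
      exact Exec.push .c2 b _
    · simp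
      omega
    · simp [hf]

theorem exec_inc_loop_true (l : List Bool) (t : Tape) (hc : t.c = l) (hf : t.fl = [true]) :
    Exec (.loop .c (fun b => .pop .fl fun o =>
      if o.isSome then .push .c2 (!b) ;; (if b then .push .fl true else .skip) else .push .c2 b) :
      Prog Stk Γ) t (4 * l.length + 1)
      { t with
        c := []
        c2 := (flipBits l).reverse ++ t.c2
        fl := if l.all id then [true] else [] } := by
  induction l generalizing t with
  | nil =>
    refine (Exec.loop_nil (by simpa [Tape.get] using hc)).conv ?_
    ext1 <;> simp_all [flipBits]
  | cons b l ih =>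
    rcases b with _ | _
    · have h := exec_inc_loop_false (Γ := Γ) l { t with c := l, c2 := true :: t.c2, fl := [] }
        rfl rfl
      refine ((Exec.loop_cons (show t.get .c = false :: l from hc) (T := 3)
        (t' := { t with c := l, c2 := true :: t.c2, fl := [] }) (Exec.pop ?_) h).le ?_).conv ?_
      · simp only [Tape.get, Tape.set, hf]
        exact (Exec.push .c2 true _).seq (Exec.skip _)
      · simp
        omega
      · simp [flipBits]
    · have h := ih { t with c := l, c2 := false :: t.c2 } rfl hf
      refine ((Exec.loop_cons (show t.get .c = true :: l from hc) (T := 3)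
        (t' := { t with c := l, c2 := false :: t.c2 }) (Exec.pop ?_) h).le ?_).conv ?_
      · simp only [Tape.get, Tape.set, hf]
        refine ((Exec.push .c2 false _).seq (Exec.push .fl true _)).conv ?_
        simp [Tape.get, Tape.set]
      · simp
        omega
      · simp [flipBits]

theorem exec_inc {ov : Prog Stk Γ} (k : ℕ) (t t' : Tape) (T : ℕ) (hc : t.c = Nat.bits k)
    (hc2 : t.c2 = []) (hf : t.fl = [])
    (h : Exec (if (Nat.bits k).all id then ov else .skip) { t with c := Nat.bits (k + 1) } T t') :
    Exec (inc ov) t (6 * k + T + 10) t' := by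
  have h0 := Exec.push (Γ := Γ) .fl true t
  have h1 := exec_inc_loop_true (Γ := Γ) (Nat.bits k) { t with fl := [true] } hc rfl
  have e0 : t.set .fl (true :: t.get .fl) = { t with fl := [true] } := by
    simp [Tape.set, Tape.get, hf]
  have hk : (Nat.bits k).length ≤ k := by
    rw [length_bits]
    exact size_le_self k
  refine ((h0.conv e0).seq (h1.seq (Exec.pop (T := 2 * k + T + 4) ?_))).le (by omega)
  by_cases ha : (Nat.bits k).all id
  · simp only [ha, if_true] at h ⊢
    have h3 := Exec.move (Γ := Γ) (a := .c2) (b := .c) (by simp)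
      { t with c := [], c2 := true :: ((flipBits (Nat.bits k)).reverse ++ t.c2), fl := [] }
    refine (((Exec.push .c2 true _).seq (h3.seq (T' := T) (t'' := t') ?_))).le ?_
    · have e : Nat.bits (k + 1) = flipBits (Nat.bits k) ++ [true] := by
        rw [← incBits_bits, incBits, if_pos ha]
      refine cast ?_ h
      congr 1
      simp only [Tape.get, Tape.set, hc2, hf, e]
      ext1 <;> simp [*]
    · simp [Tape.get, hc2]
      omega
  · simp only [ha] at h ⊢
    have h3 := Exec.move (Γ := Γ) (a := .c2) (b := .c) (by simp)
      { t with c := [], c2 := (flipBits (Nat.bits k)).reverse ++ t.c2, fl := [] }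
    refine (h3.seq (T' := T) (t'' := t') ?_).le ?_
    · have e : Nat.bits (k + 1) = flipBits (Nat.bits k) := by
        rw [← incBits_bits, incBits, if_neg ha, List.append_nil]
      refine cast ?_ h
      simp only [Tape.get, Tape.set, hc2, hf, e]
      congr 1
      ext1 <;> simp [*]
    · simp [Tape.get, hc2]
      omega

/-! ### Gate lists and their cost -/

/-- The cost of `s` gates. -/
def cost (s : ℕ) : ℕ := ∑ k ∈ Finset.range s, (Nat.size (k + 1) + 10)

/-- The number of gates described by a gate list. -/
def numGates (G : List Bool) : ℕ := G.count false / 2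

/-- Add the length of `c` to `d`. -/
def tally : Prog Stk Γ := .loop .c (fun b => .push .c2 b ;; .push .d true) ;; move .c2 .c

theorem exec_tally (t : Tape) (hc2 : t.c2 = []) :
    Exec (tally : Prog Stk Γ) t (5 * t.c.length + 2)
      { t with d := List.replicate t.c.length true ++ t.d } := by
  have h (l : List Bool) (t : Tape) (hc : t.c = l) :
      Exec (.loop .c (fun b => .push .c2 b ;; .push .d true) : Prog Stk Γ) t (3 * l.length + 1)
        { t with
          c := []
          c2 := l.reverse ++ t.c2
          d := List.replicate l.length true ++ t.d } := by
    induction l generalizing t with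
    | nil =>
      refine (Exec.loop_nil (by simpa [Tape.get] using hc)).conv ?_
      ext1 <;> simp_all
    | cons b l ih =>
      refine ((Exec.loop_cons (show t.get .c = b :: l from hc)
        ((Exec.push .c2 b _).seq (Exec.push .d true _)) (ih _ rfl)).le
        (show 1 + (1 + 1) + (3 * l.length + 1) ≤ _ by simp; omega)).conv ?_
      simp [Tape.set, Tape.get, List.replicate_succ']
  have h1 := h t.c t rfl
  refine ((h1.seq (Exec.move (by simp) _)).le ?_).conv ?_
  · simp [Tape.get, hc2]
    omega
  · simp [Tape.get, Tape.set, hc2]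

/-- Compute the cost of the gate list `g` in unary, on the stack `d`. -/
def costPass : Prog Stk Γ :=
  .loop .g (fun b => .push .g2 b ;; if b then .skip else
    .pop .ac fun o => if o.isSome then inc .skip ;; tally ;; pushN .d true 10
      else .push .ac true) ;;
  clear .ac ;; clear .c ;; move .g2 .g

theorem exec_costPass (G : List Bool) (t : Tape) (hg : t.g = G) (hg2 : t.g2 = [])
    (hac : t.ac = []) (hc : t.c = []) (hc2 : t.c2 = []) (hf : t.fl = []) (hd : t.d = []) :
    Exec (costPass : Prog Stk Γ) t (11 * G.length ^ 2 + 50 * G.length + 10)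
      { t with d := List.replicate (cost (numGates G)) true } := by
  -- Loop invariant: a gate is complete at every second `false`, so `ac` holds the parity of the
  -- number of `false` read, `c` the number of complete gates and `d` their cost.
  let F (i : ℕ) : Tape := { t with
    g := G.drop i
    g2 := (G.take i).reverse
    ac := List.replicate ((G.take i).count false % 2) true
    c := Nat.bits ((G.take i).count false / 2)
    d := List.replicate (cost ((G.take i).count false / 2)) true }
  have e0 : F 0 = t := by
    simp only [F]
    ext1 <;> simp [*, cost]
  have hle (i : ℕ) : (G.take i).count false ≤ G.length :=
    List.count_le_length.trans (by simp)
  have h1 : Exec (.loop .g (fun b => .push .g2 b ;; if b then .skip else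
      .pop .ac fun o => if o.isSome then inc .skip ;; tally ;; pushN .d true 10
      else .push .ac true) : Prog Stk Γ) (F 0) (G.length * (11 * G.length + 40 + 1) + 1)
      (F G.length) := by
    refine Exec.loop_seq F _ _ (by simp [F, Tape.get]) fun i hi =>
      ⟨G[i], G.drop (i + 1), List.drop_eq_getElem_cons hi, ?_⟩
    have ht : G.take (i + 1) = G.take i ++ [G[i]] := (List.take_append_getElem hi).symm
    refine ((Exec.push .g2 _ _).seq (T' := 11 * G.length + 39) ?_).le (by omega)
    generalize G[i] = b at ht
    rcases b with _ | _
    · refine (Exec.pop (T := 11 * G.length + 38) ?_).le (by omega)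
      have hcount : (G.take i ++ [false]).count false = (G.take i).count false + 1 := by
        rw [List.count_append]
        simp
      rcases Nat.mod_two_eq_zero_or_one ((G.take i).count false) with hm | hm
      · have e2 : ((G.take i).count false + 1) % 2 = 1 := by omega
        have e3 : ((G.take i).count false + 1) / 2 = (G.take i).count false / 2 := by omega
        simp only [F, Tape.get, Tape.set, ht, hcount, hm, e2, e3]
        refine ((Exec.push .ac true _).le (by omega)).conv ?_
        simp [Tape.get, Tape.set]
      · have e2 : ((G.take i).count false + 1) % 2 = 0 := by omega
        have e3 : ((G.take i).count false + 1) / 2 = (G.take i).count false / 2 + 1 := by omega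
        simp only [F, Tape.get, Tape.set, ht, hcount, hm, e2, e3]
        have hk := hle i
        generalize (G.take i).count false = m at *
        have hs := size_le_self (m / 2 + 1)
        let t1 : Tape := { t with
          g := G.drop (i + 1)
          g2 := false :: (G.take i).reverse
          ac := []
          c := Nat.bits (m / 2)
          d := List.replicate (cost (m / 2)) true }
        have h1 := exec_inc (Γ := Γ) (ov := .skip) (m / 2) t1 { t1 with c := Nat.bits (m / 2 + 1) } 1
          rfl hc2 hf (by split_ifs <;> exact Exec.skip _)
        have h2 := exec_tally (Γ := Γ) { t1 with c := Nat.bits (m / 2 + 1) } hc2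
        refine ((h1.seq (h2.seq (Exec.pushN .d true 10 _))).le ?_).conv ?_
        · rw [length_bits]
          omega
        · simp only [t1, Tape.get, Tape.set, List.replicate_append_replicate,
            length_bits, List.reverse_append]
          rw [cost, cost, Finset.sum_range_succ]
          congr 2
          ring
    · have hcount : (G.take i ++ [true]).count false = (G.take i).count false := by
        rw [List.count_append]
        simp
      simp only [F, Tape.get, Tape.set, hcount, ht]
      refine ((Exec.skip _).le (by omega)).conv ?_
      simp
  have h2 := Exec.clear (Γ := Γ) .ac (F G.length)
  have h3 := Exec.clear (Γ := Γ) .c ((F G.length).set .ac [])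
  have h4 := Exec.move (Γ := Γ) (a := .g2) (b := .g) (by simp)
    (((F G.length).set .ac []).set .c [])
  rw [e0] at h1
  refine ((h1.seq (h2.seq (h3.seq h4))).le ?_).conv ?_
  · have h5 : (Nat.bits (List.count false G / 2)).length ≤ G.length := by
      rw [length_bits]
      exact (size_le_self _).trans ((Nat.div_le_self _ _).trans List.count_le_length)
    simp [F, Tape.get, Tape.set]
    ring_nf
    ring_nf at h5
    omega
  · simp [F, Tape.get, Tape.set, numGates, *]

end CountingMeasure

end

noncomputable section

namespace CountingMeasure

open Filter Computability

variable {Γ : Type}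

/-! ### Evaluation of gate lists -/

/-- One step of the evaluation of a gate list. The state consists of the wires that the current
pointer has passed, the remaining wires, and the value found by the first pointer of the current
gate. A gate computes the conjunction of the wires at its two pointers; its value and its negation
become new wires. -/
def gateStep : List Bool × List Bool × List Bool → Bool → List Bool × List Bool × List Bool
  | (w2, [], ac), true => (w2, [], ac)
  | (w2, a :: w, ac), true => (a :: w2, w, ac)
  | (w2, w, []), false => ([], w2.reverse ++ w, [w.head?.getD false])
  | (w2, w, a :: ac), false =>
    ([], (a && w.head?.getD false) :: (!(a && w.head?.getD false)) :: (w2.reverse ++ w), ac)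

/-- The initial wires: all bits and their negations. -/
def initWires (c : List Bool) : List Bool := c.flatMap fun b => [b, !b]

/-- The state after evaluating a gate list. -/
def gateState (G c : List Bool) : List Bool × List Bool × List Bool :=
  G.foldl gateStep ([], initWires c, [])

/-- The output of a gate list: the wire created last. -/
def gateOut (G c : List Bool) : Bool :=
  ((gateState G c).1.reverse ++ (gateState G c).2.1).head?.getD false

theorem length_gateStep (s : List Bool × List Bool × List Bool) (b : Bool) :
    (gateStep s b).1.length + (gateStep s b).2.1.length ≤ s.1.length + s.2.1.length + 2 ∧
      (gateStep s b).2.2.length ≤ s.2.2.length + 1 := by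
  rcases s with ⟨w2, _ | ⟨a, w⟩, _ | ⟨a', ac⟩⟩ <;> cases b <;> simp [gateStep] <;> omega

theorem gateState_append (G c : List Bool) (b : Bool) :
    gateState (G ++ [b]) c = gateStep (gateState G c) b := by
  simp [gateState]

theorem length_gateState (G c : List Bool) :
    (gateState G c).1.length + (gateState G c).2.1.length ≤ 2 * c.length + 2 * G.length ∧
      (gateState G c).2.2.length ≤ G.length := by
  induction G using List.reverseRecOn with
  | nil =>
    have : (initWires c).length = 2 * c.length := by
      induction c with
      | nil => rfl
      | cons b c ih =>
        simp [initWires] at ih ⊢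
        omega
    simp [gateState, this]
  | append_singleton G b ih =>
    have := length_gateStep (gateState G c) b
    rw [gateState_append, List.length_append, List.length_singleton]
    omega

/-- The program for `gateStep`. -/
def stepProg (b : Bool) : Prog Stk Γ :=
  .push .g2 b ;;
  .pop .w fun o =>
    if b then (if o.isSome then .push .w2 (o.getD false) else .skip)
    else (if o.isSome then .push .w (o.getD false) else .skip) ;; move .w2 .w ;;
      .pop .ac fun o' =>
        if o'.isSome then
          .push .w (!(o'.getD false && o.getD false)) ;; .push .w (o'.getD false && o.getD false)
        else .push .ac (o.getD false)

theorem exec_stepProg (b : Bool) (t : Tape) :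
    Exec (stepProg b : Prog Stk Γ) t (2 * t.w2.length + 8)
      { t with
        g2 := b :: t.g2
        w2 := (gateStep (t.w2, t.w, t.ac) b).1
        w := (gateStep (t.w2, t.w, t.ac) b).2.1
        ac := (gateStep (t.w2, t.w, t.ac) b).2.2 } := by
  refine ((Exec.push .g2 b t).seq (Exec.pop (T := 2 * t.w2.length + 6) ?_)).le (by omega)
  rcases b with _ | _
  · have key : Exec ((if t.w.head?.isSome then .push .w (t.w.head?.getD false) else .skip) :
        Prog Stk Γ) { t with g2 := false :: t.g2, w := t.w.tail } 1
        { t with g2 := false :: t.g2 } := by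
      rcases h : t.w with _ | ⟨a, w⟩
      · refine (Exec.skip _).conv ?_
        simp
      · refine (Exec.push .w a _).conv ?_
        simp [Tape.get, Tape.set]
    refine ((key.seq ((Exec.move (by simp) _).seq (Exec.pop (T := 2) ?_))).le
      (show 1 + (2 * t.w2.length + 1 + (2 + 1)) ≤ _ by omega))
    rcases h : t.ac with _ | ⟨a, ac⟩
    · simp only [Tape.get, Tape.set, h]
      refine ((Exec.push .ac _ _).le (by omega)).conv ?_
      simp [Tape.get, Tape.set, gateStep]
    · simp only [Tape.get, Tape.set, h]
      refine ((Exec.push .w _ _).seq (Exec.push .w _ _)).conv ?_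
      simp [Tape.get, Tape.set, gateStep]
  · rcases h : t.w with _ | ⟨a, w⟩
    · simp only [Tape.get, Tape.set, h]
      refine ((Exec.skip _).le (by omega)).conv ?_
      simp [gateStep]
    · simp only [Tape.get, Tape.set, h]
      refine ((Exec.push .w2 _ _).le (by omega)).conv ?_
      simp [Tape.get, Tape.set, gateStep]

/-- Evaluate the gate list `g` on the bits of `c`; the wires are left on `w`. -/
def evalPass : Prog Stk Γ :=
  move .c .c2 ;;
  .loop .c2 (fun b => .push .c b ;; .push .w (!b) ;; .push .w b) ;;
  .loop .g stepProg ;; move .g2 .g ;; move .w2 .w ;; clear .ac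

theorem exec_evalPass (G c : List Bool) (t : Tape) (hg : t.g = G) (hg2 : t.g2 = [])
    (hw : t.w = []) (hw2 : t.w2 = []) (hac : t.ac = []) (hc : t.c = c) (hc2 : t.c2 = []) :
    Exec (evalPass : Prog Stk Γ) t (4 * G.length * (c.length + G.length) +
        20 * (c.length + G.length) + 10)
      { t with w := (gateState G c).1.reverse ++ (gateState G c).2.1 } := by
  have h2 (l : List Bool) (t : Tape) (hc : t.c2 = l) :
      Exec (.loop .c2 (fun b => .push .c b ;; .push .w (!b) ;; .push .w b) : Prog Stk Γ) t
        (4 * l.length + 1) { t with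
          c2 := []
          c := l.reverse ++ t.c
          w := initWires l.reverse ++ t.w } := by
    induction l generalizing t with
    | nil =>
      refine (Exec.loop_nil (by simpa [Tape.get] using hc)).conv ?_
      ext1 <;> simp_all [initWires]
    | cons b l ih =>
      refine ((Exec.loop_cons (show t.get .c2 = b :: l from hc)
        ((Exec.push .c b _).seq ((Exec.push .w _ _).seq (Exec.push .w b _))) (ih _ rfl)).le
        (show 1 + (1 + (1 + 1)) + (4 * l.length + 1) ≤ _ by simp; omega)).conv ?_
      simp [Tape.set, Tape.get, initWires]
  have h1 := Exec.move (Γ := Γ) (a := .c) (b := .c2) (by simp) t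
  let F (i : ℕ) : Tape := { t with
    g := G.drop i
    g2 := (G.take i).reverse
    w2 := (gateState (G.take i) c).1
    w := (gateState (G.take i) c).2.1
    ac := (gateState (G.take i) c).2.2 }
  have h3 : Exec (.loop .g stepProg : Prog Stk Γ) (F 0)
      (G.length * (4 * (c.length + G.length) + 8 + 1) + 1) (F G.length) := by
    refine Exec.loop_seq F _ _ (by simp [F, Tape.get]) fun i hi =>
      ⟨G[i], G.drop (i + 1), List.drop_eq_getElem_cons hi, ?_⟩
    have ht : G.take (i + 1) = G.take i ++ [G[i]] := (List.take_append_getElem hi).symm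
    have hs : gateState (G.take (i + 1)) c = gateStep (gateState (G.take i) c) G[i] := by
      rw [ht, gateState_append]
    refine ((exec_stepProg _ _).le ?_).conv ?_
    · have := (length_gateState (G.take i) c).1
      have h' : (G.take i).length ≤ G.length := by simp
      simp only [F, Tape.set]
      omega
    · simp only [F, Tape.set, hs]
      rw [ht, List.reverse_append]
      rfl
  have e2 : ({ (t.set .c []).set .c2 (t.c.reverse ++ t.c2) with
      c2 := []
      c := t.c.reverse.reverse ++ []
      w := initWires t.c.reverse.reverse ++ t.w } : Tape) = F 0 := by
    simp only [F, Tape.set]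
    simp [gateState, hg, hg2, hw, hw2, hac, hc, hc2]
  have h4 := h2 t.c.reverse ((t.set .c []).set .c2 (t.c.reverse ++ t.c2))
    (by simp [Tape.set, hc2])
  have hl := length_gateState G c
  refine ((h1.seq ((h4.conv e2).seq (h3.seq ((Exec.move (by simp) _).seq
    ((Exec.move (by simp) _).seq (Exec.clear .ac _)))))).le ?_).conv ?_
  · simp [F, Tape.get, Tape.set, hc]
    ring_nf
    ring_nf at hl
    omega
  · simp [F, Tape.get, Tape.set, hg, hg2, hw2, hac, hc]

end CountingMeasure

end

noncomputable section

namespace CountingMeasure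

open Filter Computability

variable {Γ : Type}

/-! ### The verifier -/

/-- Split the witness `q` into its unary header `nn` and the gate list `g`. -/
def headerPass : Prog Stk Γ :=
  .push .fl true ;;
  .loop .q (fun b => .pop .fl fun o =>
    if o.isSome then (if b then .push .nn true ;; .push .fl true else .skip) else .push .g b) ;;
  clear .fl

/-- The number in the header of a witness. -/
def headNum (Q : List Bool) : ℕ := (Q.takeWhile id).length

/-- The gate list of a witness. -/
def gateList (Q : List Bool) : List Bool := (Q.dropWhile id).tail.reverse

theorem headNum_le (Q : List Bool) : headNum Q ≤ Q.length :=
  (List.takeWhile_prefix id).length_le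

theorem length_gateList_le (Q : List Bool) : (gateList Q).length ≤ Q.length := by
  have := (List.dropWhile_suffix (l := Q) id).length_le
  simp [gateList]
  omega

theorem exec_headerPass (Q : List Bool) (t : Tape) (hq : t.q = Q) (hf : t.fl = [])
    (hn : t.nn = []) (hg : t.g = []) :
    Exec (headerPass : Prog Stk Γ) t (4 * Q.length + 5)
      { t with q := [], nn := List.replicate (headNum Q) true, g := gateList Q } := by
  have h1 (l : List Bool) (t : Tape) (hq : t.q = l) (hf : t.fl = []) :
      Exec (.loop .q (fun b => .pop .fl fun o =>
        if o.isSome then (if b then .push .nn true ;; .push .fl true else .skip) else .push .g b) :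
        Prog Stk Γ) t (3 * l.length + 1) { t with q := [], g := l.reverse ++ t.g } := by
    induction l generalizing t with
    | nil =>
      refine (Exec.loop_nil (by simpa [Tape.get] using hq)).conv ?_
      ext1 <;> simp_all
    | cons b l ih =>
      have h := ih { t with q := l, g := b :: t.g, fl := [] } rfl rfl
      refine ((Exec.loop_cons (show t.get .q = b :: l from hq) (T := 2)
        (t' := { t with q := l, g := b :: t.g, fl := [] }) (Exec.pop ?_) h).le ?_).conv ?_
      · simp only [Tape.get, Tape.set, hf]
        exact Exec.push .g b _
      · simp
        omega
      · simp [hf]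
  have h2 (l : List Bool) (t : Tape) (hq : t.q = l) (hf : t.fl = [true]) :
      Exec (.loop .q (fun b => .pop .fl fun o =>
        if o.isSome then (if b then .push .nn true ;; .push .fl true else .skip) else .push .g b) :
        Prog Stk Γ) t (4 * l.length + 1)
        { t with
          q := []
          fl := if l.all id then [true] else []
          nn := List.replicate (headNum l) true ++ t.nn
          g := gateList l ++ t.g } := by
    induction l generalizing t with
    | nil =>
      refine (Exec.loop_nil (by simpa [Tape.get] using hq)).conv ?_
      ext1 <;> simp_all [headNum, gateList]
    | cons b l ih =>
      rcases b with _ | _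
      · have h := h1 l { t with q := l, fl := [] } rfl rfl
        refine ((Exec.loop_cons (show t.get .q = false :: l from hq) (T := 2)
          (t' := { t with q := l, fl := [] }) (Exec.pop ?_) h).le ?_).conv ?_
        · simp only [Tape.get, Tape.set, hf]
          exact Exec.skip _
        · simp
          omega
        · simp [headNum, gateList]
      · have h := ih { t with q := l, nn := true :: t.nn } rfl hf
        refine ((Exec.loop_cons (show t.get .q = true :: l from hq) (T := 3)
          (t' := { t with q := l, nn := true :: t.nn }) (Exec.pop ?_) h).le ?_).conv ?_
        · simp only [Tape.get, Tape.set, hf]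
          refine ((Exec.push .nn true _).seq (Exec.push .fl true _)).conv ?_
          simp [Tape.get, Tape.set]
        · simp
          omega
        · simp [headNum, gateList, List.replicate_succ']
  refine (((Exec.push .fl true t).seq ((h2 Q _ ?_ ?_).seq (Exec.clear .fl _))).le ?_).conv ?_
  · simp [Tape.set, hq]
  · simp [Tape.get, Tape.set, hf]
  · simp only [Tape.get]
    split_ifs <;> simp <;> omega
  · simp [Tape.set, hf, hn, hg]

/-- The reaction to a growing counter: count down `nn`, then count up `ph`. -/
def overflow : Prog Stk Γ := .pop .nn fun o => if o.isSome then .skip else .push .ph true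

/-- The stacks `nn` and `ph` are the two truncated differences of `n` and the counter's length. At
most one of them is nonempty, so an overflow shortens `nn` while it can and otherwise extends `ph`.
-/
theorem exec_inc_overflow (n k : ℕ) (t : Tape) (hc : t.c = Nat.bits k) (hc2 : t.c2 = [])
    (hf : t.fl = []) (hn : t.nn = List.replicate (n - Nat.size k) true)
    (hp : t.ph = List.replicate (Nat.size k - n) true) :
    Exec (inc overflow : Prog Stk Γ) t (6 * k + 12)
      { t with
        c := Nat.bits (k + 1)
        nn := List.replicate (n - Nat.size (k + 1)) true
        ph := List.replicate (Nat.size (k + 1) - n) true } := by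
  refine exec_inc k t _ 2 hc hc2 hf ?_
  rw [size_succ]
  by_cases ha : (Nat.bits k).all id
  · simp only [ha, if_true]
    refine Exec.pop ?_
    by_cases hk : Nat.size k < n
    · obtain ⟨m, hm⟩ : ∃ m, n - Nat.size k = m + 1 := ⟨n - Nat.size k - 1, by omega⟩
      simp only [Tape.get, Tape.set, hn, hm, List.replicate_succ]
      refine (Exec.skip _).conv ?_
      rw [show Nat.size k + 1 - n = Nat.size k - n by omega, ← hp,
        show n - (Nat.size k + 1) = m by omega]
      rfl
    · simp only [Tape.get, Tape.set, hn, show n - Nat.size k = 0 by omega]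
      refine (Exec.push .ph true _).conv ?_
      rw [show Nat.size k + 1 - n = Nat.size k - n + 1 by omega,
        show n - (Nat.size k + 1) = 0 by omega]
      simp [Tape.get, Tape.set, hp, List.replicate_succ]
  · simp only [ha]
    refine ((Exec.skip _).le (by omega)).conv ?_
    simp [hn, hp]

/-- Position `i` of a characteristic sequence belongs to strings of length `n`. -/
def Active (n i : ℕ) : Prop := Nat.size (i + 1) = n + 1

instance (n : ℕ) : DecidablePred (Active n) := fun _ => inferInstanceAs (Decidable (_ = _))

/-- The gate list `G` is wrong about the bit of `y` at position `i`. -/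
def Wrong (n : ℕ) (G y : List Bool) (i : ℕ) : Prop :=
  Active n i ∧ gateOut G (Nat.bits (i + 1)) ≠ y.getD i false

instance (n : ℕ) (G y : List Bool) : DecidablePred (Wrong n G y) :=
  fun _ => inferInstanceAs (Decidable (_ ∧ _))

/-- The transcript of the main loop: the bits of `y`, each with a mark telling whether it is at an
active position. -/
def transcript (n : ℕ) (y : List Bool) : ℕ → List Bool
  | 0 => []
  | i + 1 => decide (Active n i) :: y.getD i false :: transcript n y i

theorem length_transcript (n : ℕ) (y : List Bool) (i : ℕ) :
    (transcript n y i).length = 2 * i := by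
  induction i with
  | zero => rfl
  | succ i ih =>
    simp [transcript, ih]
    ring

/-- The body of the main loop. -/
def mainBody (b : Bool) : Prog Stk Γ :=
  .push .out b ;; inc overflow ;;
  .pop .ph fun o =>
    if o.isSome then
      .pop .ph fun o' =>
        if o'.isSome then .push .ph true ;; .push .ph true ;; .push .out false
        else .push .ph true ;; .push .out true ;; evalPass ;;
          .pop .w (fun o => if o.getD false = b then .skip else .push .bad true) ;;
          clear .w ;; .pop .d fun _ => .skip
    else .push .out false

/-- The memory in the main loop, at position `i` of `y`, where `D` is the cost of the gates. -/
def mainTape (n D : ℕ) (G y : List Bool) (i : ℕ) : Tape where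
  x := y.drop i
  g := G
  c := Nat.bits i
  nn := List.replicate (n - Nat.size i) true
  ph := List.replicate (Nat.size i - n) true
  d := List.replicate (D - Nat.count (Active n) i) true
  bad := List.replicate (Nat.count (Wrong n G y) i) true
  out := transcript n y i

/-- Only active positions are evaluated, and each of them also removes one unit of cost from `d`. So
the comparison of the cost with the number of active positions needs no arithmetic. -/
theorem exec_mainBody (n D : ℕ) (G y : List Bool) (i : ℕ) (hi : i < y.length) :
    Exec (mainBody (y.getD i false) : Prog Stk Γ)
      ((mainTape n D G y i).set .x (y.drop (i + 1)))
      (4 * G.length * (y.length + G.length) + 40 * (y.length + G.length) + 50)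
      (mainTape n D G y (i + 1)) := by
  have h1 := exec_inc_overflow (Γ := Γ) n i { mainTape n D G y i with
    x := y.drop (i + 1)
    out := y.getD i false :: transcript n y i } rfl rfl rfl rfl rfl
  have hT : (Nat.bits (i + 1)).length ≤ y.length := by
    rw [length_bits]
    exact (size_le_self _).trans hi
  have hmul : 4 * G.length * ((Nat.bits (i + 1)).length + G.length) ≤
    4 * G.length * (y.length + G.length) := by gcongr
  refine ((Exec.push .out _ _).seq (h1.seq (Exec.pop
    (T := 4 * G.length * (y.length + G.length) + 34 * (y.length + G.length) + 36) ?_))).le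
    (by omega)
  -- After the increment, position `i` is active exactly when `ph` holds one symbol; popping twice
  -- separates this from none and from several.
  by_cases ha : Active n i
  · have hc : Nat.count (Active n) (i + 1) = Nat.count (Active n) i + 1 := by
      simp [Nat.count_succ, ha]
    have hp : Nat.size (i + 1) - n = 1 := by
      unfold Active at ha
      omega
    simp only [Tape.get, Tape.set, mainTape, hp]
    refine (Exec.pop (T := 4 * G.length * (y.length + G.length) +
      34 * (y.length + G.length) + 35) ?_).le (by omega)
    let B (ph out w bad d : List Bool) : Tape :=
      { x := y.drop (i + 1), g := G, c := Nat.bits (i + 1), ph := ph, out := out, w := w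
        bad := bad, d := d, nn := List.replicate (n - Nat.size (i + 1)) true }
    let o := y.getD i false :: transcript n y i
    let e := List.replicate (Nat.count (Wrong n G y) i) true
    let e' := List.replicate (Nat.count (Wrong n G y) (i + 1)) true
    let d := List.replicate (D - Nat.count (Active n) i) true
    let W := (gateState G (Nat.bits (i + 1))).1.reverse ++ (gateState G (Nat.bits (i + 1))).2.1
    have h2 : Exec (Prog.push .ph true : Prog Stk Γ) (B [] o [] e d) 1 (B [true] o [] e d) :=
      Exec.push .ph true _
    have h3 : Exec (Prog.push .out true : Prog Stk Γ) (B [true] o [] e d) 1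
      (B [true] (true :: o) [] e d) := Exec.push .out true _
    have h4 := exec_evalPass (Γ := Γ) G (Nat.bits (i + 1)) (B [true] (true :: o) [] e d)
      rfl rfl rfl rfl rfl rfl rfl
    have h5 : Exec (Prog.pop .w (fun o => if o.getD false = y.getD i false then .skip
        else .push .bad true) : Prog Stk Γ) (B [true] (true :: o) W e d) 2
        (B [true] (true :: o) W.tail e' d) := by
      refine Exec.pop ?_
      by_cases hg : gateOut G (Nat.bits (i + 1)) = y.getD i false
      · have hw : Nat.count (Wrong n G y) (i + 1) = Nat.count (Wrong n G y) i := by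
          simp [Nat.count_succ, Wrong, hg]
        rw [if_pos (show (Tape.get (B [true] (true :: o) W e d) .w).head?.getD false = _ from hg)]
        simp only [e', hw]
        exact Exec.skip _
      · have hw : Nat.count (Wrong n G y) (i + 1) = Nat.count (Wrong n G y) i + 1 := by
          rw [Nat.count_succ, if_pos ⟨ha, hg⟩]
        rw [if_neg (show ¬ (Tape.get (B [true] (true :: o) W e d) .w).head?.getD false = _ from hg)]
        simp only [e', hw, List.replicate_succ]
        exact Exec.push .bad true _
    have h6 := Exec.clear (Γ := Γ) .w (B [true] (true :: o) W.tail e' d)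
    have h7 : Exec (Prog.pop .d fun _ => .skip : Prog Stk Γ) (B [true] (true :: o) [] e' d) 2
        (mainTape n D G y (i + 1)) := by
      refine Exec.pop ((Exec.skip _).conv ?_)
      simp only [B, d, e', o, Tape.set, Tape.get, mainTape, hp, List.tail_replicate, transcript,
        ha, decide_true, hc]
      rfl
    refine Exec.conv (t' := mainTape n D G y (i + 1))
      ((h2.seq (h3.seq (h4.seq (h5.seq (h6.seq h7))))).le ?_) (by simp [mainTape, hp])
    have hl := (length_gateState G (Nat.bits (i + 1))).1
    have hW : W.length = (gateState G (Nat.bits (i + 1))).1.length +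
      (gateState G (Nat.bits (i + 1))).2.1.length := by simp [W]
    have hW' : (Tape.get (B [true] (true :: o) W.tail e' d) .w).length = W.length - 1 := by
      simp [B, Tape.get]
    rw [hW']
    omega
  · have hc : Nat.count (Active n) (i + 1) = Nat.count (Active n) i := by
      simp [Nat.count_succ, ha]
    have hw : Nat.count (Wrong n G y) (i + 1) = Nat.count (Wrong n G y) i := by
      simp [Nat.count_succ, Wrong, ha]
    by_cases hp : Nat.size (i + 1) ≤ n
    · have hp' : Nat.size (i + 1) - n = 0 := by omega
      simp only [Tape.get, Tape.set, mainTape, hp']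
      refine ((Exec.push .out false _).le (by omega)).conv ?_
      simp [Tape.get, Tape.set, hc, hw, transcript, ha]
    · obtain ⟨m, hm⟩ : ∃ m, Nat.size (i + 1) - n = m + 2 := ⟨Nat.size (i + 1) - n - 2, by
        unfold Active at ha
        omega⟩
      simp only [Tape.get, Tape.set, mainTape, hm, List.replicate_succ]
      refine ((Exec.pop ((Exec.push .ph true _).seq ((Exec.push .ph true _).seq
        (Exec.push .out false _)))).le ?_).conv ?_
      · omega
      · simp [Tape.get, Tape.set, hc, hw, transcript, ha]

end CountingMeasure

end

noncomputable section

namespace CountingMeasure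

open Filter Computability

variable {Γ : Type}

/-- The witness `Q` (a unary number `n` and a gate list) is correct for `y`: the sequence `y`
contains all bits for strings of length `n`, the gate list computes them, and its cost is at most
`2 ^ n`. If `exact` is set, then `n` must be maximal. -/
def Passes (exact : Bool) (Q y : List Bool) : Prop :=
  Nat.count (Wrong (headNum Q) (gateList Q) y) y.length = 0 ∧
  cost (numGates (gateList Q)) ≤ Nat.count (Active (headNum Q)) y.length ∧
  2 ≤ Nat.size (y.length + 1) - headNum Q ∧
  (exact = true → Nat.size (y.length + 1) - headNum Q = 2)

instance (exact : Bool) (Q y : List Bool) : Decidable (Passes exact Q y) :=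
  inferInstanceAs (Decidable (_ ∧ _ ∧ _ ∧ (_ → _)))

/-- The main part of the verifier. -/
def corePass : Prog Stk Γ :=
  headerPass ;; costPass ;; .loop .x mainBody ;; inc overflow

/-- The increment after the loop moves the counter to `y.length + 1`. Then `ph` has at least two
symbols iff the block of length `n` is complete, and exactly two iff it is moreover the last
complete block. -/
theorem exec_corePass (Q y : List Bool) (L : ℕ) (hQ : Q.length ≤ L) (hy : y.length ≤ L) :
    Exec (corePass : Prog Stk Γ) { x := y, q := Q }
      (8 * L ^ 3 + 100 * L ^ 2 + 200 * L + 50)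
      { mainTape (headNum Q) (cost (numGates (gateList Q))) (gateList Q) y y.length with
        c := Nat.bits (y.length + 1)
        nn := List.replicate (headNum Q - Nat.size (y.length + 1)) true
        ph := List.replicate (Nat.size (y.length + 1) - headNum Q) true } := by
  have h1 := exec_headerPass (Γ := Γ) Q { x := y, q := Q } rfl rfl rfl rfl
  have hG := length_gateList_le Q
  generalize gateList Q = G at *
  generalize headNum Q = n at *
  have h2 := exec_costPass (Γ := Γ) G { x := y, nn := List.replicate n true, g := G }
    rfl rfl rfl rfl rfl rfl rfl
  have h3 : Exec (.loop .x mainBody : Prog Stk Γ) (mainTape n (cost (numGates G)) G y 0) _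
      (mainTape n (cost (numGates G)) G y y.length) :=
    Exec.loop_seq (mainTape n (cost (numGates G)) G y) y.length _ (by simp [mainTape, Tape.get])
      fun i hi => ⟨y.getD i false, y.drop (i + 1), by
        rw [List.getD_eq_getElem _ _ hi]
        exact List.drop_eq_getElem_cons hi, exec_mainBody n _ G y i hi⟩
  have h4 := exec_inc_overflow (Γ := Γ) n y.length (mainTape n (cost (numGates G)) G y y.length)
    rfl rfl rfl rfl rfl
  have e : mainTape n (cost (numGates G)) G y 0 =
      { x := y, g := G, nn := List.replicate n true
        d := List.replicate (cost (numGates G)) true } := by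
    simp [mainTape, transcript]
  rw [e] at h3
  refine (h1.seq (h2.seq (h3.seq h4))).le ?_
  · have hGL : G.length ≤ L := hG.trans hQ
    calc _ ≤ 4 * L + 5 + (11 * L ^ 2 + 50 * L + 10 + (L * (4 * L * (L + L) + 40 * (L + L) + 50 + 1)
          + 1 + (6 * L + 12))) := by gcongr
      _ ≤ _ := by
        ring_nf
        omega

/-- Decide whether the verifier has succeeded. -/
def verdict (exact : Bool) (acc rej : Prog Stk Γ) : Prog Stk Γ :=
  .pop .bad fun o => if o.isSome then rej else
  .pop .d fun o => if o.isSome then rej else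
  .pop .ph fun o => if o.isSome then
    .pop .ph fun o => if o.isSome then
      .pop .ph fun o => if exact && o.isSome then rej else acc
      else rej
    else rej

/-- Only the first few symbols are inspected. The amounts `a'`, `b'`, `c'` left behind depend on the
branch and matter only for the cost of clearing. -/
theorem exec_verdict (exact : Bool) (acc rej : Prog Stk Γ) (T a b c : ℕ) (t : Tape)
    (oa or : List Bool) (ha : t.bad = List.replicate a true) (hb : t.d = List.replicate b true)
    (hc : t.ph = List.replicate c true)
    (hacc : ∀ s : Tape, s.out = t.out → Exec acc s T { s with out := oa })
    (hrej : ∀ s : Tape, s.out = t.out → Exec rej s T { s with out := or }) :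
    ∃ a' b' c', a' ≤ a ∧ b' ≤ b ∧ c' ≤ c ∧ Exec (verdict exact acc rej) t (T + 5)
      { t with
        bad := List.replicate a' true
        d := List.replicate b' true
        ph := List.replicate c' true
        out := if a = 0 ∧ b = 0 ∧ 2 ≤ c ∧ (exact = true → c = 2) then oa else or } := by
  rcases a with _ | a
  swap
  · refine ⟨a, b, c, by omega, le_rfl, le_rfl, Exec.le (T := T + 1) (Exec.pop ?_) (by omega)⟩
    simp only [Tape.get, ha, Tape.set]
    refine (hrej _ (by rfl)).conv ?_
    simp [hb, hc]
  rcases b with _ | b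
  swap
  · refine ⟨0, b, c, by omega, by omega, le_rfl,
      Exec.le (T := T + 1 + 1) (Exec.pop ?_) (by omega)⟩
    simp only [Tape.get, ha, Tape.set]
    refine Exec.pop ?_
    simp only [Tape.get, hb, Tape.set]
    refine (hrej _ (by rfl)).conv ?_
    simp [hc]
  have step (p : Prog Stk Γ) (c' : ℕ) (o : List Bool)
      (h : Exec (.pop .ph fun o => if o.isSome then
        .pop .ph fun o => if o.isSome then
        .pop .ph fun o => if exact && o.isSome then rej else acc
        else rej else rej) { t with bad := [], d := [] } (T + 3)
        { t with bad := [], d := [], ph := List.replicate c' true, out := o }) :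
      Exec (verdict exact acc rej) t (T + 5)
        { t with bad := [], d := [], ph := List.replicate c' true, out := o } := by
    refine Exec.pop ?_
    simp only [Tape.get, ha, Tape.set]
    refine Exec.pop ?_
    simp only [Tape.get, hb, Tape.set]
    exact h
  rcases c with _ | _ | _ | c
  · refine ⟨0, 0, 0, le_rfl, le_rfl, le_rfl, step rej 0 _ ?_⟩
    refine Exec.le (T := T + 1) (Exec.pop ?_) (by omega)
    simp only [Tape.get, hc, Tape.set]
    exact (hrej _ (by rfl)).conv (by simp)
  · refine ⟨0, 0, 0, le_rfl, le_rfl, by omega, step rej 0 _ ?_⟩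
    refine Exec.le (T := T + 1 + 1) (Exec.pop ?_) (by omega)
    simp only [Tape.get, hc, Tape.set]
    refine Exec.pop ?_
    simp only [Tape.get, Tape.set]
    exact (hrej _ (by rfl)).conv (by simp)
  · refine ⟨0, 0, 0, le_rfl, le_rfl, by omega, step acc 0 _ ?_⟩
    refine Exec.pop ?_
    simp only [Tape.get, hc, Tape.set]
    refine Exec.pop ?_
    simp only [Tape.get, Tape.set]
    refine Exec.pop ?_
    simp only [Tape.get, Tape.set]
    rcases exact with _ | _ <;> exact (hacc _ (by rfl)).conv (by simp)
  · refine ⟨0, 0, c, le_rfl, le_rfl, by omega, step acc c _ ?_⟩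
    refine Exec.pop ?_
    simp only [Tape.get, hc, Tape.set]
    refine Exec.pop ?_
    simp only [Tape.get, Tape.set]
    refine Exec.pop ?_
    simp only [Tape.get, Tape.set]
    rcases exact with _ | _
    · exact (hacc _ (by rfl)).conv (by simp)
    · exact (hrej _ (by rfl)).conv (by simp)

/-- The verifier, without the input and output stages. -/
def verifier (exact : Bool) (acc rej : Prog Stk Γ) : Prog Stk Γ :=
  corePass ;; verdict exact acc rej ;;
    clearAll [.x, .y, .q, .g, .g2, .w, .w2, .ac, .c, .c2, .fl, .nn, .ph, .d, .bad]

theorem cost_le (s : ℕ) : cost s ≤ s * (s + 10) := by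
  rw [cost]
  refine (Finset.sum_le_card_nsmul _ _ (s + 10) fun k hk => ?_).trans (by simp)
  have := size_le_self (k + 1)
  rw [Finset.mem_range] at hk
  omega

/-- Both machines share this core. The NP verifier replaces the transcript by a bit, while the
transducer keeps it, with a `true` in front, or erases it. -/
theorem exec_verifier (exact : Bool) (acc rej : Prog Stk Γ) (Q y : List Bool) (L T : ℕ)
    (hQ : Q.length ≤ L) (hy : y.length ≤ L) (oa or : List Bool)
    (hacc : ∀ s : Tape, s.out = transcript (headNum Q) y y.length →
      Exec acc s T { s with out := oa })
    (hrej : ∀ s : Tape, s.out = transcript (headNum Q) y y.length →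
      Exec rej s T { s with out := or })
    (hoa : oa.length ≤ 2 * L + 1) (hor : or.length ≤ 2 * L + 1) :
    Exec (verifier exact acc rej) { x := y, q := Q }
      (8 * L ^ 3 + 130 * L ^ 2 + 600 * L + 200 + T)
      { out := if Passes exact Q y then oa else or } := by
  have h1 := exec_corePass (Γ := Γ) Q y L hQ hy
  obtain ⟨a, b, c, ha, hb, hc, h2⟩ := exec_verdict exact acc rej T
    (Nat.count (Wrong (headNum Q) (gateList Q) y) y.length)
    (cost (numGates (gateList Q)) - Nat.count (Active (headNum Q)) y.length)
    (Nat.size (y.length + 1) - headNum Q)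
    { mainTape (headNum Q) (cost (numGates (gateList Q))) (gateList Q) y y.length with
        c := Nat.bits (y.length + 1)
        nn := List.replicate (headNum Q - Nat.size (y.length + 1)) true
        ph := List.replicate (Nat.size (y.length + 1) - headNum Q) true }
    oa or rfl rfl rfl hacc hrej
  have e : (Nat.count (Wrong (headNum Q) (gateList Q) y) y.length = 0 ∧
    cost (numGates (gateList Q)) - Nat.count (Active (headNum Q)) y.length = 0 ∧
    2 ≤ Nat.size (y.length + 1) - headNum Q ∧
    (exact = true → Nat.size (y.length + 1) - headNum Q = 2)) = Passes exact Q y := by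
    rw [Passes, Nat.sub_eq_zero_iff_le]
  simp only [e] at h2
  have hG := length_gateList_le Q
  have hn := headNum_le Q
  have hcost : cost (numGates (gateList Q)) ≤ L * (L + 10) := by
    have hs : numGates (gateList Q) ≤ L :=
      (Nat.div_le_self _ _).trans (List.count_le_length.trans (hG.trans hQ))
    exact (cost_le _).trans (by gcongr)
  have hs := size_le_self (y.length + 1)
  have hw : Nat.count (Wrong (headNum Q) (gateList Q) y) y.length ≤ y.length := Nat.count_le _
  refine ((h1.seq (h2.seq (Exec.clearAll _ _ (B := L * (L + 10) + 2 * L + 2) ?_))).le ?_).conv ?_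
  · intro k
    cases k <;> simp only [Tape.get, mainTape, List.length_replicate, length_bits, List.length_nil,
      List.length_drop]
    all_goals try omega
    split_ifs <;> omega
  · simp only [List.length_cons, List.length_nil]
    ring_nf
    omega
  · simp [Tape.set, mainTape]

/-! ### The two machines -/

/-- The input stage of the verifier for pairs `(x, u)`. -/
def pairInput : Prog Stk (Bool ⊕ Bool) :=
  .input (Sum.elim (fun b => .push .y b) fun b => .push .q b) ;; move .y .x

/-- Reading onto a stack reverses the witness; this is the source of the reversals in later
statements. -/
theorem run_pairInput (x u : List Bool) :
    Prog.Run pairInput (x.map .inl ++ u.map .inr, Tape.get {})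
      (4 * (x.length + u.length) + 2) ([], Tape.get { x := x, q := u.reverse }) := by
  have h2 (u : List Bool) (t : Tape) :
      Prog.Run (.input (Sum.elim (fun b => .push .y b) fun b => .push .q b))
        ((u.map .inr : List (Bool ⊕ Bool)), t.get)
        (2 * u.length + 1) ([], Tape.get { t with q := u.reverse ++ t.q }) := by
    induction u generalizing t with
    | nil => exact Prog.Run.input_nil
    | cons b u ih =>
      rw [List.reverse_cons, List.append_assoc]
      exact (Prog.Run.input_cons (a := .inr b) (Exec.push .q b t _) (ih _)).le
        (show 1 + 1 + (2 * u.length + 1) ≤ 2 * (b :: u).length + 1 by simp; omega)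
  have h1 (x u : List Bool) (t : Tape) :
      Prog.Run (.input (Sum.elim (fun b => .push .y b) fun b => .push .q b))
        (x.map .inl ++ u.map .inr, t.get) (2 * (x.length + u.length) + 1)
        ([], Tape.get { t with y := x.reverse ++ t.y, q := u.reverse ++ t.q }) := by
    induction x generalizing t with
    | nil => simpa using h2 u t
    | cons b x ih =>
      rw [List.reverse_cons, List.append_assoc]
      exact (Prog.Run.input_cons (a := .inl b) (Exec.push .y b t _) (ih _)).le
        (show _ ≤ 2 * ((b :: x).length + u.length) + 1 by simp; omega)
  have h3 := Exec.move (Γ := Bool ⊕ Bool) (a := .y) (b := .x) (by simp)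
    { y := x.reverse ++ [], q := u.reverse ++ [] }
  refine (Prog.Run.seq (h1 x u {}) ((h3.conv (t'' := { x := x, q := u.reverse }) ?_) [])).le ?_
  · simp [Tape.set, Tape.get]
  · simp [Tape.get]
    omega

theorem polyTime_passes :
    PolyTime (encodingProd (encodingList Bool) (encodingList Bool)) encodingBoolBool
      (fun a : Str × Str => decide (Passes true a.2.reverse a.1)) := by
  refine Prog.polyTime (pairInput ;; verifier true (clear .out ;; .push .out true)
    (clear .out ;; .push .out false)) .out
    (4 * .X + 2 + (8 * .X ^ 3 + 130 * .X ^ 2 + 600 * .X + 200 + (4 * .X + 2))) fun a => ?_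
  have h1 := run_pairInput a.1 a.2
  have h2 := exec_verifier (Γ := Bool ⊕ Bool) true (clear .out ;; .push .out true)
    (clear .out ;; .push .out false) a.2.reverse a.1 (a.1.length + a.2.length)
    (4 * (a.1.length + a.2.length) + 2) (by simp) (by simp) [true] [false] (fun s hs =>
      (((Exec.clear .out s).seq (Exec.push .out true _)).le (by
        simp only [Tape.get, hs, length_transcript]
        omega)).conv (by simp [Tape.set, Tape.get]))
    (fun s hs =>
      (((Exec.clear .out s).seq (Exec.push .out false _)).le (by
        simp only [Tape.get, hs, length_transcript]
        omega)).conv (by simp [Tape.set, Tape.get])) (by simp) (by simp)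
  rw [← get_out, ← get_empty]
  refine cast ?_ (Prog.Run.seq h1 (h2 []))
  have e : encodingBoolBool.encode (decide (Passes true a.2.reverse a.1)) =
      if Passes true a.2.reverse a.1 then [true] else [false] := by
    split_ifs with h <;> simp [h, encodingBoolBool, encodeBool]
  rw [e]
  congr 1
  simp [encodingProd, encodingList]

/-- The symbols of a list at even positions. -/
def evens : List Bool → List Bool
  | [] => []
  | [a] => [a]
  | a :: _ :: l => a :: evens l

/-- The symbols of a list at odd positions. -/
def odds : List Bool → List Bool
  | [] => []
  | [_] => []
  | _ :: b :: l => b :: odds l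

theorem length_evens_le (u : List Bool) : (evens u).length ≤ u.length := by
  induction u using evens.induct with
  | case1 => simp [evens]
  | case2 => simp [evens]
  | case3 a b l ih =>
    simp [evens]
    omega

theorem length_odds_le (u : List Bool) : (odds u).length ≤ u.length := by
  induction u using evens.induct with
  | case1 => simp [odds]
  | case2 => simp [odds]
  | case3 a b l ih =>
    simp [odds]
    omega

/-- The input stage of the transducer, for inputs `((w, r), u)`. -/
def tripleInput : Prog Stk ((Bool ⊕ Bool) ⊕ Bool) :=
  .input (Sum.elim (Sum.elim (fun b => .push .y b) fun _ => .skip) fun b =>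
    .pop .fl fun o => if o.isSome then .push .q b else .push .fl true ;; .push .y b) ;;
  clear .fl ;; move .y .x

theorem run_tripleInput (w v u : List Bool) :
    Prog.Run tripleInput
      ((w.map Sum.inl ++ v.map Sum.inr).map Sum.inl ++ u.map Sum.inr, Tape.get {})
      (6 * (w.length + v.length + u.length) + 10)
      ([], Tape.get { x := w ++ evens u, q := (odds u).reverse }) := by
  -- The stack `fl` holds the parity of the position in `u`, so `f` is nonempty when `u` has odd
  -- length. Splitting by parity spares the machine from computing where the extension ends.
  have h3 (u : List Bool) (t : Tape) (hf : t.fl = []) : ∃ f : List Bool, f.length ≤ 1 ∧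
      Prog.Run (.input (Sum.elim (Sum.elim (fun b => .push .y b) fun _ => .skip) fun b =>
        .pop .fl fun o => if o.isSome then .push .q b else .push .fl true ;; .push .y b))
        ((u.map .inr : List ((Bool ⊕ Bool) ⊕ Bool)), t.get) (4 * u.length + 1)
        ([], Tape.get { t with
          y := (evens u).reverse ++ t.y
          q := (odds u).reverse ++ t.q
          fl := f }) := by
    induction u using evens.induct generalizing t with
    | case1 =>
      refine ⟨[], by simp, ?_⟩
      have e : ({ t with fl := [] } : Tape) = t := by rw [← hf]
      simp only [evens, odds, List.reverse_nil, List.nil_append, e]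
      exact Prog.Run.input_nil
    | case2 a =>
      refine ⟨[true], by simp, ?_⟩
      refine (Prog.Run.input_cons (a := Sum.inr a) (t := 3) (s' := ([], Tape.get { t with
        y := a :: t.y, fl := [true] })) (Exec.pop ?_ []) Prog.Run.input_nil).le
        (show 1 + 3 + 1 ≤ 4 * [a].length + 1 by simp)
      simp only [Tape.get, Tape.set, hf]
      exact (Exec.push .fl true _).seq (Exec.push .y a _)
    | case3 a b l ih =>
      obtain ⟨f, hf1, h⟩ := ih { t with y := a :: t.y, q := b :: t.q, fl := [] } rfl
      refine ⟨f, hf1, ?_⟩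
      refine (Prog.Run.input_cons (a := .inr a) (t := 3) (t' := 1 + 2 + (4 * l.length + 1))
        (s' := (Sum.inr b :: l.map .inr, Tape.get { t with y := a :: t.y, fl := [true] }))
        (Exec.pop ?_ _)
        (Prog.Run.input_cons (t := 2)
          (s' := (l.map .inr, Tape.get { t with y := a :: t.y, q := b :: t.q, fl := [] }))
          (Exec.pop ?_ _) ?_)).le ?_
      · simp only [Tape.get, Tape.set, hf]
        exact (Exec.push .fl true _).seq (Exec.push .y a _)
      · simp only [Tape.get, Tape.set]
        exact Exec.push .q b _
      · simpa [evens, odds] using h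
      · simp
        omega
  have h2 (v : List Bool) (t : Tape) (hf : t.fl = []) : ∃ f : List Bool, f.length ≤ 1 ∧
      Prog.Run (.input (Sum.elim (Sum.elim (fun b => .push .y b) fun _ => .skip) fun b =>
        .pop .fl fun o => if o.isSome then .push .q b else .push .fl true ;; .push .y b))
        ((v.map Sum.inr).map Sum.inl ++ u.map Sum.inr, t.get) (4 * (v.length + u.length) + 1)
        ([], Tape.get { t with
          y := (evens u).reverse ++ t.y
          q := (odds u).reverse ++ t.q
          fl := f }) := by
    induction v generalizing t with
    | nil => simpa using h3 u t hf
    | cons b v ih =>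
      obtain ⟨f, hf1, h⟩ := ih t hf
      refine ⟨f, hf1, Prog.Run.le (Prog.Run.input_cons (a := Sum.inl (Sum.inr b)) (Exec.skip t _) h) ?_⟩
      simp
      omega
  have h1 (w : List Bool) (t : Tape) (hf : t.fl = []) : ∃ f : List Bool, f.length ≤ 1 ∧
      Prog.Run (.input (Sum.elim (Sum.elim (fun b => .push .y b) fun _ => .skip) fun b =>
        .pop .fl fun o => if o.isSome then .push .q b else .push .fl true ;; .push .y b))
        ((w.map Sum.inl ++ v.map Sum.inr).map Sum.inl ++ u.map Sum.inr, t.get)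
        (4 * (w.length + v.length + u.length) + 1)
        ([], Tape.get { t with
          y := (w ++ evens u).reverse ++ t.y
          q := (odds u).reverse ++ t.q
          fl := f }) := by
    induction w generalizing t with
    | nil => simpa using h2 v t hf
    | cons b w ih =>
      obtain ⟨f, hf1, h⟩ := ih (t.set .y (b :: t.y)) hf
      refine ⟨f, hf1, ?_⟩
      rw [List.cons_append, List.reverse_cons, List.append_assoc]
      exact (Prog.Run.input_cons (a := .inl (.inl b)) (Exec.push .y b t _) h).le
        
        (show _ ≤ 4 * ((b :: w).length + v.length + u.length) + 1 by simp; omega)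
  obtain ⟨f, hf, h⟩ := h1 w {} rfl
  have h4 := Exec.clear (Γ := (Bool ⊕ Bool) ⊕ Bool) .fl
    { y := (w ++ evens u).reverse ++ [], q := (odds u).reverse ++ [], fl := f }
  have h5 := Exec.move (Γ := (Bool ⊕ Bool) ⊕ Bool) (a := .y) (b := .x) (by simp)
    { y := (w ++ evens u).reverse ++ [], q := (odds u).reverse ++ [] }
  refine (Prog.Run.seq h (((h4.seq h5).conv
    (t'' := { x := w ++ evens u, q := (odds u).reverse }) ?_) [])).le ?_
  · simp [Tape.set, Tape.get]
  · have := length_evens_le u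
    simp [Tape.get]
    omega

/-- The transducer of the SpanP function: on input `((w, r), u)`, the random bits `u` are split
into an extension of `w` and a witness, and the transcript is output if the witness is correct. -/
def transducer (a : (Str × ℕ) × Str) : Option Str :=
  if Passes false (odds a.2).reverse (a.1.1 ++ evens a.2) then
    some (transcript (headNum (odds a.2).reverse) (a.1.1 ++ evens a.2)
      (a.1.1 ++ evens a.2).length)
  else none

theorem polyTime_transducer :
    PolyTime (encodingProd encodingStrUnary (encodingList Bool)) encodingOutput transducer := by
  refine Prog.polyTime (tripleInput ;; verifier false (.push .out true) (clear .out)) .out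
    (6 * .X + 10 + (8 * .X ^ 3 + 130 * .X ^ 2 + 600 * .X + 200 + (4 * .X + 2))) fun a => ?_
  have h1 := run_tripleInput a.1.1 (List.replicate a.1.2 true) a.2
  have he := length_evens_le a.2
  have ho := length_odds_le a.2
  have h2 := exec_verifier (Γ := (Bool ⊕ Bool) ⊕ Bool) false (.push .out true) (clear .out)
    (odds a.2).reverse (a.1.1 ++ evens a.2)
    (a.1.1.length + (List.replicate a.1.2 true).length + a.2.length)
    (4 * (a.1.1.length + (List.replicate a.1.2 true).length + a.2.length) + 2)
    (by simp; omega) (by simp; omega)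
    (true :: transcript (headNum (odds a.2).reverse) (a.1.1 ++ evens a.2)
      (a.1.1 ++ evens a.2).length) [] (fun s hs =>
      ((Exec.push .out true _).le (by omega)).conv (by simp [Tape.set, Tape.get, hs]))
    (fun s hs =>
      ((Exec.clear .out s).le (by
        simp only [Tape.get, hs, length_transcript, List.length_append]
        omega)).conv (by simp [Tape.set]))
    (by simp [length_transcript]; omega) (by simp)
  rw [← get_out, ← get_empty]
  refine cast ?_ (Prog.Run.seq h1 (h2 []))
  have e : encodingOutput.encode (transducer a) =
      if Passes false (odds a.2).reverse (a.1.1 ++ evens a.2) then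
        true :: transcript (headNum (odds a.2).reverse) (a.1.1 ++ evens a.2)
          (a.1.1 ++ evens a.2).length else [] := by
    rw [transducer]
    split_ifs <;> rfl
  rw [e]
  congr 1
  · simp [encodingStrUnary, encodingProd, encodingList, unaryEncodingNat, unaryEncodeNat_eq]
  · simp [encodingStrUnary, encodingProd, encodingList, unaryEncodingNat, unaryEncodeNat_eq,
      add_assoc]

end CountingMeasure

end

/-! ### Straight-line programs over truth tables. -/

noncomputable section

namespace CountingMeasure

open Filter Computability

/-! ### Straight-line programs over functions -/

/-- Boolean functions on `{0, …, 2 ^ n - 1}`, i.e. truth tables. -/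
abbrev Table (n : ℕ) : Type := Fin (2 ^ n) → Bool

/-- The bits of the `j`-th string of length `n` (least significant first), followed by a one. -/
def point {n : ℕ} (j : Fin (2 ^ n)) : List Bool := Nat.bits (2 ^ n + j)

theorem size_two_pow_add {n j : ℕ} (hj : j < 2 ^ n) : Nat.size (2 ^ n + j) = n + 1 := by
  refine le_antisymm (Nat.size_le.2 (by rw [pow_succ]; omega)) ?_
  exact Nat.lt_size.2 (by omega)

theorem length_point {n : ℕ} (j : Fin (2 ^ n)) : (point j).length = n + 1 := by
  rw [point, length_bits, size_two_pow_add j.2]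

theorem length_initWires (c : List Bool) : (initWires c).length = 2 * c.length := by
  induction c with
  | nil => rfl
  | cons b c ih =>
    simp [initWires] at ih ⊢
    omega

variable {n : ℕ}

/-- The functions available without any gate. -/
def baseFn (n q : ℕ) : Table n := fun j => (initWires (point j)).getD q false

/-- The functions available to a gate, given the functions computed by earlier gates. -/
def IsRef (l : List (Table n)) (u : Table n) : Prop :=
  u = ⊥ ∨ (∃ q < 2 * (n + 1), u = baseFn n q) ∨ u ∈ l ∨ uᶜ ∈ l

/-- Sequences of functions (the last one first), each the conjunction of two functions
available to it. -/
inductive Chain : List (Table n) → Prop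
  | nil : Chain []
  | cons {l a b} : Chain l → IsRef l a → IsRef l b → Chain ((a ⊓ b) :: l)

/-- The wires carried by a sequence of functions, at a given point. -/
def wireList (l : List (Table n)) (j : Fin (2 ^ n)) : List Bool :=
  (l.flatMap fun r => [r j, !r j]) ++ initWires (point j)

theorem wireList_cons (r : Table n) (l : List (Table n)) (j : Fin (2 ^ n)) :
    wireList (r :: l) j = r j :: (!r j) :: wireList l j := rfl

theorem length_wireList (l : List (Table n)) (j : Fin (2 ^ n)) :
    (wireList l j).length = 2 * l.length + 2 * (n + 1) := by
  induction l with
  | nil => simp [wireList, length_initWires, length_point]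
  | cons r l ih =>
    rw [wireList_cons, List.length_cons, List.length_cons, ih, List.length_cons]
    ring

theorem IsRef.mono {l l' : List (Table n)} {u : Table n} (h : IsRef l u) (hl : l ⊆ l') :
    IsRef l' u := by
  rcases h with h | h | h | h
  · exact .inl h
  · exact .inr (.inl h)
  · exact .inr (.inr (.inl (hl h)))
  · exact .inr (.inr (.inr (hl h)))

theorem isRef_compl_of_mem {l : List (Table n)} {r : Table n} (h : r ∈ l) : IsRef l rᶜ :=
  .inr (.inr (.inr (by rwa [compl_compl])))

/-- A pointer beyond the last wire reads `false`, hence the zero function among the references. -/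
theorem isRef_wire (l : List (Table n)) (p : ℕ) :
    IsRef l fun j => (wireList l j).getD p false := by
  induction l generalizing p with
  | nil =>
    by_cases hp : p < 2 * (n + 1)
    · exact .inr (.inl ⟨p, hp, rfl⟩)
    · refine .inl (funext fun j => ?_)
      rw [List.getD_eq_default]
      · rfl
      · rw [length_wireList]
        simp
        omega
  | cons r l ih =>
    rcases p with _ | _ | p
    · exact .inr (.inr (.inl (by simp [wireList_cons])))
    · exact isRef_compl_of_mem (l := r :: l) (r := r) (by simp)
    · exact (ih p).mono (by simp)

theorem IsRef.exists_wire {l : List (Table n)} {u : Table n} (h : IsRef l u) :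
    ∃ p ≤ 2 * l.length + 2 * (n + 1), ∀ j, (wireList l j).getD p false = u j := by
  induction l with
  | nil =>
    rcases h with rfl | ⟨q, hq, rfl⟩ | h | h
    -- The first position past all wires serves as a pointer to the zero function.
    · refine ⟨2 * (n + 1), by simp, fun j => List.getD_eq_default _ _ ?_⟩
      rw [length_wireList]
      simp
    · exact ⟨q, by simp; omega, fun j => rfl⟩
    · simp at h
    · simp at h
  | cons r l ih =>
    have key (h : IsRef l u) : ∃ p ≤ 2 * (r :: l).length + 2 * (n + 1),
        ∀ j, (wireList (r :: l) j).getD p false = u j := by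
      obtain ⟨p, hp, e⟩ := ih h
      exact ⟨p + 2, by simp; omega, fun j => by simpa [wireList_cons] using e j⟩
    rcases h with h | h | h | h
    · exact key (.inl h)
    · exact key (.inr (.inl h))
    · rcases List.mem_cons.1 h with rfl | h
      · exact ⟨0, by simp, fun j => rfl⟩
      · exact key (.inr (.inr (.inl h)))
    · rcases List.mem_cons.1 h with h | h
      · refine ⟨1, by simp; omega, fun j => ?_⟩
        rw [wireList_cons, ← h]
        simp
      · exact key (.inr (.inr (.inr h)))

/-! ### Gate lists and straight-line programs -/

/-- The state is a zipper on the wire list `W` with the pointer at `p`. Past the end, `take` and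
`drop` no longer change, in agreement with a pointer that stays put. -/
theorem gateStep_true (W : List Bool) (p : ℕ) (ac : List Bool) :
    gateStep ((W.take p).reverse, W.drop p, ac) true =
      ((W.take (p + 1)).reverse, W.drop (p + 1), ac) := by
  rcases h : W.drop p with _ | ⟨a, w⟩
  · have hp : W.length ≤ p := by simpa using h
    rw [gateStep, List.take_of_length_le hp, List.take_of_length_le (by omega),
      List.drop_of_length_le (by omega)]
  · have hp : p < W.length := by
      by_contra hp
      rw [List.drop_of_length_le (by omega)] at h
      simp at h
    rw [List.drop_eq_getElem_cons hp] at h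
    rw [gateStep, ← List.take_append_getElem hp, (List.cons.inj h).1, (List.cons.inj h).2]
    simp

theorem head_drop (W : List Bool) (p : ℕ) : (W.drop p).head?.getD false = W.getD p false := by
  rw [List.head?_drop, List.getD_eq_getElem?_getD]

theorem gateStep_false_nil (W : List Bool) (p : ℕ) :
    gateStep ((W.take p).reverse, W.drop p, []) false = ([], W, [W.getD p false]) := by
  rw [← head_drop]
  rcases h : W.drop p with _ | ⟨a, w⟩ <;> simp [gateStep, ← h]

theorem gateStep_false_cons (W : List Bool) (p : ℕ) (a : Bool) :
    gateStep ((W.take p).reverse, W.drop p, [a]) false =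
      ([], (a && W.getD p false) :: (!(a && W.getD p false)) :: W, []) := by
  rw [← head_drop]
  rcases h : W.drop p with _ | ⟨b, w⟩ <;> simp [gateStep, ← h]

/-- Every bit string is a meaningful gate list. At all points `j` simultaneously, the state is a
zipper at position `p` on the wires of one chain, and `a` is the first operand of a gate whose
second pointer is still moving. -/
theorem exists_chain (n : ℕ) (G : List Bool) :
    ∃ (l : List (Table n)) (p : ℕ) (a : Option (Table n)), Chain l ∧ (∀ u ∈ a, IsRef l u) ∧
      G.count false = 2 * l.length + a.toList.length ∧
      ∀ j, gateState G (point j) = (((wireList l j).take p).reverse, (wireList l j).drop p,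
        a.toList.map fun u => u j) := by
  induction G using List.reverseRecOn with
  | nil => exact ⟨[], 0, none, .nil, by simp, by simp, fun j => by simp [gateState, wireList]⟩
  | append_singleton G b ih =>
    obtain ⟨l, p, a, hl, ha, hc, h⟩ := ih
    rcases b with _ | _
    · have hu := isRef_wire l p
      rcases a with _ | a
      · refine ⟨l, 0, some fun j => (wireList l j).getD p false, hl, ?_, ?_, fun j => ?_⟩
        · intro u hu'
          rw [Option.mem_some_iff] at hu'
          rw [← hu']
          exact hu
        · simp [List.count_append, hc]
        · rw [gateState_append, h]
          simp only [Option.toList_none, List.map_nil, gateStep_false_nil]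
          simp
      · refine ⟨_, 0, none, hl.cons (ha a rfl) hu, by simp, ?_, fun j => ?_⟩
        · simp [List.count_append, hc]
          ring
        · rw [gateState_append, h]
          simp only [Option.toList_some, List.map_cons, List.map_nil, gateStep_false_cons]
          simp [wireList_cons]
    · refine ⟨l, p + 1, a, hl, ha, by simp [List.count_append, hc], fun j => ?_⟩
      rw [gateState_append, h, gateStep_true]

theorem chain_of_gateList (n : ℕ) (G : List Bool) :
    ∃ l : List (Table n), Chain l ∧ l.length = numGates G ∧
      ∀ j, gateOut G (point j) = (wireList l j).head?.getD false := by
  obtain ⟨l, p, a, hl, -, hc, h⟩ := exists_chain n G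
  refine ⟨l, hl, ?_, fun j => by rw [gateOut, h]; simp⟩
  rw [numGates, hc]
  rcases a with _ | a <;> simp
  omega

theorem foldl_replicate_true (W : List Bool) (p q : ℕ) (ac : List Bool) :
    (List.replicate p true).foldl gateStep ((W.take q).reverse, W.drop q, ac) =
      ((W.take (q + p)).reverse, W.drop (q + p), ac) := by
  induction p generalizing q with
  | zero => rfl
  | succ p ih =>
    rw [List.replicate_succ, List.foldl_cons, gateStep_true, ih]
    congr 3 <;> ring

/-- Each gate is written as two unary pointers with terminators. A pointer after `m` gates is at
most `2 * m + 2 * (n + 1)`, so a gate takes at most `4 * m + 4 * n + 6` symbols. -/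
theorem gateList_of_chain {l : List (Table n)} (hl : Chain l) :
    ∃ G : List Bool, G.length ≤ l.length * (4 * l.length + 4 * n + 6) ∧ numGates G = l.length ∧
      ∀ j, gateState G (point j) = ([], wireList l j, []) := by
  suffices H : ∃ G : List Bool, G.length ≤ l.length * (4 * l.length + 4 * n + 6) ∧
      G.count false = 2 * l.length ∧ ∀ j, gateState G (point j) = ([], wireList l j, []) by
    obtain ⟨G, h1, h2, h3⟩ := H
    exact ⟨G, h1, by simp [numGates, h2], h3⟩
  induction hl with
  | nil => exact ⟨[], by simp, by simp, fun j => by simp [gateState, wireList]⟩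
  | @cons l a b hl ha hb ih =>
    obtain ⟨G, h1, h2, h3⟩ := ih
    obtain ⟨p, hp, ep⟩ := ha.exists_wire
    obtain ⟨q, hq, eq⟩ := hb.exists_wire
    refine ⟨G ++ (List.replicate p true ++ [false] ++ (List.replicate q true ++ [false])),
      ?_, ?_, fun j => ?_⟩
    · simp only [List.length_append, List.length_replicate, List.length_cons,
        List.length_nil]
      generalize l.length = m at *
      calc G.length + (p + 1 + (q + 1))
          ≤ m * (4 * m + 4 * n + 6) + (4 * m + 4 * n + 6) := by omega
        _ = (m + 1) * (4 * m + 4 * n + 6) := by ring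
        _ ≤ _ := Nat.mul_le_mul_left _ (by omega)
    · have hr (k : ℕ) : (List.replicate k true).count false = 0 :=
        List.count_eq_zero.2 (by simp [List.mem_replicate])
      simp only [List.count_append, h2, hr, List.length_cons, List.count_singleton_self]
      omega
    · have e1 := foldl_replicate_true (wireList l j) p 0 []
      have e2 := foldl_replicate_true (wireList l j) q 0 [(wireList l j).getD p false]
      simp only [List.take_zero, List.reverse_nil, List.drop_zero, zero_add] at e1 e2
      have h4 : G.foldl gateStep ([], initWires (point j), []) = _ := h3 j
      rw [gateState, List.foldl_append, h4]
      simp only [List.foldl_append, List.foldl_cons, List.foldl_nil]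
      rw [e1, gateStep_false_nil, e2, gateStep_false_cons, ep, eq, wireList_cons]
      rfl

/-- A trailing `true` only moves the pointer, and the output does not depend on the pointer. Thus
witnesses can be padded to a prescribed length. -/
theorem gateState_pad (G c : List Bool) (m : ℕ) :
    gateOut (G ++ List.replicate m true) c = gateOut G c := by
  induction m with
  | zero => simp
  | succ m ih =>
    rw [List.replicate_succ', ← List.append_assoc, ← ih, gateOut, gateOut, gateState_append]
    obtain ⟨w2, w, ac⟩ := gateState (G ++ List.replicate m true) c
    rcases w with _ | ⟨a, w⟩ <;> simp [gateStep]

/-! ### Truth tables of small circuits -/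

/-- The truth tables computed by gate lists of cost at most `2 ^ n`. -/
def Tables (n : ℕ) : Set (Table n) :=
  {f | ∃ G, cost (numGates G) ≤ 2 ^ n ∧ ∀ j, gateOut G (point j) = f j}

/-- If there is no gate at all, the output is a base wire, and one gate `r ⊓ r` is added to make it
an entry of a chain. That gate costs 11, which is at most `2 ^ n` from `n = 4` on. -/
theorem exists_chain_of_mem_tables (hn : 4 ≤ n) {f : Table n} (hf : f ∈ Tables n) :
    ∃ l, Chain (f :: l) ∧ cost (f :: l).length ≤ 2 ^ n := by
  obtain ⟨G, hG, e⟩ := hf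
  obtain ⟨l, hl, hc, h⟩ := chain_of_gateList n G
  cases hl with
  | nil =>
    refine ⟨[], ?_, ?_⟩
    · have hr : IsRef [] f := by
        have := isRef_wire (n := n) [] 0
        convert this using 2 with j
        rw [← e, h, List.head?_eq_getElem?, List.getD_eq_getElem?_getD]
      simpa using Chain.nil.cons hr hr
    · have : cost 1 = 11 := by simp [cost]
      rw [List.length_singleton, this]
      calc 11 ≤ 2 ^ 4 := by norm_num
        _ ≤ 2 ^ n := Nat.pow_le_pow_right (by norm_num) hn
  | @cons l a b hl ha hb =>
    have : f = a ⊓ b := funext fun j => by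
      rw [← e, h, wireList_cons]
      rfl
    subst this
    exact ⟨l, hl.cons ha hb, hc ▸ hG⟩

theorem le_cost (s : ℕ) : 11 * s ≤ cost s := by
  rw [cost]
  have : ∀ k ∈ Finset.range s, 11 ≤ Nat.size (k + 1) + 10 := fun k _ => by
    have : 0 < Nat.size (k + 1) := Nat.size_pos.2 (by omega)
    omega
  simpa [mul_comm] using Finset.card_nsmul_le_sum _ _ 11 this

theorem headNum_mk (n : ℕ) (l : List Bool) :
    headNum (List.replicate n true ++ false :: l) = n := by
  simp [headNum]

theorem gateList_mk (n : ℕ) (l : List Bool) :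
    gateList (List.replicate n true ++ false :: l) = l.reverse := by
  simp [gateList]

/-- A gate costs at least 11, so there are at most `2 ^ n / 11` gates, each written with at most `3
* 2 ^ n` symbols; header and gate list together fit into `4 ^ n`. -/
theorem exists_witness (hn : 4 ≤ n) {f : Table n} {l : List (Table n)} (hl : Chain (f :: l))
    (hc : cost (f :: l).length ≤ 2 ^ n) {K : ℕ} (hK : 4 ^ n ≤ K) :
    ∃ Q : List Bool, Q.length = K ∧ headNum Q = n ∧ cost (numGates (gateList Q)) ≤ 2 ^ n ∧
      ∀ j, gateOut (gateList Q) (point j) = f j := by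
  obtain ⟨G, hG, hs, h⟩ := gateList_of_chain hl
  have hle : n + 1 + G.length ≤ K := by
    have h1 := (le_cost _).trans hc
    have h2 : 4 * n ≤ 2 ^ n := by
      obtain ⟨k, rfl⟩ := Nat.exists_eq_add_of_le hn
      have : k < 2 ^ k := Nat.lt_two_pow_self
      rw [pow_add]
      omega
    have h3 : (4 : ℕ) ^ n = 2 ^ n * 2 ^ n := by rw [← mul_pow]; rfl
    have h4 := hG.trans (Nat.mul_le_mul_left (f :: l).length
      (show 4 * (f :: l).length + 4 * n + 6 ≤ 3 * 2 ^ n by omega))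
    nlinarith
  obtain ⟨m, hm⟩ := Nat.exists_eq_add_of_le hle
  refine ⟨List.replicate n true ++ false :: (G ++ List.replicate m true).reverse, ?_,
    headNum_mk _ _, ?_, fun j => ?_⟩
  · simp
    omega
  · have hr : (List.replicate m true).count false = 0 :=
      List.count_eq_zero.2 (by simp [List.mem_replicate])
    rw [gateList_mk, List.reverse_reverse, numGates, List.count_append, hr, add_zero]
    rwa [← hs] at hc
  · rw [gateList_mk, List.reverse_reverse, gateState_pad, gateOut, h]
    rfl

end CountingMeasure

end

noncomputable section

namespace CountingMeasure

open Filter Computability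

variable {n : ℕ}

/-! ### From circuits to straight-line programs -/

theorem getD_initWires_even (c : List Bool) (k : ℕ) :
    (initWires c).getD (2 * k) false = c.getD k false := by
  induction c generalizing k with
  | nil => simp [initWires]
  | cons b c ih =>
    rcases k with _ | k
    · rfl
    · exact ih k

theorem getD_initWires_odd {c : List Bool} {k : ℕ} (hk : k < c.length) :
    (initWires c).getD (2 * k + 1) false = !c.getD k false := by
  induction c generalizing k with
  | nil => simp at hk
  | cons b c ih =>
    rcases k with _ | k
    · rfl
    · exact ih (by simpa using hk)

theorem baseFn_even (n k : ℕ) : baseFn n (2 * k) = fun j => (point j).getD k false :=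
  funext fun _ => getD_initWires_even _ _

theorem baseFn_odd {k : ℕ} (hk : k < n + 1) :
    baseFn n (2 * k + 1) = fun j => !(point j).getD k false :=
  funext fun j => getD_initWires_odd (by rwa [length_point])

theorem getD_point_last (j : Fin (2 ^ n)) : (point j).getD n false = true := by
  have h := Nat.testBit_eq_inth (2 ^ n + j) n
  rw [Nat.testBit_two_pow_add_eq, Nat.testBit_lt_two_pow j.2] at h
  exact h.symm

theorem IsRef.compl {l : List (Table n)} {u : Table n} (h : IsRef l u) : IsRef l uᶜ := by
  rcases h with rfl | ⟨q, hq, rfl⟩ | h | h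
  -- Wire `2 * n` carries the leading one of `point j`, so the constant `⊤` is available without a
  -- gate.
  · refine .inr (.inl ⟨2 * n, by omega, ?_⟩)
    rw [baseFn_even]
    ext j
    rw [getD_point_last]
    rfl
  · rcases Nat.even_or_odd' q with ⟨k, rfl | rfl⟩
    · refine .inr (.inl ⟨2 * k + 1, by omega, ?_⟩)
      rw [baseFn_even, baseFn_odd (by omega)]
      rfl
    · refine .inr (.inl ⟨2 * k, by omega, ?_⟩)
      rw [baseFn_even, baseFn_odd (by omega)]
      ext j
      simp
  · exact isRef_compl_of_mem h
  · exact .inr (.inr (.inl h))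

/-- The `j`-th string of length `n`, as an input to a circuit. -/
def inputAt (j : Fin (2 ^ n)) : Fin n → Bool := fun i => (point j).getD (n - 1 - i) false

theorem ofFn_inputAt (j : Fin (2 ^ n)) :
    List.ofFn (inputAt j) = stdString (2 ^ n - 1 + j) := by
  have h1 : 2 ^ n - 1 + j + 1 = 2 ^ n + (j : ℕ) := by
    have := Nat.one_le_two_pow (n := n)
    omega
  rw [stdString, h1]
  change _ = (point j).dropLast.reverse
  have hl := length_point j
  refine List.ext_getElem (by simp [hl]) fun i h2 h3 => ?_
  simp only [List.length_ofFn] at h2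
  rw [List.getElem_ofFn, List.getElem_reverse, List.getElem_dropLast, inputAt,
    List.getD_eq_getElem _ _ (by omega)]
  simp [hl]

/-- Each gate becomes exactly one conjunction up to complement: OR by De Morgan, NOT as `a ⊓ a`,
constants as `⊥ ⊓ ⊥`. Not losing a constant factor in the number of gates is essential, since the
size bound is tight to lower order. -/
theorem GateSeq.exists_chain {s : ℕ} (P : GateSeq n s) :
    ∃ l : List (Table n), Chain l ∧ l.length = s ∧
      ∀ v, IsRef l fun j => P.wires (inputAt j) v := by
  induction P with
  | nil =>
    refine ⟨[], .nil, rfl, fun v => .inr (.inl ⟨2 * (n - 1 - v), by omega, ?_⟩)⟩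
    rw [baseFn_even]
    rfl
  | @snoc s P g ih =>
    obtain ⟨l, hl, hs, h⟩ := ih
    suffices H : ∃ a b, IsRef l a ∧ IsRef l b ∧
        ((a ⊓ b = fun j => g.eval (P.wires (inputAt j))) ∨
          (a ⊓ b = (fun j => g.eval (P.wires (inputAt j)))ᶜ)) by
      obtain ⟨a, b, ha, hb, e⟩ := H
      refine ⟨(a ⊓ b) :: l, hl.cons ha hb, by simp [hs], fun v => ?_⟩
      refine Fin.lastCases ?_ (fun v => ?_) v
      · simp only [GateSeq.wires, Fin.snoc_last]
        rcases e with e | e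
        · exact .inr (.inr (.inl (by rw [← e]; simp)))
        · exact .inr (.inr (.inr (by rw [← e]; simp)))
      · simp only [GateSeq.wires, Fin.snoc_castSucc]
        exact (h v).mono (by simp)
    have hbot : IsRef l ⊥ := .inl rfl
    cases g with
    | const b =>
      refine ⟨_, _, hbot, hbot, ?_⟩
      cases b
      · exact .inl (by ext j; simp [Gate.eval])
      · exact .inr (by ext j; simp [Gate.eval])
    | not i => exact ⟨_, _, h i, h i, .inr (by ext j; simp [Gate.eval])⟩
    | and i j => exact ⟨_, _, h i, h j, .inl (by ext j; simp [Gate.eval])⟩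
    | or i j => exact ⟨_, _, (h i).compl, (h j).compl, .inr (by ext j; simp [Gate.eval])⟩

/-- The output may be an input or an earlier wire, possibly complemented, whereas a gate list
outputs its last gate. Hence one additional gate. -/
theorem Circuit.mem_tables (C : Circuit n) (hC : cost (C.size + 1) ≤ 2 ^ n) :
    (fun j => C.eval (inputAt j)) ∈ Tables n := by
  obtain ⟨l, hl, hs, h⟩ := C.gates.exists_chain
  obtain ⟨G, -, hG, e⟩ := gateList_of_chain (hl.cons (h C.out) (h C.out))
  refine ⟨G, by rwa [hG, List.length_cons, hs], fun j => ?_⟩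
  rw [gateOut, e]
  simp [wireList_cons, Circuit.eval]

theorem Circuit.Decides.mem_tables {C : Circuit n} {A : Lang} (h : C.Decides A)
    (hC : cost (C.size + 1) ≤ 2 ^ n) :
    (fun j : Fin (2 ^ n) => charSeq A (2 ^ n - 1 + j)) ∈ Tables n := by
  convert C.mem_tables hC using 2 with j
  rw [Bool.eq_iff_iff, h, ofFn_inputAt, charSeq]
  exact @decide_eq_true_iff _ (_)

end CountingMeasure

end

/-! ### Counting cheap truth tables. -/

noncomputable section

namespace CountingMeasure

open Filter Computability

variable {n : ℕ}

/-! ### Counting straight-line programs -/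

/-- A repeated entry can be dropped because references depend only on membership. Without
repetitions, different labellings of the entries are different as functions. -/
theorem Chain.exists_nodup {l : List (Table n)} (hl : Chain l) :
    ∃ l', Chain l' ∧ l'.Nodup ∧ l ⊆ l' ∧ l'.length ≤ l.length := by
  induction hl with
  | nil => exact ⟨[], .nil, .nil, by simp, le_rfl⟩
  | @cons l a b _ ha hb ih =>
    obtain ⟨l', h1, h2, h3, h4⟩ := ih
    by_cases h : a ⊓ b ∈ l'
    · exact ⟨l', h1, h2, List.cons_subset.2 ⟨h, h3⟩, h4.trans (by simp)⟩
    · exact ⟨(a ⊓ b) :: l', h1.cons (ha.mono h3) (hb.mono h3), List.nodup_cons.2 ⟨h, h2⟩,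
        List.cons_subset_cons _ h3, by simpa using h4⟩

theorem Chain.exists_getElem {l : List (Table n)} (hl : Chain l) (p : ℕ) (hp : p < l.length) :
    ∃ a b, l[p] = a ⊓ b ∧ IsRef (l.drop (p + 1)) a ∧ IsRef (l.drop (p + 1)) b := by
  induction hl generalizing p with
  | nil => simp at hp
  | @cons l a b _ ha hb ih =>
    rcases p with _ | p
    · exact ⟨a, b, rfl, ha, hb⟩
    · exact ih p (by simpa using hp)

/-- References to the zero function, to a function computed without gates, or to one of `s`
labelled functions or its complement. -/
abbrev Ref (n s : ℕ) : Type := Option (Fin (2 * (n + 1)) ⊕ Fin s × Bool)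

/-- The function referred to. -/
def Ref.val {s : ℕ} (g : Fin s → Table n) : Ref n s → Table n
  | none => ⊥
  | some (.inl q) => baseFn n q
  | some (.inr (k, true)) => g k
  | some (.inr (k, false)) => (g k)ᶜ

/-- The references `R` determine the functions `g`, in some order of the labels. -/
def Describes {s : ℕ} (R : Fin s → Ref n s × Ref n s) (g : Fin s → Table n) : Prop :=
  ∃ rank : Fin s → ℕ, ∀ i, ∀ g' : Fin s → Table n,
    (∀ k, rank k < rank i → g' k = g k) → (R i).1.val g' ⊓ (R i).2.val g' = g i

/-- Induction along the rank of `g` alone: the second description, applied to `g'` itself, says that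
`g'` satisfies the gate equations, and these have only one solution. -/
theorem Describes.unique {s : ℕ} {R : Fin s → Ref n s × Ref n s} {g g' : Fin s → Table n}
    (h : Describes R g) (h' : Describes R g') : g = g' := by
  obtain ⟨rank, h⟩ := h
  obtain ⟨rank', h'⟩ := h'
  have key (m : ℕ) : ∀ i, rank i = m → g' i = g i := by
    induction m using Nat.strong_induction_on with
    | _ m ih =>
      rintro i rfl
      rw [← h i g' fun k hk => ih _ hk k rfl]
      exact (h' i g' fun _ _ => rfl).symm
  exact funext fun i => (key _ i rfl).symm

theorem IsRef.exists_ref {l : List (Table n)} {p : ℕ} {u : Table n}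
    (h : IsRef (l.drop (p + 1)) u) (σ : Equiv.Perm (Fin l.length)) :
    ∃ r : Ref n l.length, ∀ g' : Fin l.length → Table n,
      (∀ k, p < σ k → g' k = l[σ k]) → r.val g' = u := by
  have key {u : Table n} (h : u ∈ l.drop (p + 1)) :
      ∃ k, p < σ k ∧ l[σ k] = u := by
    obtain ⟨m, hm, e⟩ := List.getElem_of_mem h
    rw [List.getElem_drop] at e
    rw [List.length_drop] at hm
    refine ⟨σ.symm ⟨p + 1 + m, by omega⟩, ?_, ?_⟩
    · simp
      omega
    · simpa using e
  rcases h with rfl | ⟨q, hq, rfl⟩ | h | h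
  · exact ⟨none, fun _ _ => rfl⟩
  · exact ⟨some (.inl ⟨q, hq⟩), fun _ _ => rfl⟩
  · obtain ⟨k, hk, e⟩ := key h
    exact ⟨some (.inr (k, true)), fun g' hg => (hg k hk).trans e⟩
  · obtain ⟨k, hk, e⟩ := key h
    refine ⟨some (.inr (k, false)), fun g' hg => ?_⟩
    rw [Ref.val, hg k hk, e, compl_compl]

theorem Chain.exists_describes {l : List (Table n)} (hl : Chain l)
    (σ : Equiv.Perm (Fin l.length)) : ∃ R, Describes R fun i => l[σ i] := by
  have H (i : Fin l.length) : ∃ r : Ref n l.length × Ref n l.length,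
      ∀ g' : Fin l.length → Table n, (∀ k, σ i < σ k → g' k = l[σ k]) →
        r.1.val g' ⊓ r.2.val g' = l[σ i] := by
    obtain ⟨a, b, e, ha, hb⟩ := hl.exists_getElem (σ i) (σ i).2
    obtain ⟨r1, h1⟩ := ha.exists_ref σ
    obtain ⟨r2, h2⟩ := hb.exists_ref σ
    refine ⟨(r1, r2), fun g' hg => ?_⟩
    rw [h1 g' hg, h2 g' hg]
    exact e.symm
  choose R hR using H
  -- Chains list the last function first, so a larger position means a smaller rank.
  refine ⟨R, fun i => l.length - σ i, fun i g' hg => hR i g' fun k hk => hg k ?_⟩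
  have := (σ k).2
  have := (σ i).2
  have : (σ i : ℕ) < σ k := hk
  change l.length - (σ k : ℕ) < l.length - σ i
  omega

/-- The functions computed by a repetition-free straight-line program of length `s`. -/
def chainTables (n s : ℕ) : Set (Table n) :=
  {f | ∃ l, Chain l ∧ l.Nodup ∧ l.length = s ∧ f ∈ l}

/-- Fix one program for each function and label its entries in all `s!` ways. The pair consisting of
the references and the label of the output determines both the function and the labelling. There are
`2 * n + 2 * s + 3` references, two for each gate. -/
theorem ncard_chainTables_mul_le (n s : ℕ) :
    (chainTables n s).ncard * s.factorial ≤ (2 * n + 2 * s + 3) ^ (2 * s) * s := by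
  have H (f : chainTables n s) : ∃ l : Fin s → Table n, Function.Injective l ∧
      (∃ p, l p = f) ∧ ∀ σ : Equiv.Perm (Fin s), ∃ R, Describes R fun i => l (σ i) := by
    obtain ⟨f, l, hl, hn, rfl, hf⟩ := f
    obtain ⟨p, hp, e⟩ := List.getElem_of_mem hf
    exact ⟨fun i => l[i], fun i j h => Fin.ext ((hn.getElem_inj_iff).1 h), ⟨⟨p, hp⟩, e⟩,
      hl.exists_describes⟩
  choose l hinj out hout using H
  choose p hp using out
  choose R hR using hout
  -- The references recover the labelled family, the output label then recovers `f`, and injectivity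
  -- of the program chosen for `f` recovers the labelling.
  have hF : Function.Injective fun a : chainTables n s × Equiv.Perm (Fin s) =>
      (R a.1 a.2, a.2.symm (p a.1)) := by
    rintro ⟨f, σ⟩ ⟨f', σ'⟩ h
    obtain ⟨h1, h2⟩ := Prod.mk.inj h
    simp only at h1 h2
    have h3 := (hR f σ).unique (h1 ▸ hR f' σ')
    have h4 : f = f' := by
      apply Subtype.ext
      rw [← hp, ← hp]
      have := congrFun h3 (σ.symm (p f))
      simp only [Equiv.apply_symm_apply] at this
      rw [this, h2, Equiv.apply_symm_apply]
    subst h4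
    congr 1
    exact Equiv.ext fun i => hinj f (congrFun h3 i)
  have := Nat.card_le_card_of_injective _ hF
  rw [Nat.card_prod, Nat.card_prod, Nat.card_coe_set_eq, Nat.card_perm, Nat.card_fun,
    Nat.card_prod] at this
  simp only [Nat.card_eq_fintype_card, Fintype.card_option, Fintype.card_sum, Fintype.card_prod,
    Fintype.card_fin, Fintype.card_bool] at this
  refine this.trans (Nat.mul_le_mul_right _ ?_)
  rw [← sq, ← pow_mul]
  exact Nat.pow_le_pow_left (by omega) _

theorem factorial_le_two_pow (s : ℕ) :
    s.factorial ≤ 2 ^ ∑ k ∈ Finset.range s, Nat.size (k + 1) := by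
  induction s with
  | zero => simp
  | succ s ih =>
    rw [Nat.factorial_succ, Finset.sum_range_succ, pow_add, mul_comm]
    exact Nat.mul_le_mul ih (Nat.lt_size_self _).le

/-- One term of the exponential series gives `s ^ s / s! ≤ e ^ s`. -/
theorem pow_self_le (s : ℕ) : s ^ s ≤ 4 ^ s * s.factorial := by
  have h := Real.pow_div_factorial_le_exp (s : ℝ) (by positivity) s
  rw [div_le_iff₀ (by positivity), ← mul_one (s : ℝ), Real.exp_nat_mul, mul_one] at h
  have h4 : Real.exp 1 ^ s ≤ 4 ^ s :=
    pow_le_pow_left₀ (Real.exp_pos _).le (by linarith [Real.exp_one_lt_d9]) _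
  exact_mod_cast h.trans (mul_le_mul_of_nonneg_right h4 (by positivity))

/-- Here there are at most `3 * s` references. Replacing `s ^ (2 * s)` by `16 ^ s * s! ^ 2` cancels
one factorial, the other is covered by the sizes in the cost, and `576 ≤ 2 ^ 10` accounts for the
constant 10, including a spare factor `2 ^ s`. -/
theorem ncard_chainTables_le_of_large {s : ℕ} (hs : 2 * n + 3 ≤ s) :
    (chainTables n s).ncard * 2 ^ s ≤ 2 ^ cost s := by
  refine Nat.le_of_mul_le_mul_right ?_ s.factorial_pos
  calc (chainTables n s).ncard * 2 ^ s * s.factorial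
      = (chainTables n s).ncard * s.factorial * 2 ^ s := by ring
    _ ≤ (3 * s) ^ (2 * s) * 2 ^ s * 2 ^ s :=
        Nat.mul_le_mul_right _ ((ncard_chainTables_mul_le n s).trans
          (Nat.mul_le_mul (Nat.pow_le_pow_left (by omega) _) Nat.lt_two_pow_self.le))
    _ = 36 ^ s * (s ^ s * s ^ s) := by
        rw [pow_mul, mul_pow, mul_pow, ← mul_pow s s, ← mul_pow, ← mul_pow, ← mul_pow]
        ring
    _ ≤ 36 ^ s * ((4 ^ s * s.factorial) * (4 ^ s * s.factorial)) :=
        Nat.mul_le_mul_left _ (Nat.mul_le_mul (pow_self_le s) (pow_self_le s))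
    _ = 576 ^ s * s.factorial * s.factorial := by
        rw [show 576 = 36 * 4 * 4 by rfl, mul_pow, mul_pow]
        ring
    _ ≤ (2 ^ 10) ^ s * 2 ^ (∑ k ∈ Finset.range s, Nat.size (k + 1)) * s.factorial :=
        Nat.mul_le_mul_right _ (Nat.mul_le_mul (Nat.pow_le_pow_left (by norm_num) _)
          (factorial_le_two_pow s))
    _ = 2 ^ cost s * s.factorial := by
        rw [cost, Finset.sum_add_distrib, ← pow_mul, ← pow_add]
        simp [add_comm, mul_comm]

theorem ncard_chainTables_le_of_small {s : ℕ} (hs : 2 * n + 2 * s + 3 ≤ 2 ^ n) :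
    (chainTables n s).ncard ≤ 2 ^ ((2 * n + 1) * s) := by
  calc (chainTables n s).ncard ≤ (chainTables n s).ncard * s.factorial :=
        Nat.le_mul_of_pos_right _ s.factorial_pos
    _ ≤ (2 ^ n) ^ (2 * s) * 2 ^ s := (ncard_chainTables_mul_le n s).trans
        (Nat.mul_le_mul (Nat.pow_le_pow_left hs _) Nat.lt_two_pow_self.le)
    _ = _ := by
        rw [← pow_mul, ← pow_add]
        congr 1
        ring

theorem cost_mono : Monotone cost := fun _ _ h => by
  rw [cost, cost]
  exact Finset.sum_le_sum_of_subset (Finset.range_mono h)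

theorem tables_subset (hn : 4 ≤ n) :
    Tables n ⊆ ⋃ s ∈ (Finset.range (2 ^ n)).filter fun s => cost s ≤ 2 ^ n, chainTables n s := by
  intro f hf
  obtain ⟨l, hl, hc⟩ := exists_chain_of_mem_tables hn hf
  obtain ⟨l', h1, h2, h3, h4⟩ := hl.exists_nodup
  have h5 := (cost_mono h4).trans hc
  have := le_cost l'.length
  have := Nat.one_le_two_pow (n := n)
  simp only [Set.mem_iUnion, Finset.mem_filter, Finset.mem_range]
  exact ⟨l'.length, ⟨by omega, h5⟩, l', h1, h2, rfl, h3 (by simp)⟩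

theorem two_pow_half_bound (hn : 24 ≤ n) :
    2 ^ ((n + 5) / 2) * (8 * n + 8) ≤ 2 ^ n := by
  obtain ⟨k, hk⟩ : ∃ k, n / 2 = k + 12 := Nat.exists_eq_add_of_le' (by omega)
  have h : 8 * (2 * (k + 12) + 1) + 8 ≤ 2 ^ (k + 10) := by
    have := Nat.lt_two_pow_self (n := k)
    rw [pow_add]
    omega
  calc 2 ^ ((n + 5) / 2) * (8 * n + 8) ≤ 2 ^ ((n + 5) / 2) * 2 ^ (k + 10) :=
        Nat.mul_le_mul_left _ (by omega)
    _ = 2 ^ n := by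
        rw [← pow_add]
        congr 1
        omega

theorem le_two_pow_half (n : ℕ) : n + 1 ≤ 2 ^ ((n + 5) / 2) := by
  have : (n + 5) / 2 < 2 ^ ((n + 5) / 2) := Nat.lt_two_pow_self
  obtain ⟨k, hk⟩ : ∃ k, (n + 5) / 2 = k + 2 := Nat.exists_eq_add_of_le' (by omega)
  have : k < 2 ^ k := Nat.lt_two_pow_self
  rw [hk, pow_add]
  omega

/-- With `e = 2 ^ ((n + 5) / 2)`, the lengths are split at `4 * e`. For longer programs the spare
factor `2 ^ s` gives the saving; for shorter ones there are so few programs that the bound without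
factorials suffices. The extra `n` in the exponent pays for the union over fewer than `2 ^ n`
lengths. -/
theorem ncard_tables_mul_le (hn : 24 ≤ n) :
    (Tables n).ncard * 2 ^ (2 ^ ((n + 5) / 2) + 1) ≤ 2 ^ 2 ^ n := by
  have h1 := two_pow_half_bound hn
  have h2 := le_two_pow_half n
  generalize 2 ^ ((n + 5) / 2) = e at *
  have h3 : e * (8 * n + 8) = (2 * n + 1) * (4 * e) + 4 * e := by ring
  have key : ∀ s ∈ (Finset.range (2 ^ n)).filter fun s => cost s ≤ 2 ^ n,
      (chainTables n s).ncard * 2 ^ (n + (e + 1)) ≤ 2 ^ 2 ^ n := fun s hs => by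
    have hc : cost s ≤ 2 ^ n := (Finset.mem_filter.1 hs).2
    rcases le_total (4 * e) s with h | h
    · refine le_trans (Nat.mul_le_mul_left _ (Nat.pow_le_pow_right two_pos ?_))
        ((ncard_chainTables_le_of_large (by omega)).trans (Nat.pow_le_pow_right two_pos hc))
      omega
    · have h4 : (2 * n + 1) * s ≤ (2 * n + 1) * (4 * e) := Nat.mul_le_mul_left _ h
      have h5 : 3 * (4 * e) ≤ (2 * n + 1) * (4 * e) := Nat.mul_le_mul_right _ (by omega)
      refine (Nat.mul_le_mul_right _ (ncard_chainTables_le_of_small (by omega))).trans ?_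
      rw [← pow_add]
      exact Nat.pow_le_pow_right two_pos (by omega)
  refine Nat.le_of_mul_le_mul_left ?_ (Nat.two_pow_pos n)
  calc 2 ^ n * ((Tables n).ncard * 2 ^ (e + 1))
      = (Tables n).ncard * 2 ^ (n + (e + 1)) := by rw [pow_add 2 n]; ring
    _ ≤ (∑ s ∈ (Finset.range (2 ^ n)).filter fun s => cost s ≤ 2 ^ n,
          (chainTables n s).ncard) * 2 ^ (n + (e + 1)) :=
        Nat.mul_le_mul_right _ ((Set.ncard_le_ncard (tables_subset (by omega))
          (Set.toFinite _)).trans (Finset.set_ncard_biUnion_le _ _))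
    _ ≤ (Finset.card _) • 2 ^ 2 ^ n := by
        rw [Finset.sum_mul]
        exact Finset.sum_le_card_nsmul _ _ _ key
    _ ≤ 2 ^ n * 2 ^ 2 ^ n := by
        rw [smul_eq_mul]
        exact Nat.mul_le_mul_right _ ((Finset.card_filter_le _ _).trans (by simp))

end CountingMeasure

end

/-! ### From the size bound to the cost bound. -/

noncomputable section

namespace CountingMeasure

open Filter Computability

/-! ### The size bound -/

theorem cost_le_mul_logb {s : ℕ} (hs : 1 ≤ s) : (cost s : ℝ) ≤ s * (Real.logb 2 s + 11) := by
  have h1 : cost s ≤ s * (Nat.size s + 10) := by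
    rw [cost]
    refine (Finset.sum_le_card_nsmul _ _ (Nat.size s + 10) fun k hk => ?_).trans (by simp)
    have := Nat.size_le_size (Nat.succ_le_of_lt (Finset.mem_range.1 hk))
    simpa using this
  have h2 : (Nat.size s : ℝ) - 1 ≤ Real.logb 2 s := by
    have hp := Nat.size_pos.2 hs
    rw [Real.le_logb_iff_rpow_le one_lt_two (by exact_mod_cast hs)]
    have : 2 ^ (Nat.size s - 1) ≤ s := Nat.lt_size.1 (by omega)
    have e : (Nat.size s : ℝ) - 1 = ((Nat.size s - 1 : ℕ) : ℝ) := by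
      rw [Nat.cast_sub hp, Nat.cast_one]
    rw [e, Real.rpow_natCast]
    exact_mod_cast this
  calc (cost s : ℝ) ≤ s * (Nat.size s + 10) := by exact_mod_cast h1
    _ ≤ _ := mul_le_mul_of_nonneg_left (by linarith) (by positivity)

theorem eventually_cost_le {α : ℝ} (hα : α < 1) :
    ∀ᶠ n : ℕ in atTop, ∀ s : ℕ,
      (s : ℝ) ≤ (2 : ℝ) ^ n / n * (1 + α * Real.logb 2 n / n) → cost (s + 1) ≤ 2 ^ n := by
  -- The slack between `α` and `β` absorbs the extra gate, while `β < 1` leaves `(1 - β) * L` to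
  -- beat the constant 12 below.
  obtain ⟨β, hβ, hβ1⟩ := exists_between (max_lt hα zero_lt_one)
  obtain ⟨hαβ, hβ0⟩ := max_lt_iff.1 hβ
  have hL : Tendsto (fun n : ℕ => Real.logb 2 n) atTop atTop :=
    (Real.tendsto_logb_atTop one_lt_two).comp tendsto_natCast_atTop_atTop
  filter_upwards [eventually_ge_atTop 4, hL.eventually_ge_atTop 12,
    (hL.const_mul_atTop (sub_pos.2 hβ1)).eventually_ge_atTop 12,
    (hL.const_mul_atTop (sub_pos.2 hαβ)).eventually_ge_atTop 1] with n hn h1 h2 h3 s hs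
  have hn0 : (0 : ℝ) < n := by exact_mod_cast (by omega : 0 < n)
  have hLn : Real.logb 2 n ≤ n := by
    rw [Real.logb_le_iff_le_rpow one_lt_two hn0, Real.rpow_natCast]
    exact_mod_cast Nat.lt_two_pow_self.le
  have hsq : (n : ℝ) * n ≤ 2 ^ n := by
    have : n ^ 2 ≤ 2 ^ n := by
      clear * - hn
      induction n, hn using Nat.le_induction with
      | base => norm_num
      | succ n hn ih =>
        rw [pow_succ 2 n]
        nlinarith
    rw [← sq]
    exact_mod_cast this
  set L := Real.logb 2 n with hLdef
  have hlog : Real.logb 2 ((2 : ℝ) ^ n / n * 2) = n - L + 1 := by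
    rw [Real.logb_mul (by positivity) (by norm_num), Real.logb_div (by positivity) hn0.ne',
      Real.logb_pow, Real.logb_self_eq_one one_lt_two, mul_one]
  have hX : ((s + 1 : ℕ) : ℝ) ≤ (2 : ℝ) ^ n / n * (1 + β * L / n) := by
    have : (1 : ℝ) ≤ (2 : ℝ) ^ n / n * ((β - α) * L / n) := by
      rw [div_mul_div_comm, le_div_iff₀ (by positivity), one_mul]
      nlinarith
    calc ((s + 1 : ℕ) : ℝ)
        ≤ (2 : ℝ) ^ n / n * (1 + α * L / n) + (2 : ℝ) ^ n / n * ((β - α) * L / n) := by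
          push_cast
          linarith
      _ = _ := by ring
  have hβL : β * L / n ≤ 1 := by
    rw [div_le_one hn0]
    nlinarith
  have hpos : (0 : ℝ) < ((s + 1 : ℕ) : ℝ) := by positivity
  have hls : Real.logb 2 ((s + 1 : ℕ) : ℝ) ≤ n - L + 1 := by
    rw [← hlog]
    exact Real.logb_le_logb_of_le one_lt_two hpos
      (hX.trans (mul_le_mul_of_nonneg_left (by linarith) (by positivity)))
  -- After expansion the terms of order `n` are `(12 - (1 - β) * L) * n` and the rest is `β * L *
  -- (12 - L)`; both are nonpositive by the choice of `n`.
  have key : (1 + β * L / n) * ((n - L + 12) / n) ≤ 1 := by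
    have e : (1 + β * L / n) * ((n - L + 12) / n) =
        ((n + β * L) * (n - L + 12)) / (n * n) := by
      field_simp
    rw [e, div_le_one (by positivity)]
    nlinarith [mul_nonneg (mul_nonneg hβ0.le (by linarith : 0 ≤ L)) (sub_nonneg.2 h1),
      mul_nonneg hn0.le (sub_nonneg.2 h2)]
  have : (cost (s + 1) : ℝ) ≤ 2 ^ n := calc
    (cost (s + 1) : ℝ) ≤ ((s + 1 : ℕ) : ℝ) * (n - L + 12) :=
        (cost_le_mul_logb (by omega)).trans (mul_le_mul_of_nonneg_left (by linarith) hpos.le)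
    _ ≤ (2 : ℝ) ^ n / n * (1 + β * L / n) * (n - L + 12) :=
        mul_le_mul_of_nonneg_right hX (by linarith)
    _ = (2 : ℝ) ^ n * ((1 + β * L / n) * ((n - L + 12) / n)) := by ring
    _ ≤ 2 ^ n := mul_le_of_le_one_right (by positivity) key
  exact_mod_cast this

/-- If `A` is in the class, infinitely often the part of its characteristic sequence belonging to
the strings of length `n` is the truth table of a cheap gate list. -/
theorem frequently_mem_tables {α : ℝ} (hα : α < 1) {A : Lang}
    (hA : A ∈ SIZEio fun n : ℕ => (2 : ℝ) ^ n / n * (1 + α * Real.logb 2 n / n)) :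
    ∃ᶠ n in atTop, (fun j : Fin (2 ^ n) => charSeq A (2 ^ n - 1 + j)) ∈ Tables n :=
  (Frequently.and_eventually hA (eventually_cost_le hα)).mono
    fun _ ⟨⟨_, hC, hd⟩, h⟩ => hd.mem_tables (h _ hC)

end CountingMeasure

end

/-! ### Cheap blocks and their conditional probabilities. -/

noncomputable section

namespace CountingMeasure

open Filter Computability

/-! ### Acceptance -/

/-- The truth table carried by the positions of `y` that belong to strings of length `n`. -/
def part (n : ℕ) (y : Str) : Table n := fun j => y.getD (2 ^ n - 1 + j) false

theorem active_iff {n i : ℕ} : Active n i ↔ ∃ j : Fin (2 ^ n), i = 2 ^ n - 1 + j := by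
  have h1 := Nat.one_le_two_pow (n := n)
  constructor
  · intro h
    have h2 : 2 ^ n ≤ i + 1 := Nat.lt_size.1 (by rw [h]; omega)
    have h3 : i + 1 < 2 ^ (n + 1) := Nat.size_le.1 h.le
    rw [pow_succ] at h3
    exact ⟨⟨i - (2 ^ n - 1), by omega⟩, by simp; omega⟩
  · rintro ⟨j, rfl⟩
    rw [Active, show 2 ^ n - 1 + (j : ℕ) + 1 = 2 ^ n + j by omega, size_two_pow_add j.2]

theorem point_eq {n : ℕ} (j : Fin (2 ^ n)) : point j = Nat.bits (2 ^ n - 1 + j + 1) := by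
  have h1 := Nat.one_le_two_pow (n := n)
  rw [point]
  congr 1
  omega

theorem count_active {n L : ℕ} (h : 2 ^ (n + 1) ≤ L + 1) : Nat.count (Active n) L = 2 ^ n := by
  have h1 := Nat.one_le_two_pow (n := n)
  rw [pow_succ] at h
  have e : (Finset.range L).filter (Active n) =
      Finset.univ.image fun j : Fin (2 ^ n) => 2 ^ n - 1 + (j : ℕ) := by
    ext i
    simp only [Finset.mem_filter, Finset.mem_range, active_iff, Finset.mem_image,
      Finset.mem_univ, true_and]
    constructor
    · rintro ⟨_, j, rfl⟩
      exact ⟨j, rfl⟩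
    · rintro ⟨j, rfl⟩
      have := j.2
      exact ⟨by omega, j, rfl⟩
  rw [Nat.count_eq_card_filter_range, e, Finset.card_image_of_injective _ fun i j h => by
    exact Fin.ext (by simpa using h)]
  simp

theorem count_wrong_eq_zero {n : ℕ} {G y : List Bool} (h : 2 ^ (n + 1) ≤ y.length + 1) :
    Nat.count (Wrong n G y) y.length = 0 ↔ ∀ j, gateOut G (point j) = part n y j := by
  have h1 := Nat.one_le_two_pow (n := n)
  rw [pow_succ] at h
  rw [Nat.count_eq_card_filter_range, Finset.card_eq_zero, Finset.filter_eq_empty_iff]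
  constructor
  · intro H j
    have := j.2
    by_contra hj
    refine H (x := 2 ^ n - 1 + j) (Finset.mem_range.2 (by omega)) ⟨active_iff.2 ⟨j, rfl⟩, ?_⟩
    rwa [← point_eq]
  · rintro H i - ⟨ha, hi⟩
    obtain ⟨j, rfl⟩ := active_iff.1 ha
    rw [← point_eq] at hi
    exact hi (H j)

/-- Completeness of the block comes first: it makes the number of active positions equal to `2 ^ n`,
which turns the machine's test into the bound defining `Tables`. -/
theorem passes_false_iff {Q y : List Bool} {n : ℕ} (hn : headNum Q = n) :
    Passes false Q y ↔ 2 ^ (n + 1) ≤ y.length + 1 ∧ cost (numGates (gateList Q)) ≤ 2 ^ n ∧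
      ∀ j, gateOut (gateList Q) (point j) = part n y j := by
  have h1 : 2 ≤ Nat.size (y.length + 1) - n ↔ 2 ^ (n + 1) ≤ y.length + 1 := by
    rw [← Nat.lt_size]
    omega
  rw [Passes, hn, h1]
  constructor
  · rintro ⟨hw, hc, h, -⟩
    rw [count_active h] at hc
    exact ⟨h, hc, (count_wrong_eq_zero h).1 hw⟩
  · rintro ⟨h, hc, hw⟩
    exact ⟨(count_wrong_eq_zero h).2 hw, by rwa [count_active h], h, by simp⟩

theorem passes_true_iff {Q y : List Bool} :
    Passes true Q y ↔ Passes false Q y ∧ y.length + 1 < 2 ^ (headNum Q + 2) := by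
  rw [← Nat.size_le, Passes, Passes]
  simp only [true_imp_iff, Bool.false_eq_true, false_imp_iff, and_true, and_assoc]
  refine and_congr_right fun _ => and_congr_right fun _ => and_congr_right fun _ => ?_
  omega

/-- The part of `y` at length `n` is cheap. -/
def Hit (n : ℕ) (y : Str) : Prop := part n y ∈ Tables n

/-- The part of `y` at length `n` is complete, and cheap with a description of length `K`. -/
def HitWith (K n : ℕ) (y : Str) : Prop :=
  ∃ Q : List Bool, Q.length = K ∧ headNum Q = n ∧ Passes false Q y

theorem HitWith.hit {K n : ℕ} {y : Str} (h : HitWith K n y) :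
    2 ^ (n + 1) ≤ y.length + 1 ∧ Hit n y := by
  obtain ⟨Q, -, hn, hQ⟩ := h
  obtain ⟨h1, h2, h3⟩ := (passes_false_iff hn).1 hQ
  exact ⟨h1, _, h2, h3⟩

theorem Hit.hitWith {K n : ℕ} {y : Str} (h : Hit n y) (hn : 4 ≤ n) (hK : 4 ^ n ≤ K)
    (hy : 2 ^ (n + 1) ≤ y.length + 1) : HitWith K n y := by
  obtain ⟨l, hl, hc⟩ := exists_chain_of_mem_tables hn h
  obtain ⟨Q, h1, h2, h3, h4⟩ := exists_witness hn hl hc hK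
  exact ⟨Q, h1, h2, (passes_false_iff h2).2 ⟨hy, h3, h4⟩⟩

/-- Gate lists of bounded length suffice at any fixed length. -/
theorem exists_hitWith (n : ℕ) : ∃ K₀, ∀ K ≥ K₀, ∀ y : Str, Hit n y →
    2 ^ (n + 1) ≤ y.length + 1 → HitWith K n y := by
  have H (f : Tables n) : ∃ G, cost (numGates G) ≤ 2 ^ n ∧ ∀ j, gateOut G (point j) = f.1 j := f.2
  choose G h1 h2 using H
  obtain ⟨b, hb⟩ := (Set.finite_range fun f => (G f).length).bddAbove
  refine ⟨n + 1 + b, fun K hK y hy hl => ?_⟩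
  have hG := hb ⟨⟨_, hy⟩, rfl⟩
  simp only at hG
  obtain ⟨m, hm⟩ := Nat.exists_eq_add_of_le (show n + 1 + (G ⟨_, hy⟩).length ≤ K by omega)
  have hr : (List.replicate m true).count false = 0 :=
    List.count_eq_zero.2 (by simp [List.mem_replicate])
  refine ⟨List.replicate n true ++ false :: (G ⟨_, hy⟩ ++ List.replicate m true).reverse, ?_,
    headNum_mk _ _, (passes_false_iff (headNum_mk _ _)).2 ⟨hl, ?_, fun j => ?_⟩⟩
  · simp
    omega
  · rw [gateList_mk, List.reverse_reverse, numGates, List.count_append, hr, add_zero]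
    exact h1 _
  · rw [gateList_mk, List.reverse_reverse, gateState_pad]
    exact h2 _ _

/-- Below `n = 4` the explicit witness bound is not available, but there are finitely many tables,
so a constant `c` covers these cases. -/
theorem exists_forall_hitWith : ∃ c, ∀ n, ∀ K ≥ c, 4 ^ n ≤ K → ∀ y : Str, Hit n y →
    2 ^ (n + 1) ≤ y.length + 1 → HitWith K n y := by
  choose K₀ h using exists_hitWith
  refine ⟨(Finset.range 4).sup K₀, fun n K hK hn y hy hl => ?_⟩
  rcases lt_or_ge n 4 with h4 | h4
  · exact h n K ((Finset.le_sup (f := K₀) (Finset.mem_range.2 h4)).trans hK) y hy hl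
  · exact hy.hitWith h4 hn hl

/-! ### Averages over extensions -/

open Classical in
/-- The proportion of the extensions of `w` by `m` bits that satisfy `P`. -/
def avg (P : Str → Prop) : ℕ → Str → ℝ
  | 0, w => if P w then 1 else 0
  | m + 1, w => (avg P m (w ++ [false]) + avg P m (w ++ [true])) / 2

theorem avg_nonneg (P : Str → Prop) (m : ℕ) (w : Str) : 0 ≤ avg P m w := by
  induction m generalizing w with
  | zero => unfold avg; split <;> norm_num
  | succ m ih => exact div_nonneg (add_nonneg (ih _) (ih _)) (by norm_num)

theorem avg_mono {P P' : Str → Prop} {m : ℕ} {w : Str}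
    (h : ∀ y, y.length = w.length + m → P y → P' y) : avg P m w ≤ avg P' m w := by
  induction m generalizing w with
  | zero =>
    unfold avg
    split_ifs with h1 h2
    · exact le_rfl
    · exact absurd (h w rfl h1) h2
    · exact zero_le_one
    · exact le_rfl
  | succ m ih =>
    have h' (b : Bool) : avg P m (w ++ [b]) ≤ avg P' m (w ++ [b]) :=
      ih fun y hy => h y (by simp at hy; omega)
    exact div_le_div_of_nonneg_right (add_le_add (h' _) (h' _)) (by norm_num)

theorem avg_congr {P P' : Str → Prop} {m : ℕ} {w : Str}
    (h : ∀ y, y.length = w.length + m → (P y ↔ P' y)) : avg P m w = avg P' m w :=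
  le_antisymm (avg_mono fun y hy => (h y hy).1) (avg_mono fun y hy => (h y hy).2)

theorem avg_false (m : ℕ) (w : Str) : avg (fun _ => False) m w = 0 := by
  induction m generalizing w with
  | zero => simp [avg]
  | succ m ih => simp [avg, ih]

theorem finite_extensions (P : Str → Prop) (m : ℕ) (w : Str) :
    {e : Str | e.length = m ∧ P (w ++ e)}.Finite :=
  (List.finite_length_eq Bool m).subset fun _ h => h.1

theorem avg_eq (P : Str → Prop) (m : ℕ) (w : Str) :
    avg P m w = ({e : Str | e.length = m ∧ P (w ++ e)}.ncard : ℝ) / 2 ^ m := by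
  induction m generalizing w with
  | zero =>
    by_cases h : P w
    · have : {e : Str | e.length = 0 ∧ P (w ++ e)} = {[]} := by
        ext e
        simp only [List.length_eq_zero_iff, Set.mem_ofPred_eq, Set.mem_singleton_iff]
        exact ⟨fun h => h.1, fun h' => ⟨h', by simpa [h'] using h⟩⟩
      rw [this]
      simp [avg, h]
    · have : {e : Str | e.length = 0 ∧ P (w ++ e)} = ∅ := by
        refine Set.eq_empty_of_forall_notMem ?_
        rintro e ⟨h1, h2⟩
        rw [List.length_eq_zero_iff] at h1
        exact h (by simpa [h1] using h2)
      rw [this]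
      simp [avg, h]
  | succ m ih =>
    have e : {e : Str | e.length = m + 1 ∧ P (w ++ e)} =
        List.cons false '' {e | e.length = m ∧ P ((w ++ [false]) ++ e)} ∪
        List.cons true '' {e | e.length = m ∧ P ((w ++ [true]) ++ e)} := by
      ext e
      rcases e with _ | ⟨_ | _, e⟩ <;> simp
    rw [e, Set.ncard_union_eq ?_ ((finite_extensions _ _ _).image _)
      ((finite_extensions _ _ _).image _), Set.ncard_image_of_injective _ List.cons_injective,
      Set.ncard_image_of_injective _ List.cons_injective, avg, ih, ih]
    · push_cast
      field_simp
      ring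
    · rw [Set.disjoint_left]
      rintro _ ⟨e, _, rfl⟩ ⟨e', _, h⟩
      simp at h

theorem part_append {n : ℕ} {y e : Str} (h : 2 ^ (n + 1) ≤ y.length + 1) :
    part n (y ++ e) = part n y := by
  ext j
  have := j.2
  rw [pow_succ] at h
  rw [part, part, List.getD_append _ _ _ _ (by omega)]

/-- Bits after the end of the block are irrelevant, so the average stabilizes once the extensions
cover the block. -/
theorem avg_hit_succ {n m : ℕ} {w : Str} (h : 2 ^ (n + 1) ≤ w.length + m + 1) :
    avg (Hit n) (m + 1) w = avg (Hit n) m w := by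
  induction m generalizing w with
  | zero =>
    have h' (b : Bool) : Hit n (w ++ [b]) ↔ Hit n w := by rw [Hit, Hit, part_append h]
    have h'' (b : Bool) : avg (Hit n) 0 (w ++ [b]) = avg (Hit n) 0 w := by
      by_cases hw : Hit n w
      · rw [avg, avg, if_pos hw, if_pos ((h' b).2 hw)]
      · rw [avg, avg, if_neg hw, if_neg fun hb => hw ((h' b).1 hb)]
    change (avg (Hit n) 0 (w ++ [false]) + avg (Hit n) 0 (w ++ [true])) / 2 = _
    rw [h'', h'', add_self_div_two]
  | succ m ih =>
    rw [avg, ih (by simp; omega), ih (by simp; omega)]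
    rfl

theorem avg_hit_eq {n m m' : ℕ} {w : Str} (h : 2 ^ (n + 1) ≤ w.length + m + 1) (hm : m ≤ m') :
    avg (Hit n) m' w = avg (Hit n) m w := by
  induction m', hm using Nat.le_induction with
  | base => rfl
  | succ m' hm ih => rw [avg_hit_succ (by omega), ih]

/-- As long as `w` does not reach the block, the block is uniformly distributed. The induction
extends `w` up to length `2 ^ n - 1`, where the next `2 ^ n` bits are the table. -/
theorem avg_hit_le {n m : ℕ} {w : Str} (h : w.length + 1 ≤ 2 ^ n)
    (hm : 2 ^ (n + 1) ≤ w.length + m + 1) :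
    avg (Hit n) m w ≤ (Tables n).ncard / 2 ^ 2 ^ n := by
  induction m generalizing w with
  | zero =>
    rw [pow_succ] at hm
    omega
  | succ m ih =>
    rcases h.lt_or_eq with h | h
    · have h' (b : Bool) := ih (w := w ++ [b]) (by simpa using h) (by simp; omega)
      rw [avg]
      linarith [h' false, h' true]
    · have e2 : 2 ^ (n + 1) = 2 ^ n + 2 ^ n := by rw [pow_succ, mul_two]
      rw [avg_hit_eq (m := 2 ^ n) (by omega) (by omega), avg_eq]
      refine div_le_div_of_nonneg_right ?_ (by positivity)
      refine Nat.cast_le.2 (Set.ncard_le_ncard_of_injOn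
        (fun e (j : Fin (2 ^ n)) => e.getD j false) ?_ ?_ (Set.toFinite _))
      · rintro e ⟨he, hit⟩
        have : (fun j : Fin (2 ^ n) => e.getD j false) = part n (w ++ e) := by
          ext j
          rw [part, List.getD_append_right _ _ _ _ (by omega)]
          congr 1
          omega
        exact this ▸ hit
      · rintro e ⟨he, -⟩ e' ⟨he', -⟩ hee
        refine List.ext_getElem (by rw [he, he']) fun i h1 h2 => ?_
        have : e.getD i false = e'.getD i false := congrFun hee ⟨i, by omega⟩
        rwa [List.getD_eq_getElem _ _ h1, List.getD_eq_getElem _ _ h2] at this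

theorem avg_hit_le_two_pow {n m : ℕ} {w : Str} (hn : 24 ≤ n) (h : w.length + 1 ≤ 2 ^ n)
    (hm : 2 ^ (n + 1) ≤ w.length + m + 1) :
    avg (Hit n) m w ≤ ((2 : ℝ) ^ (2 ^ ((n + 5) / 2) + 1))⁻¹ := by
  refine (avg_hit_le h hm).trans ?_
  rw [div_le_iff₀ (by positivity), inv_mul_eq_div, le_div_iff₀ (by positivity)]
  exact_mod_cast ncard_tables_mul_le hn

theorem part_prefixOf {n m : ℕ} (S : Cantor) (h : 2 ^ (n + 1) ≤ m + 1) :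
    part n (prefixOf S m) = fun j : Fin (2 ^ n) => S (2 ^ n - 1 + j) := by
  ext j
  have := j.2
  rw [pow_succ] at h
  rw [part, List.getD_eq_getElem _ _ (by simp [prefixOf]; omega)]
  simp [prefixOf]

end CountingMeasure

end

/-! ### The NP entropy rate. -/

noncomputable section

namespace CountingMeasure

open Filter Computability

/-! ### Entropy rates -/

theorem four_pow_eq (m : ℕ) : ∃ t, 4 ^ m = 3 * t + 1 := by
  induction m with
  | zero => exact ⟨0, rfl⟩
  | succ m ih =>
    obtain ⟨t, ht⟩ := ih
    exact ⟨4 * t + 1, by rw [pow_succ, ht]; ring⟩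

/-- Together with `le_four_pow_rounds`, this says that `rounds N` is the least `m` with `3 * N + 1 ≤
4 ^ m`, so `2 ^ rounds N` is of order `√N`. The ceilings do no harm because `4 ^ m` is one modulo
three. -/
theorem rounds_le {N m : ℕ} (h : 3 * N + 1 ≤ 4 ^ m) : rounds N ≤ m := by
  induction m generalizing N with
  | zero =>
    obtain rfl : N = 0 := by
      rw [pow_zero] at h
      omega
    rw [rounds]
  | succ m ih =>
    rcases N with _ | N
    · rw [rounds]
      exact Nat.zero_le _
    · rw [rounds]
      obtain ⟨t, ht⟩ := four_pow_eq m
      rw [pow_succ, ht] at h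
      exact Nat.succ_le_succ (ih (by omega))

theorem le_four_pow_rounds (N : ℕ) : 3 * N + 1 ≤ 4 ^ rounds N := by
  induction N using Nat.strong_induction_on with
  | _ N ih =>
    rcases N with _ | N
    · simp [rounds]
    · have := ih ((N + 3) / 4) (by omega)
      rw [rounds, pow_succ]
      omega

/-- From `f ≥ (i + 16) ^ 2`, the exponent `f` dominates both `i` and the logarithm of `f ^ 4`. The
product `(N + 1) * (N + 2)` is chosen so that the reciprocals telescope. -/
theorem summand_bound {i N f : ℕ} (hN : (i + 16) ^ 4 ≤ N) (hf : N + 1 ≤ f * f) :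
    2 ^ i * ((N + 1) * (N + 2)) ≤ 2 ^ f := by
  have h1 : (i + 16) * (i + 16) ≤ f := by
    by_contra h
    have := Nat.mul_self_le_mul_self (not_le.1 h).le
    have e : (i + 16) ^ 4 = (i + 16) * (i + 16) * ((i + 16) * (i + 16)) := by ring
    omega
  have h2 : 16 * (i + 16) ≤ f := (Nat.mul_le_mul_right _ (by omega)).trans h1
  have h3 : f ≤ 16 * (f / 8) := by omega
  have h4 : f / 8 < 2 ^ (f / 8) := Nat.lt_two_pow_self
  have h5 : f ≤ 2 ^ (f / 8 + 4) := by
    rw [pow_add]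
    omega
  have h6 : 1 ≤ f * f := by omega
  calc 2 ^ i * ((N + 1) * (N + 2)) ≤ 2 ^ i * ((f * f) * (2 * (f * f))) :=
        Nat.mul_le_mul_left _ (Nat.mul_le_mul hf (by omega))
    _ = 2 ^ (i + 1) * f ^ 4 := by ring
    _ ≤ 2 ^ (i + 1) * (2 ^ (f / 8 + 4)) ^ 4 :=
        Nat.mul_le_mul_left _ (Nat.pow_le_pow_left h5 4)
    _ = 2 ^ (i + 1 + (f / 8 + 4) * 4) := by rw [← pow_mul, ← pow_add]
    _ ≤ 2 ^ f := Nat.pow_le_pow_right two_pos (by omega)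

theorem sum_range_telescope (M n : ℕ) :
    ∑ k ∈ Finset.range n, (((k + M + 1 : ℕ) : ℝ) * ((k + M + 2 : ℕ) : ℝ))⁻¹ =
      ((M + 1 : ℕ) : ℝ)⁻¹ - ((n + M + 1 : ℕ) : ℝ)⁻¹ := by
  induction n with
  | zero => simp
  | succ n ih =>
    rw [Finset.sum_range_succ, ih]
    push_cast
    field_simp
    ring

theorem sum_range_two_pow_rounds_le (i n : ℕ) :
    ∑ k ∈ Finset.range n, ((2 : ℝ) ^ 2 ^ rounds (k + (i + 16) ^ 4))⁻¹ ≤ ((2 : ℝ) ^ i)⁻¹ := by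
  set M := (i + 16) ^ 4
  have h (k : ℕ) : ((2 : ℝ) ^ 2 ^ rounds (k + M))⁻¹ ≤
      ((2 : ℝ) ^ i)⁻¹ * (((k + M + 1 : ℕ) : ℝ) * ((k + M + 2 : ℕ) : ℝ))⁻¹ := by
    rw [← mul_inv]
    refine inv_anti₀ (by positivity) ?_
    have e := le_four_pow_rounds (k + M)
    rw [show 4 = 2 * 2 by rfl, mul_pow] at e
    exact_mod_cast summand_bound (i := i) (N := k + M) (by omega) (by omega)
  calc _ ≤ ∑ k ∈ Finset.range n,
        ((2 : ℝ) ^ i)⁻¹ * (((k + M + 1 : ℕ) : ℝ) * ((k + M + 2 : ℕ) : ℝ))⁻¹ :=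
        Finset.sum_le_sum fun k _ => h k
    _ ≤ ((2 : ℝ) ^ i)⁻¹ * 1 := by
        rw [← Finset.mul_sum, sum_range_telescope]
        refine mul_le_mul_of_nonneg_left ?_ (by positivity)
        have : ((M + 1 : ℕ) : ℝ)⁻¹ ≤ 1 := 
          inv_le_one_of_one_le₀ (by push_cast; linarith [M.cast_nonneg (α := ℝ)])
        have : (0 : ℝ) ≤ ((n + M + 1 : ℕ) : ℝ)⁻¹ := by positivity
        linarith
    _ = _ := mul_one _

theorem pConvergent_two_pow_rounds :
    PConvergent fun n => ((2 : ℝ) ^ 2 ^ rounds n)⁻¹ := by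
  refine ⟨fun n => by positivity, ?_, fun i => (i + 16) ^ 4, polyTime_pow4 16, fun i => ?_⟩
  · rw [← summable_nat_add_iff ((0 + 16) ^ 4)]
    exact summable_of_sum_range_le (fun n => by positivity) (sum_range_two_pow_rounds_le 0)
  · exact Real.tsum_le_of_sum_range_le (fun n => by positivity) (sum_range_two_pow_rounds_le i)

/-- The strings with a cheap complete part, verified by strings of the given polynomial length. -/
def cheapStrings (c : ℕ) : Lang :=
  {x | ∃ u : Str, u.length = (x.length + c) ^ 4 ∧ Passes true u.reverse x}

theorem cheapStrings_mem_NP (c : ℕ) : cheapStrings c ∈ NP :=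
  ⟨(.X + .C c) ^ 4, _, polyTime_passes, fun x => by simp [cheapStrings]⟩

/-- Maximality of the block forces `n` to be determined by `N`, so no union over `n` is needed and
the proportion bound applies directly. -/
theorem ncard_cheapStrings_lt (c N : ℕ) (hN : 2 ^ 25 ≤ N) :
    (Set.ncard {x : Str | x ∈ cheapStrings c ∧ x.length = N} : ℝ) <
      (2 : ℝ) ^ ((N : ℤ) - ((2 ^ rounds N : ℕ) : ℤ)) := by
  obtain ⟨n, hn, hn24⟩ : ∃ n, Nat.size (N + 1) = n + 2 ∧ 24 ≤ n := by
    have : 25 < Nat.size (N + 1) := Nat.lt_size.2 (by omega)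
    exact ⟨Nat.size (N + 1) - 2, by omega, by omega⟩
  have h1 : 2 ^ (n + 1) ≤ N + 1 := Nat.lt_size.1 (by omega)
  have h2 : N + 1 < 2 ^ (n + 2) := Nat.size_le.1 (by omega)
  have hsub : {x : Str | x ∈ cheapStrings c ∧ x.length = N} ⊆
      {e : Str | e.length = N ∧ Hit n ([] ++ e)} := by
    rintro x ⟨⟨u, -, hu⟩, rfl⟩
    obtain ⟨h3, h4⟩ := passes_true_iff.1 hu
    have h5 := HitWith.hit ⟨_, rfl, rfl, h3⟩
    have h6 := (Nat.pow_lt_pow_iff_right one_lt_two).1 (h1.trans_lt h4)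
    have h7 := (Nat.pow_lt_pow_iff_right one_lt_two).1 (h5.1.trans_lt h2)
    obtain rfl : headNum u.reverse = n := by omega
    exact ⟨rfl, h5.2⟩
  have hf : 2 ^ rounds N ≤ 2 ^ ((n + 5) / 2) := by
    refine Nat.pow_le_pow_right two_pos (rounds_le ?_)
    have h3 : 2 ^ (n + 4) ≤ 4 ^ ((n + 5) / 2) := by
      rw [show 4 = 2 ^ 2 by rfl, ← pow_mul]
      exact Nat.pow_le_pow_right two_pos (by omega)
    rw [pow_add] at h2 h3
    omega
  have havg := avg_hit_le_two_pow (w := []) hn24 (by simpa using Nat.one_le_two_pow)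
    (by simpa using h1)
  rw [avg_eq, div_le_iff₀ (by positivity)] at havg
  calc (Set.ncard {x : Str | x ∈ cheapStrings c ∧ x.length = N} : ℝ)
      ≤ ({e : Str | e.length = N ∧ Hit n ([] ++ e)}.ncard : ℝ) :=
        Nat.cast_le.2 (Set.ncard_le_ncard hsub (finite_extensions _ _ _))
    _ ≤ ((2 : ℝ) ^ (2 ^ ((n + 5) / 2) + 1))⁻¹ * 2 ^ N := havg
    _ < ((2 : ℝ) ^ 2 ^ rounds N)⁻¹ * 2 ^ N := by
        -- The additional one in the exponent of the proportion bound gives the strict inequality.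
        refine mul_lt_mul_of_pos_right (inv_strictAnti₀ (by positivity) ?_) (by positivity)
        exact pow_lt_pow_right₀ one_lt_two (by omega)
    _ = _ := by
        rw [zpow_sub₀ two_ne_zero, zpow_natCast, zpow_natCast, inv_mul_eq_div]

theorem entropyRateMeasureZero {X : Set Cantor}
    (hX : ∀ S ∈ X, ∃ᶠ n in atTop, (fun j : Fin (2 ^ n) => S (2 ^ n - 1 + j)) ∈ Tables n) :
    EntropyRateMeasureZero NP X := by
  obtain ⟨c, hc⟩ := exists_forall_hitWith
  refine ⟨cheapStrings c, cheapStrings_mem_NP c, fun n => 2 ^ rounds n, polyTime_powRounds,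
    fun S hS => ?_, ?_, pConvergent_two_pow_rounds⟩
  · refine frequently_atTop.2 fun a => ?_
    obtain ⟨n, hn, hit⟩ := frequently_atTop.1 (hX S hS) a
    have h1 : n + 1 < 2 ^ (n + 1) := Nat.lt_two_pow_self
    have h2 : 2 ^ (n + 1) - 1 + 1 = 2 ^ (n + 1) := by omega
    -- This prefix ends exactly with the block of length `n`, which is therefore its last complete
    -- block.
    refine ⟨2 ^ (n + 1) - 1, by omega, ?_⟩
    have hl : (prefixOf S (2 ^ (n + 1) - 1)).length = 2 ^ (n + 1) - 1 := by simp [prefixOf]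
    have h4 : 4 ^ n ≤ (2 ^ (n + 1) - 1 + c) ^ 4 := by
      have e : 4 ^ n = (2 ^ n) ^ 2 := by rw [← pow_mul, mul_comm, pow_mul]; rfl
      have : 1 ≤ 2 ^ n := Nat.one_le_two_pow
      rw [pow_succ] at h1 ⊢
      rw [e]
      exact (Nat.pow_le_pow_right this (by norm_num)).trans (Nat.pow_le_pow_left (by omega) 4)
    obtain ⟨Q, h5, h6, h7⟩ := hc n _
      ((Nat.le_add_left c (2 ^ (n + 1) - 1)).trans (Nat.le_self_pow (by norm_num) _)) h4
      (prefixOf S (2 ^ (n + 1) - 1)) (by rwa [Hit, part_prefixOf S (by omega)])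
      (by rw [hl]; omega)
    refine ⟨Q.reverse, by rw [List.length_reverse, h5, hl], ?_⟩
    rw [List.reverse_reverse, passes_true_iff, hl, h6]
    refine ⟨h7, ?_⟩
    rw [h2]
    exact Nat.pow_lt_pow_right one_lt_two (by omega)
  · filter_upwards [eventually_ge_atTop (2 ^ 25)] with N hN using ncard_cheapStrings_lt c N hN

end CountingMeasure

end

/-! ### The SpanP-martingale. -/

noncomputable section

namespace CountingMeasure

open Filter Computability

/-! ### Counting transcripts -/

theorem getD_eq_of_transcript_eq {n n' m : ℕ} {y y' : List Bool}
    (h : transcript n y m = transcript n' y' m) {i : ℕ} (hi : i < m) :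
    (Active n i ↔ Active n' i) ∧ y.getD i false = y'.getD i false := by
  induction m with
  | zero => omega
  | succ m ih =>
    rw [transcript, transcript, List.cons.injEq, List.cons.injEq] at h
    rcases Nat.lt_succ_iff_lt_or_eq.1 hi with hi | rfl
    · exact ih h.2.2 hi
    · exact ⟨decide_eq_decide.1 h.1, h.2.1⟩

/-- Position `2 ^ n - 1` is active for `n` and for no other length; completeness of the block
ensures that it occurs in the transcript. -/
theorem transcript_inj {n n' : ℕ} {y y' : List Bool} (hn : 2 ^ (n + 1) ≤ y.length + 1)
    (h : transcript n y y.length = transcript n' y' y'.length) : n = n' ∧ y = y' := by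
  have hl : y.length = y'.length := by
    have := congrArg List.length h
    rw [length_transcript, length_transcript] at this
    omega
  rw [← hl] at h
  constructor
  · have h1 := Nat.one_le_two_pow (n := n)
    rw [pow_succ] at hn
    have ha : Active n (2 ^ n - 1) := active_iff.2 ⟨⟨0, h1⟩, rfl⟩
    have hb := (getD_eq_of_transcript_eq h (i := 2 ^ n - 1) (by omega)).1.1 ha
    rw [Active] at ha hb
    omega
  · refine List.ext_getElem hl fun i h1 h2 => ?_
    have := (getD_eq_of_transcript_eq h h1).2
    rwa [List.getD_eq_getElem _ _ h1, List.getD_eq_getElem _ _ h2] at this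

theorem exists_interleave {K : ℕ} (e Q : List Bool) (he : e.length = K) (hQ : Q.length = K) :
    ∃ u : List Bool, u.length = 2 * K ∧ evens u = e ∧ odds u = Q := by
  induction K generalizing e Q with
  | zero =>
    rw [List.length_eq_zero_iff] at he hQ
    subst he hQ
    exact ⟨[], rfl, rfl, rfl⟩
  | succ K ih =>
    obtain ⟨a, e, rfl⟩ := List.exists_cons_of_length_eq_add_one he
    obtain ⟨b, Q, rfl⟩ := List.exists_cons_of_length_eq_add_one hQ
    obtain ⟨u, h1, h2, h3⟩ := ih e Q (by simpa using he) (by simpa using hQ)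
    exact ⟨a :: b :: u, by simp; omega, by rw [evens, h2], by rw [odds, h3]⟩

theorem length_evens_odds {K : ℕ} (u : List Bool) (hu : u.length = 2 * K) :
    (evens u).length = K ∧ (odds u).length = K := by
  induction K generalizing u with
  | zero =>
    rw [mul_zero, List.length_eq_zero_iff] at hu
    subst hu
    exact ⟨rfl, rfl⟩
  | succ K ih =>
    obtain ⟨a, v, rfl⟩ := List.exists_cons_of_length_eq_add_one (n := 2 * K + 1) hu
    obtain ⟨b, u, rfl⟩ := List.exists_cons_of_length_eq_add_one (n := 2 * K)
      (show v.length = _ from Nat.succ.inj hu)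
    obtain ⟨h1, h2⟩ := ih u (by simpa [mul_add] using hu)
    exact ⟨by simp [evens, h1], by simp [odds, h2]⟩

/-- All witnesses for the same block and extension produce one transcript, and different pairs
produce different ones. So the span counts pairs `(n, e)`, and `B` exceeds every `n` whose block can
be complete. -/
theorem ncard_transducer (w : Str) (r K B : ℕ) (hB : w.length + K + 1 ≤ B) :
    (Set.ncard {y : Str | ∃ u : Str, u.length = 2 * K ∧ transducer ((w, r), u) = some y} : ℝ) =
      (∑ n ∈ Finset.range B, avg (HitWith K n) K w) * 2 ^ K := by
  let T : Finset (Σ _ : ℕ, Str) :=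
    (Finset.range B).sigma fun n => (finite_extensions (HitWith K n) K w).toFinset
  let F : (Σ _ : ℕ, Str) → Str := fun a => transcript a.1 (w ++ a.2) (w ++ a.2).length
  have hT (a : Σ _ : ℕ, Str) (ha : a ∈ T) : a.2.length = K ∧ HitWith K a.1 (w ++ a.2) := by
    simpa [T] using (Finset.mem_sigma.1 ha).2
  have hF : Set.InjOn F T := by
    rintro ⟨n, e⟩ ha ⟨n', e'⟩ - h
    obtain ⟨rfl, h2⟩ := transcript_inj (hT _ ha).2.hit.1 h
    exact congrArg _ (List.append_cancel_left h2)
  have hS : {y : Str | ∃ u : Str, u.length = 2 * K ∧ transducer ((w, r), u) = some y} =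
      F '' T := by
    ext y
    constructor
    · rintro ⟨u, hu, h⟩
      obtain ⟨h1, h2⟩ := length_evens_odds u hu
      unfold transducer at h
      split_ifs at h with hp
      have hw : HitWith K (headNum (odds u).reverse) (w ++ evens u) :=
        ⟨_, by rw [List.length_reverse, h2], rfl, hp⟩
      refine ⟨⟨headNum (odds u).reverse, evens u⟩, ?_, Option.some.inj h⟩
      have h3 := hw.hit.1
      rw [List.length_append, h1] at h3
      have h4 : headNum (odds u).reverse + 1 < 2 ^ (headNum (odds u).reverse + 1) :=
        Nat.lt_two_pow_self
      exact Finset.mem_sigma.2 ⟨Finset.mem_range.2 (by simp only; omega), by simpa [h1] using hw⟩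
    · rintro ⟨a, ha, rfl⟩
      obtain ⟨h1, Q, h2, h3, h4⟩ := hT a ha
      obtain ⟨u, hu, h5, h6⟩ := exists_interleave a.2 Q.reverse h1 (by rwa [List.length_reverse])
      refine ⟨u, hu, ?_⟩
      have h7 : (odds u).reverse = Q := by rw [h6, List.reverse_reverse]
      simp only [transducer, h5, h7, h3, if_pos h4]
      rfl
  rw [hS, hF.ncard_image, Set.ncard_coe_finset, Finset.card_sigma, Finset.sum_mul]
  push_cast
  refine Finset.sum_congr rfl fun n _ => ?_
  rw [avg_eq, div_mul_cancel₀ _ (by positivity), Set.ncard_eq_toFinset_card _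
    (finite_extensions (HitWith K n) K w)]

/-! ### The martingale -/

/-- The probability, given the prefix `w`, that the part at length `n` is cheap. -/
def pr (n : ℕ) (w : Str) : ℝ := avg (Hit n) (2 ^ (n + 1)) w

/-- The expected number of lengths at which the part is cheap. -/
def mart (w : Str) : ℝ := ∑' n, pr n w

theorem pr_nonneg (n : ℕ) (w : Str) : 0 ≤ pr n w := avg_nonneg _ _ _

theorem avg_hit_eq_pr {n m : ℕ} {w : Str} (h : 2 ^ (n + 1) ≤ w.length + m + 1) :
    avg (Hit n) m w = pr n w := by
  rcases le_total m (2 ^ (n + 1)) with hm | hm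
  · exact (avg_hit_eq h hm).symm
  · exact avg_hit_eq (by omega) hm

theorem pr_eq (n : ℕ) (w : Str) : pr n w = (pr n (w ++ [false]) + pr n (w ++ [true])) / 2 := by
  rw [pr, ← avg_hit_succ (by omega)]
  rfl

theorem pr_eq_one {n : ℕ} {w : Str} (h : 2 ^ (n + 1) ≤ w.length + 1) (hit : Hit n w) :
    pr n w = 1 := by
  rw [← avg_hit_eq_pr (m := 0) (by omega), avg, if_pos hit]

/-- Half of `2 ^ ((n + 5) / 2)` is at least `r` and half is at least `n + 1`. The right side is a
geometric series with sum `2 ^ -r`. -/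
theorem pr_le {n r : ℕ} {w : Str} (hn : 24 ≤ n) (h : (w.length + r + 1) ^ 2 ≤ 2 ^ n) :
    pr n w ≤ ((2 : ℝ) ^ r)⁻¹ * (1 / 2 / 2 ^ n) := by
  have hw : w.length + 1 ≤ 2 ^ n := ((by omega : w.length + 1 ≤ w.length + r + 1).trans
    (Nat.le_self_pow two_ne_zero _)).trans h
  refine (avg_hit_le_two_pow hn hw (by omega)).trans ?_
  obtain ⟨k, hk⟩ : ∃ k, (n + 5) / 2 = k + 1 := Nat.exists_eq_add_of_le' (by omega)
  have h1 : n + 1 ≤ 2 ^ k := by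
    obtain ⟨l, hl⟩ : ∃ l, k = l + 2 := Nat.exists_eq_add_of_le' (by omega)
    have : l < 2 ^ l := Nat.lt_two_pow_self
    rw [hl, pow_add]
    omega
  have h2 : r ≤ 2 ^ k := by
    have h3 : 2 ^ n ≤ (2 ^ k) ^ 2 := by
      rw [← pow_mul]
      exact Nat.pow_le_pow_right two_pos (by omega)
    have h4 := (Nat.pow_le_pow_iff_left two_ne_zero).1 (h.trans h3)
    omega
  rw [hk, div_div, one_div, ← mul_inv, ← pow_succ', ← pow_add]
  refine inv_anti₀ (by positivity) (pow_le_pow_right₀ one_le_two ?_)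
  rw [pow_succ]
  omega

theorem summable_pr (w : Str) : Summable fun n => pr n w := by
  set M := (w.length + 0 + 1) ^ 2 + 24
  rw [← summable_nat_add_iff M]
  refine Summable.of_nonneg_of_le (fun n => pr_nonneg _ _) (fun n => ?_)
    ((summable_geometric_two' 1).mul_left ((2 : ℝ) ^ 0)⁻¹ |>.comp_injective (add_left_injective M))
  refine pr_le (by omega) ?_
  have : n + M < 2 ^ (n + M) := Nat.lt_two_pow_self
  omega

theorem isMartingale_mart : IsMartingale mart := by
  refine ⟨fun w => tsum_nonneg fun n => pr_nonneg _ _, fun w => ?_⟩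
  rw [mart, mart, mart, ← (summable_pr _).tsum_add (summable_pr _), ← tsum_div_const]
  exact tsum_congr fun n => pr_eq n w

/-- If `4 ^ n ≤ K`, witnesses and extensions of length `K` suffice and the difference vanishes.
Otherwise `n` is so large that `pr n w` itself is small, and the approximation lies between zero and
it. The summand `2 ^ 12` in `c'` forces `n ≥ 24` in that case. -/
theorem abs_pr_sub_le {c : ℕ} (hc : ∀ n, ∀ K ≥ c, 4 ^ n ≤ K → ∀ y : Str, Hit n y →
    2 ^ (n + 1) ≤ y.length + 1 → HitWith K n y) (n r c' : ℕ) (hc' : c + 2 ^ 12 ≤ c') (w : Str) :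
    |pr n w - avg (HitWith ((w.length + r + c') ^ 4) n) ((w.length + r + c') ^ 4) w| ≤
      ((2 : ℝ) ^ r)⁻¹ * (1 / 2 / 2 ^ n) := by
  set K := (w.length + r + c') ^ 4 with hK
  have hle : w.length + r + c' ≤ K := Nat.le_self_pow (by norm_num) _
  rcases le_or_gt (4 ^ n) K with h | h
  · have h1 : 2 ^ (n + 1) ≤ w.length + K + 1 := by
      rcases n with _ | n
      · omega
      · rw [show 4 = 2 * 2 by rfl, mul_pow] at h
        have := Nat.one_le_two_pow (n := n)
        rw [pow_succ 2 (n + 1)]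
        rw [pow_succ] at h ⊢
        nlinarith
    have : avg (HitWith K n) K w = avg (Hit n) K w := avg_congr fun y hy =>
      ⟨fun h => h.hit.2, fun h' => hc n K (by omega) h y h' (by omega)⟩
    rw [this, avg_hit_eq_pr h1, sub_self, abs_zero]
    positivity
  · have h1 : (w.length + r + c') ^ 2 < 2 ^ n := by
      rw [show 4 = 2 ^ 2 by rfl, ← pow_mul, mul_comm, pow_mul, hK,
        show (w.length + r + c') ^ 4 = ((w.length + r + c') ^ 2) ^ 2 by ring] at h
      exact lt_of_pow_lt_pow_left₀ 2 (by positivity) h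
    have h2 : 24 ≤ n := by
      have : (2 ^ 12) ^ 2 ≤ (w.length + r + c') ^ 2 := Nat.pow_le_pow_left (by omega) 2
      rw [← pow_mul] at this
      exact ((Nat.pow_lt_pow_iff_right one_lt_two).1 (this.trans_lt h1)).le
    have h3 := pr_le (w := w) (r := r) h2 ((Nat.pow_le_pow_left (by omega) 2).trans h1.le)
    have h4 := avg_nonneg (HitWith K n) K w
    have h5 : avg (HitWith K n) K w ≤ pr n w := by
      by_cases h6 : 2 ^ (n + 1) ≤ w.length + K + 1
      · rw [← avg_hit_eq_pr h6]
        exact avg_mono fun y _ h => h.hit.2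
      · refine (avg_mono (P' := fun _ => False) fun y hy h => ?_).trans
          ((avg_false _ _).le.trans (pr_nonneg _ _))
        exact h6 (by have := h.hit.1; omega)
    rw [abs_of_nonneg (by linarith)]
    linarith

theorem isSpanPMartingale_mart : IsSpanPMartingale mart := by
  obtain ⟨c, hc⟩ := exists_forall_hitWith
  refine ⟨isMartingale_mart, fun x => Set.ncard {y : Str | ∃ u : Str,
    u.length = 2 * (x.1.length + x.2 + (c + 2 ^ 12)) ^ 4 ∧ transducer (x, u) = some y},
    fun x => 2 ^ (x.1.length + x.2 + (c + 2 ^ 12)) ^ 4,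
    ⟨2 * (.X + .C (c + 2 ^ 12)) ^ 4, _, polyTime_transducer, fun x => ?_⟩, polyTime_two_pow _,
    fun w r => ⟨_, rfl⟩, fun w r => ?_⟩
  · have e : (encodingStrUnary.encode x).length = x.1.length + x.2 := by
      simp [encodingStrUnary, encodingProd, encodingList, unaryEncodingNat, unaryEncodeNat_eq]
    simp only [e, Polynomial.eval_mul, Polynomial.eval_pow, Polynomial.eval_add,
      Polynomial.eval_X, Polynomial.eval_C, Polynomial.eval_ofNat]
  · dsimp only
    set K := (w.length + r + (c + 2 ^ 12)) ^ 4
    -- For larger `n` no extension by `K` bits completes the block, so the terms vanish and the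
    -- machine's finite sum is the whole series.
    have hb : HasSum (fun n => avg (HitWith K n) K w)
        (∑ n ∈ Finset.range (w.length + K + 1), avg (HitWith K n) K w) := by
      refine hasSum_sum_of_ne_finset_zero fun n hn => le_antisymm ?_ (avg_nonneg _ _ _)
      rw [Finset.mem_range, not_lt] at hn
      have : n + 1 < 2 ^ (n + 1) := Nat.lt_two_pow_self
      refine (avg_mono (P' := fun _ => False) fun y hy h => ?_).trans (avg_false _ _).le
      have := h.hit.1
      omega
    have hd := (summable_pr w).hasSum.sub hb
    have hg := (hasSum_geometric_two' 1).mul_left ((2 : ℝ) ^ r)⁻¹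
    have hle (n : ℕ) := abs_le.1 (abs_pr_sub_le hc n r _ le_rfl w)
    rw [ncard_transducer w r K _ le_rfl, Nat.cast_pow, Nat.cast_ofNat,
      mul_div_cancel_right₀ _ (by positivity), abs_le]
    rw [mul_one] at hg
    exact ⟨hasSum_le (fun n => (hle n).1) hg.neg hd, hasSum_le (fun n => (hle n).2) hd hg⟩

theorem spanPMeasureZero {X : Set Cantor}
    (hX : ∀ S ∈ X, ∃ᶠ n in atTop, (fun j : Fin (2 ^ n) => S (2 ^ n - 1 + j)) ∈ Tables n) :
    SpanPMeasureZero X := by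
  refine ⟨mart, isSpanPMartingale_mart, fun S hS => ?_⟩
  have hinf := Nat.frequently_atTop_iff_infinite.1 (hX S hS)
  have ht : Tendsto (fun n => mart (prefixOf S n)) atTop atTop := by
    refine tendsto_atTop.2 fun b => ?_
    obtain ⟨k, hk⟩ := exists_nat_ge b
    -- Choose `k` cheap blocks; once the prefix covers them, each contributes one to the
    -- expectation.
    obtain ⟨F, hF, hc⟩ := hinf.exists_subset_card_eq k
    filter_upwards [eventually_ge_atTop (2 ^ (F.sup id + 1))] with N hN
    have hone : ∀ n ∈ F, pr n (prefixOf S N) = 1 := fun n hn => by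
      have h1 : 2 ^ (n + 1) ≤ N := (Nat.pow_le_pow_right two_pos
        (Nat.succ_le_succ (Finset.le_sup (f := id) hn))).trans hN
      refine pr_eq_one (by simp [prefixOf]; omega) ?_
      rw [Hit, part_prefixOf S (by omega)]
      exact hF hn
    calc b ≤ k := hk
      _ = ∑ n ∈ F, pr n (prefixOf S N) := by
          rw [Finset.sum_congr rfl hone, Finset.sum_const, hc, nsmul_one]
      _ ≤ _ := (summable_pr _).sum_le_tsum _ fun n _ => pr_nonneg _ _
  exact ((EReal.tendsto_coe_nhds_top_iff).2 ht).limsup_eq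

end CountingMeasure

end

theorem mainTheorem1 (α : ℝ) (hα : α < 1) :
    CountingMeasure.SpanPMeasureZero
      (CountingMeasure.toCantor (CountingMeasure.SIZEio
        fun n : ℕ => (2 : ℝ) ^ n / n * (1 + α * Real.logb 2 n / n))) ∧
    CountingMeasure.EntropyRateMeasureZero CountingMeasure.NP
      (CountingMeasure.toCantor (CountingMeasure.SIZEio
        fun n : ℕ => (2 : ℝ) ^ n / n * (1 + α * Real.logb 2 n / n))) := by
  have h : ∀ S ∈ CountingMeasure.toCantor (CountingMeasure.SIZEio
      fun n : ℕ => (2 : ℝ) ^ n / n * (1 + α * Real.logb 2 n / n)),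
      ∃ᶠ n in Filter.atTop,
        (fun j : Fin (2 ^ n) => S (2 ^ n - 1 + j)) ∈ CountingMeasure.Tables n := by
    rintro _ ⟨A, hA, rfl⟩
    exact CountingMeasure.frequently_mem_tables hα hA
  exact ⟨CountingMeasure.spanPMeasureZero h, CountingMeasure.entropyRateMeasureZero h⟩
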